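/- All graphs are finite and simple. For $\epsilon>0$, a graph $G$ is \emph{$\epsilon$-coherent} if $|V(G)|\ge 2$; every vertex $v$ of $G$ has fewer than $\epsilon|V(G)|$ neighbours; and $\min(|A|,|B|)<\epsilon|V(G)|$ for all disjoint sets $A,B\subseteq V(G)$ with no edge of $G$ between $A$ and $B$. An \emph{ideal} of graphs is a class of graphs closed under isomorphism and under taking induced subgraphs. It is \emph{incoherent} if for some $\epsilon>0$ none of its members is $\epsilon$-coherent, and \emph{coherent} otherwise. For a graph $H$ and a path $P$ of $H$ (a path has at least one vertex), a \emph{$P$-filleting} of $H$ is any graph isomorphic to one obtained from $H$ by subdividing at least once every edge of $H$ not in $E(P)$, and not subdividing the edges in $E(P)$. \textbf{Theorem.} Let $H$ be a graph and let $P$ be a path of $H$. Then every coherent ideal contains a $P$-filleting of $H$. Equivalently, the ideal of all graphs with no induced subgraph that is a $P$-filleting of $H$ is incoherent. -/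

import Mathlib

universe u v

/-- Two sets of vertices are anticomplete if they are disjoint and no vertex of the first has a
neighbour in the second. -/
def SimpleGraph.Anticomplete {V : Type u} (G : SimpleGraph V) (A B : Set V) : Prop :=
  Disjoint A B ∧ ∀ a ∈ A, ∀ b ∈ B, ¬ G.Adj a b

/-- `ε`-coherent graphs. The first clause also forces the vertex set to be finite, since
`Nat.card` of an infinite type is `0`. -/
structure SimpleGraph.IsCoherent {V : Type u} (G : SimpleGraph V) (ε : ℝ) : Prop where
  two_le_card : 2 ≤ Nat.card V
  card_neighborSet_lt : ∀ v : V, ((G.neighborSet v).ncard : ℝ) < ε * Nat.card V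
  min_card_lt : ∀ A B : Set V, G.Anticomplete A B →
    (min A.ncard B.ncard : ℝ) < ε * Nat.card V

/-- An ideal of (finite, simple) graphs: a class of finite graphs closed under isomorphism and
under taking induced subgraphs. -/
structure GraphIdeal where
  Mem : ∀ {V : Type u}, SimpleGraph V → Prop
  finite_of_mem : ∀ {V : Type u} (G : SimpleGraph V), Mem G → Finite V
  mem_of_iso : ∀ {V V' : Type u} (G : SimpleGraph V) (G' : SimpleGraph V'),
    G ≃g G' → Mem G → Mem G'
  mem_induce : ∀ {V : Type u} (G : SimpleGraph V) (s : Set V), Mem G → Mem (G.induce s)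

/-- An ideal is incoherent if for some `ε > 0` none of its members is `ε`-coherent. -/
def GraphIdeal.Incoherent (I : GraphIdeal.{u}) : Prop :=
  ∃ ε : ℝ, 0 < ε ∧ ∀ (V : Type u) (G : SimpleGraph V), I.Mem G → ¬ G.IsCoherent ε

/-- An ideal is coherent if it is not incoherent. -/
def GraphIdeal.Coherent (I : GraphIdeal.{u}) : Prop := ¬ I.Incoherent

/-- A presentation of `J` as a subdivision of `H`: the vertices of `H` are placed injectively in
`J`, every edge of `H` is replaced by a path of `J` between the images of its ends, these paths
meet the images of the vertices of `H`, and each other, only in ends of the edges concerned, and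
`J` has no further vertices or edges. The paths are indexed by the oriented edges (darts) of `H`,
and the two orientations of an edge give the same path traversed in opposite directions. -/
structure SimpleGraph.Subdivision {W : Type v} {V : Type u}
    (H : SimpleGraph W) (J : SimpleGraph V) where
  branch : W → V
  branch_injective : Function.Injective branch
  path : ∀ d : H.Dart, J.Walk (branch d.fst) (branch d.snd)
  isPath : ∀ d : H.Dart, (path d).IsPath
  path_symm : ∀ d : H.Dart, path d.symm = (path d).reverse
  eq_end_of_branch_mem : ∀ (d : H.Dart) (w : W),
    branch w ∈ (path d).support → w = d.fst ∨ w = d.snd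
  mem_range_of_mem_of_mem : ∀ (d d' : H.Dart), d.edge ≠ d'.edge →
    ∀ x : V, x ∈ (path d).support → x ∈ (path d').support → x ∈ Set.range branch
  vertex_covered : ∀ x : V, x ∈ Set.range branch ∨ ∃ d : H.Dart, x ∈ (path d).support
  edge_covered : ∀ e ∈ J.edgeSet, ∃ d : H.Dart, e ∈ (path d).edges

/-- `J` is (isomorphic to) a `P`-filleting of `H`: a graph obtained from `H` by subdividing at
least once every edge not in `P` and not subdividing the edges of `P`. -/
def SimpleGraph.IsFilleting {W : Type v} {V : Type u} (H : SimpleGraph W) {a b : W}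
    (P : H.Walk a b) (J : SimpleGraph V) : Prop :=
  ∃ S : H.Subdivision J, ∀ d : H.Dart,
    (d.edge ∈ P.edges → (S.path d).length = 1) ∧
    (d.edge ∉ P.edges → 2 ≤ (S.path d).length)

/-- The ideal of finite graphs that have no induced subgraph isomorphic to a `P`-filleting
of `H`. -/
def GraphIdeal.filletingFree {W : Type v} (H : SimpleGraph W) {a b : W} (P : H.Walk a b) :
    GraphIdeal.{u} where
  Mem {V} G := Finite V ∧
    ∀ (U : Type u) (J : SimpleGraph U), H.IsFilleting P J → ¬ J.IsIndContained G
  finite_of_mem _ h := h.1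
  mem_of_iso _ _ e h :=
    ⟨haveI := h.1; Finite.of_equiv _ e.toEquiv,
      fun U J hJ hc => h.2 U J hJ (hc.elim fun f => ⟨e.symm.toEmbedding.comp f⟩)⟩
  mem_induce _ s h :=
    ⟨haveI := h.1; inferInstance,
      fun U J hJ hc => h.2 U J hJ (hc.elim fun f => ⟨(SimpleGraph.Embedding.induce s).comp f⟩)⟩

/-! It suffices to find `ε`, depending on `H` and `P` only, such that every `ε`-coherent graph has
an induced `P`-filleting of `H` (`filleting_ideals_of_quantitative`). Place the vertices of `H` on a
line so that the consecutive pairs are exactly the edges of `P`. A filleting can then be read off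
from a rake: an induced path together with one connected set for each remaining edge, attached to
the path exactly at the two positions of its ends, these sets being pairwise anticomplete. Shortest
paths through the sets are the subdivided edges (`exists_isFilleting_of_hasRake`).

A rake arises from a comb, an induced path whose vertices carry many pairwise anticomplete connected
legs, by linking legs in pairs. The danger is that a link creates unwanted edges. To prevent this,
every leg contains the core of a gadget: a connected set `K p` with a large block `E p` at distance
two, joined to the core by attachments `lam p x`. Half of each block is kept in reserve. A comb has
boundedly many vertices outside its cores, and each of those that matter is adjacent to few reserve
vertices and to few of their attachments. So most of any two reserves is clear of the rest, and
coherence provides an edge between the clear parts, which links the two legs (`exists_links`,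
`Comb.hasRake`).

Gadgets exist by a dichotomy (`CoherentAt.exists_isPool`). If every set of half the vertices has a
vertex with a large second neighbourhood inside it, that vertex is a core. If not, inside some large
set all second neighbourhoods are small, and a connected set grown one vertex at a time has, at the
right moment, a ball of radius two of suitable size. Gadgets are added one by one
(`PartialPool.extend`), and double counting keeps the edges between them sparse.

Combs are built by a game with tokens. A token is a large family of candidates for one rooted
structure, all with the same cores. Collect roots of a token `X` until their neighbours include a
fixed amount of the roots of some other token `Z`. The roots of `Z` that are hit acquire a structure
of `X` as a child, `X` is used up, and every other token keeps many roots with no neighbour among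
the collected ones (`Token.exists_first_hit`). The child is a new leg; or, if its root already has
`A` legs, the spine of `X` is prolonged by the root of `Z`. Levels order the pairs (spine length,
legs at the root) lexicographically. When the roots of a token are distinct vertices, coherence
guarantees a hit, and the sum of `2 ^ level` never drops, so the tokens merge into one of high level
(`RootedFamily.hasHead`).

Initially the roots are attachments, of which there may be very few distinct ones, so coherence says
nothing about them. But each attachment is adjacent to its own block vertex. Hence an attachment
token hits another token or the pool of unused block vertices; in the latter case these vertices
become its new, distinct roots. A more delicate potential, `tokenWeight`, shows that this game
reaches a high level or produces many rooted tokens (`GameState.hasHead`). -/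

namespace SimpleGraph

/-- In a coherent graph with small parameter, two large disjoint sets are joined by an edge. -/
theorem IsCoherent.exists_adj {V : Type u} {G : SimpleGraph V} {ε : ℝ} (h : G.IsCoherent ε)
    {A B : Set V} (hd : Disjoint A B) (hA : ε * Nat.card V ≤ A.ncard)
    (hB : ε * Nat.card V ≤ B.ncard) : ∃ a ∈ A, ∃ b ∈ B, G.Adj a b := by
  by_contra hc
  push Not at hc
  exact absurd (h.min_card_lt A B ⟨hd, hc⟩) (not_lt.mpr (le_min hA hB))

theorem IsCoherent.finite {V : Type u} {G : SimpleGraph V} {ε : ℝ} (h : G.IsCoherent ε) :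
    Finite V :=
  Nat.finite_of_card_ne_zero (by have := h.two_le_card; omega)

/-- The quantitative form of the theorem implies the statement about ideals. -/
theorem filleting_ideals_of_quantitative {W : Type v} (H : SimpleGraph W) {a b : W}
    (P : H.Walk a b)
    (hq : ∃ ε : ℝ, 0 < ε ∧ ∀ (V : Type u) (G : SimpleGraph V), G.IsCoherent ε →
      ∃ s : Set V, H.IsFilleting P (G.induce s)) :
    (∀ I : GraphIdeal.{u}, I.Coherent →
      ∃ (V : Type u) (J : SimpleGraph V), I.Mem J ∧ H.IsFilleting P J) ∧
    (GraphIdeal.filletingFree.{u, v} H P).Incoherent := by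
  obtain ⟨ε, hε, hq⟩ := hq
  have key : ∀ I : GraphIdeal.{u}, I.Coherent →
      ∃ (V : Type u) (J : SimpleGraph V), I.Mem J ∧ H.IsFilleting P J := by
    intro I hI
    by_contra hc
    push Not at hc
    refine hI ⟨ε, hε, fun V G hG hcoh => ?_⟩
    obtain ⟨s, hs⟩ := hq V G hcoh
    exact hc _ _ (I.mem_induce G s hG) hs
  refine ⟨key, ?_⟩
  by_contra hc
  obtain ⟨V, J, hJ, hf⟩ := key _ hc
  exact hJ.2 V J hf ⟨Embedding.refl⟩

end SimpleGraph

/-! ### Connected sets in coherent graphs, and the existence of gadgets. -/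

namespace SimpleGraph

open scoped Classical

variable {V : Type u}

/-- A set of vertices is connected if it induces a connected graph. -/
abbrev ConnSet (G : SimpleGraph V) (X : Set V) : Prop := (G.induce X).Connected

theorem connSet_singleton (G : SimpleGraph V) (v : V) : G.ConnSet {v} := by
  unfold ConnSet
  have : Subsingleton ({v} : Set V) := inferInstance
  exact { preconnected := fun a b => by rw [Subsingleton.elim a b], nonempty := ⟨⟨v, rfl⟩⟩ }

theorem ConnSet.union_of_adj {G : SimpleGraph V} {X Y : Set V} (hX : G.ConnSet X)
    (hY : G.ConnSet Y) {x y : V} (hx : x ∈ X) (hy : y ∈ Y) (h : G.Adj x y) :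
    G.ConnSet (X ∪ Y) :=
  connected_induce_union hX.preconnected hY.preconnected hx hy h

theorem ConnSet.insert_of_adj {G : SimpleGraph V} {X : Set V} (hX : G.ConnSet X) {x y : V}
    (hx : x ∈ X) (h : G.Adj x y) : G.ConnSet (insert y X) := by
  rw [Set.insert_eq, Set.union_comm]
  exact hX.union_of_adj (G.connSet_singleton y) hx rfl h

theorem ConnSet.nonempty {G : SimpleGraph V} {X : Set V} (hX : G.ConnSet X) : X.Nonempty := by
  obtain ⟨x⟩ := Connected.nonempty hX
  exact ⟨x, x.2⟩

/-- A connected set has an edge leaving every proper nonempty subset. -/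
theorem ConnSet.exists_adj_diff {G : SimpleGraph V} {X K : Set V} (hX : G.ConnSet X) {a b : V}
    (ha : a ∈ K) (haX : a ∈ X) (hb : b ∈ X) (hbK : b ∉ K) :
    ∃ x ∈ K, ∃ y ∈ X, y ∉ K ∧ G.Adj x y := by
  obtain ⟨w⟩ := hX.preconnected ⟨a, haX⟩ ⟨b, hb⟩
  obtain ⟨d, -, h1, h2⟩ := w.exists_boundary_dart (Subtype.val ⁻¹' K) ha hbK
  exact ⟨d.fst, h1, d.snd, d.snd.2, h2, d.adj⟩

/-- Absolute form of coherence: degrees are less than `e`, and any two disjoint sets of at least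
`e` vertices are joined by an edge. -/
structure CoherentAt [Fintype V] (G : SimpleGraph V) (e : ℝ) : Prop where
  degree_lt : ∀ v, ((Finset.univ.filter fun u => G.Adj v u).card : ℝ) < e
  exists_adj : ∀ A B : Finset V, Disjoint A B → e ≤ A.card → e ≤ B.card →
    ∃ a ∈ A, ∃ b ∈ B, G.Adj a b

theorem IsCoherent.coherentAt [Fintype V] {G : SimpleGraph V} {ε : ℝ} (h : G.IsCoherent ε) :
    G.CoherentAt (ε * Fintype.card V) := by
  refine ⟨fun v => ?_, fun A B hd hA hB => ?_⟩
  · have := h.card_neighborSet_lt v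
    rw [Nat.card_eq_fintype_card] at this
    convert this
    rw [← Set.ncard_coe_finset]
    congr 1
    ext; simp
  · obtain ⟨a, ha, b, hb, hab⟩ := h.exists_adj (A := A) (B := B) (by exact_mod_cast hd)
      (by simpa [Set.ncard_coe_finset] using hA) (by simpa [Set.ncard_coe_finset] using hB)
    exact ⟨a, by simpa using ha, b, by simpa using hb, hab⟩

variable [Fintype V] {G : SimpleGraph V} {e : ℝ}

theorem CoherentAt.card_filter_adj_lt (h : G.CoherentAt e) (S : Finset V) (v : V) :
    ((S.filter fun u => G.Adj v u).card : ℝ) < e := by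
  refine lt_of_le_of_lt ?_ (h.degree_lt v)
  exact_mod_cast Finset.card_le_card (Finset.filter_subset_filter _ (Finset.subset_univ _))

theorem CoherentAt.card_filter_adj_lt' (h : G.CoherentAt e) (S : Finset V) (v : V) :
    ((S.filter fun u => G.Adj u v).card : ℝ) < e := by
  simpa only [G.adj_comm] using h.card_filter_adj_lt S v

theorem CoherentAt.pos (h : G.CoherentAt e) (v : V) : 0 < e :=
  lt_of_le_of_lt (Nat.cast_nonneg _) (h.degree_lt v)

/-- A large set contains a large connected set. -/
theorem CoherentAt.exists_connSet (h : G.CoherentAt e) {τ : ℝ} {U : Finset V}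
    (he : 0 < e) (hτ : 0 < τ) (hU : 2 * e + τ ≤ U.card) :
    ∃ X ⊆ U, G.ConnSet (X : Set V) ∧ τ ≤ X.card := by
  by_contra hc
  push Not at hc
  -- These are the unions of components of the graph on `U` with fewer than `e + τ` vertices. If
  -- every connected set is smaller than `τ`, a largest such union has at least `e` vertices, since
  -- otherwise one more component could be added. Then it and its complement in `U` contradict
  -- coherence.
  let 𝒴 := U.powerset.filter fun Y : Finset V => (Y.card : ℝ) < e + τ ∧ ∀ y ∈ Y, ∀ u ∈ U, u ∉ Y → ¬ G.Adj y u
  have h0 : ∅ ∈ 𝒴 := by simp [𝒴]; linarith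
  obtain ⟨Y, hY, hmax⟩ := Finset.exists_max_image 𝒴 Finset.card ⟨_, h0⟩
  simp only [𝒴, Finset.mem_filter, Finset.mem_powerset] at hY hmax
  obtain ⟨hYU, hYc, hYcl⟩ := hY
  have hsub : ((U \ Y).card : ℝ) = U.card - Y.card := by
    rw [Finset.card_sdiff_of_subset hYU, Nat.cast_sub (Finset.card_le_card hYU)]
  by_cases hYe : e ≤ Y.card
  · obtain ⟨a, ha, b, hb, hab⟩ := h.exists_adj Y (U \ Y) Finset.disjoint_sdiff hYe
      (by rw [hsub]; linarith)
    rw [Finset.mem_sdiff] at hb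
    exact hYcl a ha b hb.1 hb.2 hab
  push Not at hYe
  have hne : (U \ Y).Nonempty := by
    rw [← Finset.card_pos]
    have : (0 : ℝ) < (U \ Y).card := by rw [hsub]; linarith
    exact_mod_cast this
  obtain ⟨v, hv⟩ := hne
  rw [Finset.mem_sdiff] at hv
  let 𝒳 := U.powerset.filter fun X : Finset V => v ∈ X ∧ G.ConnSet (X : Set V)
  have h1 : {v} ∈ 𝒳 := by
    simp only [𝒳, Finset.mem_filter, Finset.mem_powerset, Finset.singleton_subset_iff,
      Finset.mem_singleton, Finset.coe_singleton]
    exact ⟨hv.1, trivial, G.connSet_singleton v⟩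
  obtain ⟨X, hX, hXmax⟩ := Finset.exists_max_image 𝒳 Finset.card ⟨_, h1⟩
  simp only [𝒳, Finset.mem_filter, Finset.mem_powerset] at hX hXmax
  obtain ⟨hXU, hvX, hXconn⟩ := hX
  have hXc := hc X hXU hXconn
  have hunion : ((X ∪ Y).card : ℝ) ≤ X.card + Y.card := by exact_mod_cast Finset.card_union_le X Y
  have := hmax (X ∪ Y) ⟨Finset.union_subset hXU hYU, by linarith, by
    intro y hy u hu huXY hadj
    rw [Finset.mem_union, not_or] at huXY
    rcases Finset.mem_union.1 hy with hy | hy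
    · have := hXmax (insert u X) ⟨Finset.insert_subset hu hXU, Finset.mem_insert_of_mem hvX, by
        rw [Finset.coe_insert]
        exact hXconn.insert_of_adj (by exact_mod_cast hy) hadj⟩
      rw [Finset.card_insert_of_notMem huXY.1] at this
      omega
    · exact hYcl y hy u hu huXY.2 hadj⟩
  have hlt : Y.card < (X ∪ Y).card :=
    Finset.card_lt_card ⟨Finset.subset_union_right, fun hs =>
      hv.2 (hs (Finset.mem_union_left _ hvX))⟩
  omega

/-- The closed neighbourhood inside `A` of a set of vertices. -/
noncomputable def closedNbhd (G : SimpleGraph V) (A K : Finset V) : Finset V :=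
  A.filter fun a => a ∈ K ∨ ∃ y ∈ K, G.Adj a y

/-- A gadget inside `U`: a connected set `K`, and a set `E` at distance two from it, joined to `K`
by attachments `lam x` chosen in `A`. -/
def HasGadget (G : SimpleGraph V) (τ e : ℝ) (A U : Finset V) : Prop :=
  ∃ (K E : Finset V) (lam : V → V), K ⊆ U ∧ G.ConnSet (K : Set V) ∧ E ⊆ U ∧
    (∀ x ∈ E, lam x ∈ A ∧ lam x ∉ K ∧ G.Adj x (lam x) ∧ ∃ y ∈ K, G.Adj (lam x) y) ∧
    (∀ x ∈ E, ∀ y ∈ K, x ≠ y ∧ ¬ G.Adj x y) ∧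
    ((G.closedNbhd A K).card : ℝ) ≤ 2 * e ∧
    ((U.filter fun u => u ∈ K ∨ (∃ y ∈ K, G.Adj u y) ∨
      ∃ x ∈ E, u = lam x ∨ G.Adj u (lam x)).card : ℝ) ≤ 4 * τ ∧
    τ / 2 ≤ E.card

/-- A vertex with a large second neighbourhood gives a gadget. -/
theorem CoherentAt.hasGadget_of_vertex (h : G.CoherentAt e) {τ : ℝ} {A U : Finset V}
    (hUA : U ⊆ A) (he : 1 ≤ e) (hτ : 4 * e ≤ τ) {v : V} (hv : v ∈ U)
    (hball : τ ≤ (U.filter fun u => ∃ s ∈ U, G.Adj v s ∧ G.Adj s u).card) :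
    G.HasGadget τ e A U := by
  let g : Finset V → Finset V := fun S => U.filter fun u => ∃ s ∈ S, G.Adj s u
  -- Minimality of `S` keeps the second neighbourhood it produces just above `τ`: dropping one
  -- vertex loses fewer than `e`. This bounds the part of the region spoilt by the gadget.
  let 𝒮 := (U.filter fun s => G.Adj v s).powerset.filter fun S => τ ≤ (g S).card
  have h0 : (U.filter fun s => G.Adj v s) ∈ 𝒮 := by
    simp only [𝒮, Finset.mem_filter, Finset.mem_powerset, subset_refl, true_and, g]
    refine hball.trans (Nat.cast_le.2 (Finset.card_le_card fun u hu => ?_))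
    simp only [Finset.mem_filter] at hu ⊢
    obtain ⟨hu, s, hs, h1, h2⟩ := hu
    exact ⟨hu, s, ⟨hs, h1⟩, h2⟩
  obtain ⟨S, hS, hmin⟩ := Finset.exists_min_image 𝒮 Finset.card ⟨_, h0⟩
  simp only [𝒮, Finset.mem_filter, Finset.mem_powerset] at hS hmin
  obtain ⟨hSU, hSτ⟩ := hS
  have hSmem : ∀ s ∈ S, s ∈ U ∧ G.Adj v s := fun s hs => by simpa using hSU hs
  have hgS : ((g S).card : ℝ) < τ + e := by
    have hne : S.Nonempty := by
      rw [Finset.nonempty_iff_ne_empty]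
      rintro rfl
      simp [g] at hSτ
      linarith
    obtain ⟨s, hs⟩ := hne
    have h1 : ((g (S.erase s)).card : ℝ) < τ := by
      by_contra hlt
      push Not at hlt
      have := hmin (S.erase s) ⟨(Finset.erase_subset _ _).trans hSU, hlt⟩
      rw [Finset.card_erase_of_mem hs] at this
      have := Finset.card_pos.2 ⟨s, hs⟩
      omega
    have h2 : g S ⊆ g (S.erase s) ∪ U.filter (fun u => G.Adj s u) := by
      intro u hu
      simp only [g, Finset.mem_union, Finset.mem_filter, Finset.mem_erase] at hu ⊢
      obtain ⟨hu, t, ht, hadj⟩ := hu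
      by_cases hts : t = s
      · subst hts; exact Or.inr ⟨hu, hadj⟩
      · exact Or.inl ⟨hu, t, ⟨hts, ht⟩, hadj⟩
    have h3 := (Finset.card_le_card h2).trans (Finset.card_union_le _ _)
    have h4 := h.card_filter_adj_lt U s
    have h5 : ((g S).card : ℝ) ≤ (g (S.erase s)).card + (U.filter fun u => G.Adj s u).card := by
      exact_mod_cast h3
    linarith
  have hex : ∀ x, x ∈ g S → ∃ s ∈ S, G.Adj s x := fun x hx => (Finset.mem_filter.1 hx).2
  choose! lam hlam using hex
  have hsing : ((U.filter fun u => u = v).card : ℝ) ≤ 1 := by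
    have : (U.filter fun u => u = v) ⊆ {v} := fun u hu => by simpa using (Finset.mem_filter.1 hu).2
    exact_mod_cast (Finset.card_le_card this).trans (by simp)
  have hdeg := h.card_filter_adj_lt' U v
  refine ⟨{v}, (g S).filter fun u => u ≠ v ∧ ¬ G.Adj u v, lam, by simpa using hv,
    by simpa using G.connSet_singleton v, ?_, ?_, ?_, ?_, ?_, ?_⟩
  · exact (Finset.filter_subset _ _).trans (Finset.filter_subset _ _)
  · intro x hx
    have hx' := (Finset.mem_filter.1 hx).1
    obtain ⟨h1, h2⟩ := hlam x hx'
    obtain ⟨h3, h4⟩ := hSmem _ h1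
    exact ⟨hUA h3, by simpa using h4.ne', h2.symm, v, by simp, h4.symm⟩
  · intro x hx y hy
    rw [Finset.mem_singleton] at hy
    subst hy
    exact (Finset.mem_filter.1 hx).2
  · have h1 : G.closedNbhd A {v} ⊆ insert v (A.filter fun u => G.Adj u v) := by
      intro u hu
      simp only [closedNbhd, Finset.mem_filter, Finset.mem_singleton, exists_eq_left,
        Finset.mem_insert] at hu ⊢
      tauto
    have h2 := (Finset.card_le_card h1).trans (Finset.card_insert_le _ _)
    have h3 := h.card_filter_adj_lt' A v
    have h4 : ((G.closedNbhd A {v}).card : ℝ) ≤ (A.filter fun u => G.Adj u v).card + 1 := by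
      exact_mod_cast h2
    linarith
  · have h1 : (U.filter fun u => u ∈ ({v} : Finset V) ∨ (∃ y ∈ ({v} : Finset V), G.Adj u y) ∨
        ∃ x ∈ (g S).filter fun u => u ≠ v ∧ ¬ G.Adj u v, u = lam x ∨ G.Adj u (lam x)) ⊆
        ((U.filter fun u => u = v) ∪ U.filter fun u => G.Adj u v) ∪ g S := by
      intro u hu
      simp only [Finset.mem_filter, Finset.mem_singleton, exists_eq_left, Finset.mem_union] at hu ⊢
      obtain ⟨hu, rfl | h1 | ⟨x, ⟨hx, -⟩, rfl | h1⟩⟩ := hu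
      · exact Or.inl (Or.inl ⟨hu, rfl⟩)
      · exact Or.inl (Or.inr ⟨hu, h1⟩)
      · exact Or.inl (Or.inr ⟨hu, (hSmem _ (hlam x hx).1).2.symm⟩)
      · exact Or.inr (Finset.mem_filter.2 ⟨hu, _, (hlam x hx).1, h1.symm⟩)
    have h2 : ((U.filter fun u => u ∈ ({v} : Finset V) ∨ (∃ y ∈ ({v} : Finset V), G.Adj u y) ∨
        ∃ x ∈ (g S).filter fun u => u ≠ v ∧ ¬ G.Adj u v, u = lam x ∨ G.Adj u (lam x)).card : ℝ) ≤
        (U.filter fun u => u = v).card + (U.filter fun u => G.Adj u v).card + (g S).card := by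
      exact_mod_cast (Finset.card_le_card h1).trans ((Finset.card_union_le _ _).trans
        (Nat.add_le_add_right (Finset.card_union_le _ _) _))
    linarith
  · have h1 : g S ⊆ ((U.filter fun u => u = v) ∪ U.filter fun u => G.Adj u v) ∪
        (g S).filter fun u => u ≠ v ∧ ¬ G.Adj u v := by
      intro u hu
      have : u ∈ U := (Finset.mem_filter.1 hu).1
      simp only [Finset.mem_union, Finset.mem_filter]
      tauto
    have h2 : ((g S).card : ℝ) ≤ (U.filter fun u => u = v).card +
        (U.filter fun u => G.Adj u v).card + ((g S).filter fun u => u ≠ v ∧ ¬ G.Adj u v).card := by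
      exact_mod_cast (Finset.card_le_card h1).trans ((Finset.card_union_le _ _).trans
        (Nat.add_le_add_right (Finset.card_union_le _ _) _))
    linarith

/-- If all second neighbourhoods are small, then a suitable connected set gives a gadget. -/
theorem CoherentAt.hasGadget_of_small_balls (h : G.CoherentAt e) {τ : ℝ} {A U : Finset V}
    (hUA : U ⊆ A) (he : 1 ≤ e) (hτ : 4 * e ≤ τ) (hU : 6 * τ ≤ U.card)
    (hball : ∀ v ∈ A, ((A.filter fun u => ∃ s ∈ A, G.Adj v s ∧ G.Adj s u).card : ℝ) < τ) :
    G.HasGadget τ e A U := by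
  obtain ⟨X, hXU, hX, hXc⟩ := h.exists_connSet (τ := 2 * τ) (U := U) (by linarith) (by linarith)
    (by linarith)
  -- The part in `U` of the ball of radius two around `K`, where the middle vertices of paths of
  -- length two may be anywhere in `A`.
  let g : Finset V → Finset V := fun K => U.filter fun u => u ∈ K ∨ (∃ y ∈ K, G.Adj u y) ∨
    ∃ y ∈ K, ∃ s ∈ A, G.Adj y s ∧ G.Adj s u
  have hg1 : ∀ x ∈ A, ((g {x}).card : ℝ) < τ + 2 * e := by
    intro x hx
    have h1 : g {x} ⊆ insert x (U.filter fun u => G.Adj u x) ∪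
        (A.filter fun u => ∃ s ∈ A, G.Adj x s ∧ G.Adj s u) := by
      intro u hu
      simp only [g, Finset.mem_filter, Finset.mem_singleton, exists_eq_left, Finset.mem_union,
        Finset.mem_insert] at hu ⊢
      obtain ⟨hu, h1 | h1 | h1⟩ := hu
      · exact Or.inl (Or.inl h1)
      · exact Or.inl (Or.inr ⟨hu, h1⟩)
      · exact Or.inr ⟨hUA hu, h1⟩
    have h2 : ((g {x}).card : ℝ) ≤ (U.filter fun u => G.Adj u x).card + 1 +
        (A.filter fun u => ∃ s ∈ A, G.Adj x s ∧ G.Adj s u).card := by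
      exact_mod_cast (Finset.card_le_card h1).trans ((Finset.card_union_le _ _).trans
        (Nat.add_le_add_right (Finset.card_insert_le _ _) _))
    have := h.card_filter_adj_lt' U x
    have := hball x hx
    linarith
  have hgins : ∀ K x, g (insert x K) ⊆ g K ∪ g {x} := by
    intro K x u hu
    simp only [g, Finset.mem_filter, Finset.mem_insert, Finset.mem_union, Finset.mem_singleton,
      exists_eq_left, exists_eq_or_imp] at hu ⊢
    obtain ⟨hu, (h | h) | (h | h) | h | h⟩ := hu
    · exact Or.inr ⟨hu, Or.inl h⟩
    · exact Or.inl ⟨hu, Or.inl h⟩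
    · exact Or.inr ⟨hu, Or.inr (Or.inl h)⟩
    · exact Or.inl ⟨hu, Or.inr (Or.inl h)⟩
    · exact Or.inr ⟨hu, Or.inr (Or.inr h)⟩
    · exact Or.inl ⟨hu, Or.inr (Or.inr h)⟩
  obtain ⟨v, hv⟩ := hX.nonempty
  rw [Finset.mem_coe] at hv
  -- A largest member is not all of `X`, because `X` has at least `2 * τ` vertices and lies in its
  -- own ball. So it can be enlarged inside `X`. One vertex adds fewer than `τ + 2 * e` to the ball,
  -- whose size therefore lands between `2 * τ` and `4 * τ`.
  let 𝒦 := X.powerset.filter fun K : Finset V => v ∈ K ∧ G.ConnSet (K : Set V) ∧ ((g K).card : ℝ) < 2 * τ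
  have h0 : {v} ∈ 𝒦 := by
    simp only [𝒦, Finset.mem_filter, Finset.mem_powerset, Finset.singleton_subset_iff,
      Finset.mem_singleton, Finset.coe_singleton]
    exact ⟨hv, trivial, G.connSet_singleton v, by have := hg1 v (hUA (hXU hv)); linarith⟩
  obtain ⟨K₀, hK₀, hmax⟩ := Finset.exists_max_image 𝒦 Finset.card ⟨_, h0⟩
  simp only [𝒦, Finset.mem_filter, Finset.mem_powerset] at hK₀ hmax
  obtain ⟨hK₀X, hvK₀, hK₀c, hK₀g⟩ := hK₀
  have hne : ∃ b ∈ X, b ∉ K₀ := by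
    by_contra hc
    push Not at hc
    have : X ⊆ g K₀ := fun x hx => Finset.mem_filter.2 ⟨hXU hx, Or.inl (hc x hx)⟩
    have : (X.card : ℝ) ≤ (g K₀).card := by exact_mod_cast Finset.card_le_card this
    linarith
  obtain ⟨b, hb, hbK₀⟩ := hne
  obtain ⟨x, hx, y, hy, hyK₀, hxy⟩ := hX.exists_adj_diff (K := (K₀ : Set V))
    (by exact_mod_cast hvK₀) (by exact_mod_cast hv) (by exact_mod_cast hb) (by exact_mod_cast hbK₀)
  rw [Finset.mem_coe] at hx hy hyK₀
  have hKc : G.ConnSet ((insert y K₀ : Finset V) : Set V) := by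
    rw [Finset.coe_insert]
    exact hK₀c.insert_of_adj (by exact_mod_cast hx) hxy
  have hKU : insert y K₀ ⊆ U := Finset.insert_subset (hXU hy) (hK₀X.trans hXU)
  have hlow : 2 * τ ≤ ((g (insert y K₀)).card : ℝ) := by
    by_contra hc
    push Not at hc
    have := hmax (insert y K₀) ⟨Finset.insert_subset hy hK₀X, Finset.mem_insert_of_mem hvK₀,
      hKc, hc⟩
    rw [Finset.card_insert_of_notMem hyK₀] at this
    omega
  have hup : ((g (insert y K₀)).card : ℝ) ≤ 4 * τ := by
    have h1 : ((g (insert y K₀)).card : ℝ) ≤ (g K₀).card + (g {y}).card := by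
      exact_mod_cast (Finset.card_le_card (hgins _ _)).trans (Finset.card_union_le _ _)
    have := hg1 y (hUA (hXU hy))
    linarith
  generalize insert y K₀ = K at hKc hKU hlow hup
  -- The closed neighbourhood is anticomplete to `U \ g K`, which has at least `2 * τ` vertices, so
  -- coherence makes it small. Hence most of the ball is at distance exactly two.
  have hN : ((G.closedNbhd A K).card : ℝ) < e := by
    by_contra hc
    push Not at hc
    have h1 : e ≤ (U \ g K).card := by
      have h2 : ((U \ g K).card : ℝ) = U.card - (g K).card := by
        rw [Finset.card_sdiff_of_subset (Finset.filter_subset _ _),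
          Nat.cast_sub (Finset.card_le_card (Finset.filter_subset _ _))]
      rw [h2]; linarith
    obtain ⟨a, ha, u, hu, hau⟩ := h.exists_adj (G.closedNbhd A K) (U \ g K) (by
      rw [Finset.disjoint_left]
      intro a ha hb
      simp only [closedNbhd, g, Finset.mem_sdiff, Finset.mem_filter] at ha hb
      exact hb.2 ⟨hb.1, ha.2.imp_right Or.inl⟩) hc h1
    simp only [closedNbhd, g, Finset.mem_sdiff, Finset.mem_filter, not_and] at ha hu
    refine hu.2 hu.1 ?_
    obtain ⟨haA, haK | ⟨z, hz, haz⟩⟩ := ha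
    · exact Or.inr (Or.inl ⟨a, haK, hau.symm⟩)
    · exact Or.inr (Or.inr ⟨z, hz, a, haA, haz.symm, hau⟩)
  have hex : ∀ x, (∃ s, s ∈ A ∧ s ∉ K ∧ (∃ y ∈ K, G.Adj s y) ∧ G.Adj x s) →
    ∃ s, s ∈ A ∧ s ∉ K ∧ (∃ y ∈ K, G.Adj s y) ∧ G.Adj x s := fun _ h => h
  choose! lam hlam using hex
  have hE : ∀ x ∈ g K \ G.closedNbhd A K,
      (∃ s, s ∈ A ∧ s ∉ K ∧ (∃ y ∈ K, G.Adj s y) ∧ G.Adj x s) ∧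
        ∀ y ∈ K, x ≠ y ∧ ¬ G.Adj x y := by
    intro x hx
    simp only [closedNbhd, g, Finset.mem_sdiff, Finset.mem_filter, not_and, not_or, not_exists]
      at hx
    obtain ⟨⟨hxU, hx1⟩, hx2⟩ := hx
    obtain ⟨hx3, hx4⟩ := hx2 (hUA hxU)
    refine ⟨?_, fun y hy => ⟨fun hxy => hx3 (hxy ▸ hy), hx4 y hy⟩⟩
    obtain hx1 | ⟨y, hy, hxy⟩ | ⟨y, hy, s, hs, hys, hsx⟩ := hx1
    · exact absurd hx1 hx3
    · exact absurd hxy (hx4 y hy)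
    · exact ⟨s, hs, fun hsK => hx4 s hsK hsx.symm, ⟨y, hy, hys.symm⟩, hsx.symm⟩
  refine ⟨K, g K \ G.closedNbhd A K, lam, hKU, hKc, ?_, ?_, ?_, by linarith, ?_, ?_⟩
  · exact Finset.sdiff_subset.trans (Finset.filter_subset _ _)
  · intro x hx
    obtain ⟨h1, h2, h3, h4⟩ := hlam x (hE x hx).1
    exact ⟨h1, h2, h4, h3⟩
  · exact fun x hx => (hE x hx).2
  · refine le_trans (Nat.cast_le.2 (Finset.card_le_card ?_)) hup
    intro u hu
    simp only [g, Finset.mem_filter] at hu ⊢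
    obtain ⟨hu, h1 | h1 | ⟨x, hx, h1⟩⟩ := hu
    · exact ⟨hu, Or.inl h1⟩
    · exact ⟨hu, Or.inr (Or.inl h1)⟩
    · obtain ⟨h2, h3, ⟨y, hy, h5⟩, h4⟩ := hlam x (hE x hx).1
      rcases h1 with rfl | h1
      · exact ⟨hu, Or.inr (Or.inl ⟨y, hy, h5⟩)⟩
      · exact ⟨hu, Or.inr (Or.inr ⟨y, hy, lam x, h2, h5.symm, h1.symm⟩)⟩
  · have : ((g K).card : ℝ) ≤ (g K \ G.closedNbhd A K).card + (G.closedNbhd A K).card := by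
      exact_mod_cast Finset.card_le_card_sdiff_add_card
    linarith

end SimpleGraph

/-! ### Pools: many gadgets with sparse interaction. -/

namespace SimpleGraph

open scoped Classical

theorem card_mul_le_card_mul_real {α β : Type*} (S : Finset α) (D : Finset β) (R : α → β → Prop)
    {a b : ℝ} (hS : ∀ x ∈ S, ((D.filter fun u => R x u).card : ℝ) ≤ a)
    (hD : ∀ u ∈ D, b ≤ ((S.filter fun x => R x u).card : ℝ)) :
    D.card * b ≤ S.card * a := by
  have h := Finset.sum_card_bipartiteAbove_eq_sum_card_bipartiteBelow (s := S) (t := D) R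
  have h' : ∑ x ∈ S, ((D.filter fun u => R x u).card : ℝ) =
      ∑ u ∈ D, ((S.filter fun x => R x u).card : ℝ) := by
    exact_mod_cast h
  calc D.card * b = ∑ u ∈ D, b := by simp
    _ ≤ ∑ u ∈ D, ((S.filter fun x => R x u).card : ℝ) := Finset.sum_le_sum hD
    _ = ∑ x ∈ S, ((D.filter fun u => R x u).card : ℝ) := h'.symm
    _ ≤ ∑ x ∈ S, a := Finset.sum_le_sum hS
    _ = S.card * a := by simp

variable {V : Type u} {G : SimpleGraph V} {e : ℝ}

/-- A pool of `N` gadgets: connected cores `K p`, pairwise anticomplete, and disjoint blocks `E p`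
of at least `σ` vertices at distance two from the core `K p`, joined to it by the attachments
`lam p`. Blocks and attachments are anticomplete to all other cores, and no vertex of a block and
no attachment has more than `κ` of the attachments of another gadget as neighbours, counted with
multiplicity. -/
structure IsPool (G : SimpleGraph V) (N : ℕ) (K : ℕ → Finset V) (lam : ℕ → V → V)
    (E : ℕ → Finset V) (κ σ : ℝ) : Prop where
  conn : ∀ p < N, G.ConnSet (K p : Set V)
  core_anti : ∀ p < N, ∀ q < N, p ≠ q → ∀ a ∈ K p, ∀ b ∈ K q, a ≠ b ∧ ¬ G.Adj a b
  lam_adj : ∀ p < N, ∀ x ∈ E p, G.Adj x (lam p x)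
  lam_core : ∀ p < N, ∀ x ∈ E p, ∃ y ∈ K p, G.Adj (lam p x) y
  lam_notMem : ∀ p < N, ∀ x ∈ E p, lam p x ∉ K p
  lam_anti : ∀ p < N, ∀ q < N, p ≠ q → ∀ x ∈ E p, ∀ y ∈ K q, lam p x ≠ y ∧ ¬ G.Adj (lam p x) y
  block_anti : ∀ p < N, ∀ q < N, ∀ x ∈ E p, ∀ y ∈ K q, x ≠ y ∧ ¬ G.Adj x y
  block_disjoint : ∀ p < N, ∀ q < N, p ≠ q → Disjoint (E p) (E q)
  block_card : ∀ p < N, σ ≤ (E p).card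
  lam_lam : ∀ p < N, ∀ q < N, p ≠ q → ∀ i ∈ E q,
    (((E p).filter fun x => G.Adj (lam p x) (lam q i)).card : ℝ) ≤ κ
  lam_block : ∀ p < N, ∀ q < N, ∀ i ∈ E q,
    (((E p).filter fun x => G.Adj (lam p x) i).card : ℝ) ≤ κ

/-- A partial pool of `m` gadgets, together with a region `U` in which the next gadget can be
placed and a set `A` from which its attachments can be taken. -/
structure PartialPool (G : SimpleGraph V) (m : ℕ) (K : ℕ → Finset V) (lam : ℕ → V → V)
    (E : ℕ → Finset V) (A U : Finset V) (κ₁ κ₂ s t : ℝ) : Prop where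
  conn : ∀ p < m, G.ConnSet (K p : Set V)
  core_anti : ∀ p < m, ∀ q < m, p < q → ∀ a ∈ K p, ∀ b ∈ K q, a ≠ b ∧ ¬ G.Adj a b
  lam_adj : ∀ p < m, ∀ x ∈ E p, G.Adj x (lam p x)
  lam_core : ∀ p < m, ∀ x ∈ E p, ∃ y ∈ K p, G.Adj (lam p x) y
  lam_notMem : ∀ p < m, ∀ x ∈ E p, lam p x ∉ K p
  lam_anti : ∀ p < m, ∀ q < m, p ≠ q → ∀ x ∈ E p, ∀ y ∈ K q, lam p x ≠ y ∧ ¬ G.Adj (lam p x) y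
  block_disjoint : ∀ p < m, ∀ q < m, p < q → Disjoint (E p) (E q)
  block_card : ∀ p < m, s ≤ (E p).card
  lam_lam : ∀ p < m, ∀ q < m, p ≠ q → ∀ i ∈ E q,
    (((E p).filter fun x => G.Adj (lam p x) (lam q i)).card : ℝ) ≤ κ₂
  block_subset : ∀ p < m, E p ⊆ A
  region_subset : U ⊆ A
  anti : ∀ a ∈ A, ∀ p < m, ∀ y ∈ K p, a ≠ y ∧ ¬ G.Adj a y
  region_lam : ∀ u ∈ U, ∀ p < m, ∀ x ∈ E p, u ≠ lam p x ∧ ¬ G.Adj u (lam p x)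
  region_disjoint : ∀ p < m, Disjoint U (E p)
  lam_card : ∀ a ∈ A, ∀ p < m, (((E p).filter fun x => G.Adj (lam p x) a).card : ℝ) ≤ κ₁
  region_card : t ≤ U.card

theorem PartialPool.isPool {m : ℕ} {K : ℕ → Finset V} {lam : ℕ → V → V}
    {E : ℕ → Finset V} {A U : Finset V} {κ₁ κ₂ s t : ℝ}
    (h : G.PartialPool m K lam E A U κ₁ κ₂ s t) (hκ : κ₁ ≤ κ₂) : G.IsPool m K lam E κ₂ s where
  conn := h.conn
  core_anti p hp q hq hpq a ha b hb := by
    rcases lt_or_gt_of_ne hpq with hlt | hlt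
    · exact h.core_anti p hp q hq hlt a ha b hb
    · have := h.core_anti q hq p hp hlt b hb a ha
      exact ⟨this.1.symm, fun hab => this.2 hab.symm⟩
  lam_adj := h.lam_adj
  lam_core := h.lam_core
  lam_notMem := h.lam_notMem
  lam_anti := h.lam_anti
  block_anti p hp q hq x hx y hy := h.anti x (h.block_subset p hp hx) q hq y hy
  block_disjoint p hp q hq hpq := by
    rcases lt_or_gt_of_ne hpq with hlt | hlt
    · exact h.block_disjoint p hp q hq hlt
    · exact (h.block_disjoint q hq p hp hlt).symm
  block_card := h.block_card
  lam_lam := h.lam_lam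
  lam_block p hp q hq i hi := (h.lam_card i (h.block_subset q hq hi) p hp).trans hκ

variable [Fintype V]

/-- Two thresholds are needed because attachments leave `A` together with the closed neighbourhood
of their core. Vertices that stay in `A` are controlled by deleting `Dom`, those seeing at least
`κ₁` new attachments; counting edges gives at most `d` of them. Old attachments can no longer be
deleted from `A`; instead, indices in `bad p` are dropped from the old blocks. Every new attachment
comes from `A`, hence sees at most `κ₁` of the attachments of `p`, and a second count with threshold
`κ₂` bounds `bad p` by `r`. An old block thus loses at most `2 * e + d + r`, and the region at most
`4 * τ + d`. -/
theorem PartialPool.extend {m : ℕ} {K : ℕ → Finset V} {lam : ℕ → V → V}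
    {E : ℕ → Finset V} {A U : Finset V} {κ₁ κ₂ s t τ d r : ℝ}
    (hG : G.CoherentAt e) (he : 0 < e) (hκ₁ : 0 < κ₁) (hκ : κ₁ ≤ κ₂) (hd : Fintype.card V * e ≤ κ₁ * d)
    (hr : Fintype.card V * κ₁ ≤ κ₂ * r)
    (h : G.PartialPool m K lam E A U κ₁ κ₂ s t) (hg : G.HasGadget τ e A U) (hs : s ≤ τ / 2) :
    ∃ K' lam' E' A' U', A' ⊆ A ∧ G.PartialPool (m + 1) K' lam' E' A' U' κ₁ κ₂
      (s - (2 * e + d + r)) (t - (4 * τ + d)) := by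
  obtain ⟨K₁, E₁, lam₁, hKU, hKc, hEU, hlam, hEK, hcn, hreg, hEc⟩ := hg
  have hE₁n : (E₁.card : ℝ) ≤ Fintype.card V := by exact_mod_cast Finset.card_le_univ E₁
  let Dom : Finset V := Finset.univ.filter fun u =>
    κ₁ ≤ ((E₁.filter fun x => G.Adj (lam₁ x) u).card : ℝ)
  have hDom : (Dom.card : ℝ) ≤ d := by
    have h1 := card_mul_le_card_mul_real E₁ Dom (fun x u => G.Adj (lam₁ x) u) (a := e) (b := κ₁)
      (fun x _ => (hG.card_filter_adj_lt Dom (lam₁ x)).le) (fun u hu => (Finset.mem_filter.1 hu).2)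
    have h2 : (E₁.card : ℝ) * e ≤ Fintype.card V * e := by gcongr
    have : Dom.card * κ₁ ≤ d * κ₁ := by linarith
    exact le_of_mul_le_mul_right this hκ₁
  let bad : ℕ → Finset V := fun p => (E p).filter fun i =>
    κ₂ ≤ ((E₁.filter fun x => G.Adj (lam₁ x) (lam p i)).card : ℝ)
  have hκ₂ : 0 < κ₂ := hκ₁.trans_le hκ
  have hbad : ∀ p < m, ((bad p).card : ℝ) ≤ r := by
    intro p hp
    have h1 := card_mul_le_card_mul_real E₁ (bad p) (fun x i => G.Adj (lam₁ x) (lam p i))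
      (a := κ₁) (b := κ₂) (fun x hx => by
        refine le_trans (Nat.cast_le.2 (Finset.card_le_card ?_))
          (h.lam_card (lam₁ x) (hlam x hx).1 p hp)
        intro i hi
        simp only [bad, Finset.mem_filter] at hi ⊢
        exact ⟨hi.1.1, hi.2.symm⟩) (fun i hi => (Finset.mem_filter.1 hi).2)
    have h2 : (E₁.card : ℝ) * κ₁ ≤ Fintype.card V * κ₁ := by gcongr
    have : (bad p).card * κ₂ ≤ r * κ₂ := by linarith
    exact le_of_mul_le_mul_right this hκ₂
  let A' : Finset V := A.filter fun a => a ∉ G.closedNbhd A K₁ ∧ a ∉ Dom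
  have hA' : ∀ a ∈ A', a ∈ A ∧ (∀ y ∈ K₁, a ≠ y ∧ ¬ G.Adj a y) ∧
      ((E₁.filter fun x => G.Adj (lam₁ x) a).card : ℝ) ≤ κ₁ := by
    intro a ha
    simp only [A', Dom, closedNbhd, Finset.mem_filter, Finset.mem_univ, true_and, not_and, not_or,
      not_exists, not_le] at ha
    obtain ⟨ha, h1, h2⟩ := ha
    obtain ⟨h3, h4⟩ := h1 ha
    exact ⟨ha, fun y hy => ⟨fun hay => h3 (hay ▸ hy), h4 y hy⟩, h2.le⟩
  let R : Finset V := U.filter fun u => u ∈ K₁ ∨ (∃ y ∈ K₁, G.Adj u y) ∨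
      ∃ x ∈ E₁, u = lam₁ x ∨ G.Adj u (lam₁ x)
  let U' : Finset V := U.filter fun u => u ∉ R ∧ u ∉ Dom
  have hU' : ∀ u ∈ U', u ∈ U ∧ u ∈ A' ∧ ∀ x ∈ E₁, u ≠ lam₁ x ∧ ¬ G.Adj u (lam₁ x) := by
    intro u hu
    simp only [U', R, Finset.mem_filter, not_and, not_or, not_exists] at hu
    obtain ⟨hu, h1, h2⟩ := hu
    obtain ⟨h3, h4, h5⟩ := h1 hu
    refine ⟨hu, Finset.mem_filter.2 ⟨h.region_subset hu, ?_, h2⟩, h5⟩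
    simp only [closedNbhd, Finset.mem_filter, not_and, not_or, not_exists]
    exact fun _ => ⟨h3, h4⟩
  let E₂ : Finset V := E₁.filter fun x => x ∉ Dom
  have hE₂ : ∀ x ∈ E₂, x ∈ E₁ ∧ x ∈ A' := by
    intro x hx
    obtain ⟨hx, hx2⟩ := Finset.mem_filter.1 hx
    refine ⟨hx, Finset.mem_filter.2 ⟨h.region_subset (hEU hx), ?_, hx2⟩⟩
    simp only [closedNbhd, Finset.mem_filter, not_and, not_or, not_exists]
    exact fun _ => ⟨fun hxK => (hEK x hx x hxK).1 rfl, fun y hy => (hEK x hx y hy).2⟩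
  let E₃ : ℕ → Finset V := fun p => (E p).filter fun x => x ∈ A' ∧ x ∉ bad p
  have hE₃ : ∀ p, ∀ x ∈ E₃ p, x ∈ E p ∧ x ∈ A' ∧ x ∉ bad p := fun p x hx => Finset.mem_filter.1 hx
  let K' := fun p => if p < m then K p else K₁
  let lam' := fun p => if p < m then lam p else lam₁
  let E' := fun p => if p < m then E₃ p else E₂
  have K'1 : ∀ p < m, K' p = K p := fun p hp => if_pos hp
  have K'2 : K' m = K₁ := if_neg (lt_irrefl m)
  have l'1 : ∀ p < m, lam' p = lam p := fun p hp => if_pos hp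
  have l'2 : lam' m = lam₁ := if_neg (lt_irrefl m)
  have E'1 : ∀ p < m, E' p = E₃ p := fun p hp => if_pos hp
  have E'2 : E' m = E₂ := if_neg (lt_irrefl m)
  clear_value K' lam' E'
  have hcase : ∀ p < m + 1, p < m ∨ p = m := fun p hp => Nat.lt_succ_iff_lt_or_eq.1 hp
  refine ⟨K', lam', E', A', U', Finset.filter_subset _ _, ?_⟩
  constructor
  · intro p hp
    rcases hcase p hp with hp | rfl
    · rw [K'1 p hp]; exact h.conn p hp
    · rw [K'2]; exact hKc
  · intro p hp q hq hpq a ha b hb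
    rcases hcase q hq with hq | rfl
    · rw [K'1 p (hpq.trans hq)] at ha; rw [K'1 q hq] at hb
      exact h.core_anti p (hpq.trans hq) q hq hpq a ha b hb
    · rw [K'1 p hpq] at ha; rw [K'2] at hb
      have := h.anti b (h.region_subset (hKU hb)) p hpq a ha
      exact ⟨this.1.symm, fun hab => this.2 hab.symm⟩
  · intro p hp x hx
    rcases hcase p hp with hp | rfl
    · rw [E'1 p hp] at hx; rw [l'1 p hp]; exact h.lam_adj p hp x (hE₃ p x hx).1
    · rw [E'2] at hx; rw [l'2]; exact (hlam x (hE₂ x hx).1).2.2.1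
  · intro p hp x hx
    rcases hcase p hp with hp | rfl
    · rw [E'1 p hp] at hx; rw [l'1 p hp, K'1 p hp]; exact h.lam_core p hp x (hE₃ p x hx).1
    · rw [E'2] at hx; rw [l'2, K'2]; exact (hlam x (hE₂ x hx).1).2.2.2
  · intro p hp x hx
    rcases hcase p hp with hp | rfl
    · rw [E'1 p hp] at hx; rw [l'1 p hp, K'1 p hp]; exact h.lam_notMem p hp x (hE₃ p x hx).1
    · rw [E'2] at hx; rw [l'2, K'2]; exact (hlam x (hE₂ x hx).1).2.1
  · intro p hp q hq hpq x hx y hy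
    rcases hcase p hp with hp | rfl <;> rcases hcase q hq with hq | rfl
    · rw [E'1 p hp] at hx; rw [K'1 q hq] at hy; rw [l'1 p hp]
      exact h.lam_anti p hp q hq hpq x (hE₃ p x hx).1 y hy
    · rw [E'1 p hp] at hx; rw [K'2] at hy; rw [l'1 p hp]
      have := h.region_lam y (hKU hy) p hp x (hE₃ p x hx).1
      exact ⟨this.1.symm, fun hab => this.2 hab.symm⟩
    · rw [E'2] at hx; rw [K'1 q hq] at hy; rw [l'2]
      exact h.anti _ (hlam x (hE₂ x hx).1).1 q hq y hy
    · exact absurd rfl hpq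
  · intro p hp q hq hpq
    rw [Finset.disjoint_left]
    intro x hx hy
    rcases hcase q hq with hq | rfl
    · rw [E'1 p (hpq.trans hq)] at hx; rw [E'1 q hq] at hy
      exact Finset.disjoint_left.1 (h.block_disjoint p (hpq.trans hq) q hq hpq)
        (hE₃ p x hx).1 (hE₃ q x hy).1
    · rw [E'1 p hpq] at hx; rw [E'2] at hy
      exact Finset.disjoint_left.1 (h.region_disjoint p hpq) (hEU (hE₂ x hy).1) (hE₃ p x hx).1
  · intro p hp
    rcases hcase p hp with hp | rfl
    · rw [E'1 p hp]
      have h1 : E p ⊆ ((E₃ p ∪ G.closedNbhd A K₁) ∪ Dom) ∪ bad p := by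
        intro x hx
        have := h.block_subset p hp hx
        simp only [E₃, A', Finset.mem_union, Finset.mem_filter]
        tauto
      have h2 : ((E p).card : ℝ) ≤ (E₃ p).card + (G.closedNbhd A K₁).card + Dom.card
          + (bad p).card := by
        exact_mod_cast (Finset.card_le_card h1).trans ((Finset.card_union_le _ _).trans
          (Nat.add_le_add_right ((Finset.card_union_le _ _).trans
          (Nat.add_le_add_right (Finset.card_union_le _ _) _)) _))
      have := hbad p hp
      have := h.block_card p hp
      linarith
    · rw [E'2]
      have h1 : E₁ ⊆ E₂ ∪ Dom := by
        intro x hx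
        simp only [E₂, Finset.mem_union, Finset.mem_filter]
        tauto
      have h2 : (E₁.card : ℝ) ≤ E₂.card + Dom.card := by
        exact_mod_cast (Finset.card_le_card h1).trans (Finset.card_union_le _ _)
      have hr0 : 0 ≤ r := by
        have : 0 ≤ κ₂ * r := le_trans (by positivity) hr
        exact nonneg_of_mul_nonneg_right this hκ₂
      linarith
  · intro p hp q hq hpq i hi
    rcases hcase p hp with hp | rfl <;> rcases hcase q hq with hq | rfl
    · rw [E'1 q hq] at hi; rw [E'1 p hp, l'1 p hp, l'1 q hq]
      refine le_trans (Nat.cast_le.2 (Finset.card_le_card ?_))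
        (h.lam_lam p hp q hq hpq i (hE₃ q i hi).1)
      exact Finset.filter_subset_filter _ (Finset.filter_subset _ _)
    · rw [E'2] at hi; rw [E'1 p hp, l'1 p hp, l'2]
      refine le_trans (Nat.cast_le.2 (Finset.card_le_card ?_))
        ((h.lam_card _ (hlam i (hE₂ i hi).1).1 p hp).trans hκ)
      exact Finset.filter_subset_filter _ (Finset.filter_subset _ _)
    · rw [E'1 q hq] at hi; rw [E'2, l'1 q hq, l'2]
      have h1 := (hE₃ q i hi).2.2
      simp only [bad, Finset.mem_filter, not_and, not_le] at h1
      refine le_trans (Nat.cast_le.2 (Finset.card_le_card ?_)) (h1 (hE₃ q i hi).1).le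
      exact Finset.filter_subset_filter _ (Finset.filter_subset _ _)
    · exact absurd rfl hpq
  · intro p hp x hx
    rcases hcase p hp with hp | rfl
    · rw [E'1 p hp] at hx; exact (hE₃ p x hx).2.1
    · rw [E'2] at hx; exact (hE₂ x hx).2
  · exact fun u hu => (hU' u hu).2.1
  · intro a ha p hp y hy
    rcases hcase p hp with hp | rfl
    · rw [K'1 p hp] at hy; exact h.anti a (hA' a ha).1 p hp y hy
    · rw [K'2] at hy; exact (hA' a ha).2.1 y hy
  · intro u hu p hp x hx
    rcases hcase p hp with hp | rfl
    · rw [E'1 p hp] at hx; rw [l'1 p hp]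
      exact h.region_lam u (hU' u hu).1 p hp x (hE₃ p x hx).1
    · rw [E'2] at hx; rw [l'2]; exact (hU' u hu).2.2 x (hE₂ x hx).1
  · intro p hp
    rw [Finset.disjoint_left]
    intro x hx hy
    rcases hcase p hp with hp | rfl
    · rw [E'1 p hp] at hy
      exact Finset.disjoint_left.1 (h.region_disjoint p hp) (hU' x hx).1 (hE₃ p x hy).1
    · rw [E'2] at hy
      have hx1 := (hE₂ x hy).1
      exact ((hU' x hx).2.2 x hx1).2 (hlam x hx1).2.2.1
  · intro a ha p hp
    rcases hcase p hp with hp | rfl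
    · rw [E'1 p hp, l'1 p hp]
      refine le_trans (Nat.cast_le.2 (Finset.card_le_card ?_)) (h.lam_card a (hA' a ha).1 p hp)
      exact Finset.filter_subset_filter _ (Finset.filter_subset _ _)
    · rw [E'2, l'2]
      refine le_trans (Nat.cast_le.2 (Finset.card_le_card ?_)) (hA' a ha).2.2
      exact Finset.filter_subset_filter _ (Finset.filter_subset _ _)
  · have h1 : U ⊆ (U' ∪ R) ∪ Dom := by
      intro u hu
      simp only [U', Finset.mem_union, Finset.mem_filter]
      tauto
    have h2 : (U.card : ℝ) ≤ U'.card + R.card + Dom.card := by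
      exact_mod_cast (Finset.card_le_card h1).trans ((Finset.card_union_le _ _).trans
        (Nat.add_le_add_right (Finset.card_union_le _ _) _))
    have := h.region_card
    linarith

/-- Pools exist if every large set contains a gadget. -/
theorem exists_partialPool {κ₁ κ₂ τ d r β : ℝ} (hG : G.CoherentAt e) (he : 0 < e) (hκ₁ : 0 < κ₁)
    (hκ : κ₁ ≤ κ₂) (hd : Fintype.card V * e ≤ κ₁ * d) (hr : Fintype.card V * κ₁ ≤ κ₂ * r)
    (hτ : 0 ≤ τ) (hd0 : 0 ≤ d) (hr0 : 0 ≤ r) {A₀ : Finset V} {N : ℕ} (hA₀ : β + N * (4 * τ + d) ≤ A₀.card)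
    (hg : ∀ A ⊆ A₀, ∀ U ⊆ A, β ≤ U.card → G.HasGadget τ e A U) :
    ∀ m ≤ N, ∃ K lam E A U, A ⊆ A₀ ∧ G.PartialPool m K lam E A U κ₁ κ₂
      (τ / 2 - m * (2 * e + d + r)) (A₀.card - m * (4 * τ + d)) := by
  intro m
  induction m with
  | zero =>
    intro _
    refine ⟨fun _ => ∅, fun _ => id, fun _ => ∅, A₀, A₀, subset_rfl, ?_⟩
    constructor <;> simp
  | succ m ih =>
    intro hm
    obtain ⟨K, lam, E, A, U, hA, h⟩ := ih (by omega)
    have hm' : (m : ℝ) ≤ N := by exact_mod_cast (by omega : m ≤ N)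
    have hU : β ≤ U.card := by
      have h1 := h.region_card
      have : (m : ℝ) * (4 * τ + d) ≤ N * (4 * τ + d) := by gcongr
      linarith
    obtain ⟨K', lam', E', A', U', hA', h'⟩ := h.extend hG he hκ₁ hκ hd hr
      (hg A hA U h.region_subset hU) (by
        have : 0 ≤ (m : ℝ) * (2 * e + d + r) := by positivity
        linarith)
    refine ⟨K', lam', E', A', U', hA'.trans hA, ?_⟩
    convert h' using 1 <;> push_cast <;> ring

/-- In a coherent graph there are pools with any prescribed number of gadgets. -/
theorem CoherentAt.exists_isPool (hG : G.CoherentAt e) {κ₁ κ₂ τ d r : ℝ} {N : ℕ} (he : 1 ≤ e)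
    (hκ₁ : 0 < κ₁) (hκ : κ₁ ≤ κ₂) (hd : Fintype.card V * e ≤ κ₁ * d)
    (hr : Fintype.card V * κ₁ ≤ κ₂ * r) (hτ : 4 * e ≤ τ) (hd0 : 0 ≤ d) (hr0 : 0 ≤ r)
    (hn : 12 * τ + 2 * N * (4 * τ + d) ≤ Fintype.card V) :
    ∃ K lam E, G.IsPool N K lam E κ₂ (τ / 2 - N * (2 * e + d + r)) := by
  have he0 : 0 < e := by linarith
  have hτ0 : 0 ≤ τ := by linarith
  set n : ℝ := (Fintype.card V : ℝ)
  have hNτ : 0 ≤ (N : ℝ) * (4 * τ + d) := by positivity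
  suffices h : ∃ (A₀ : Finset V) (β : ℝ), β + N * (4 * τ + d) ≤ A₀.card ∧
      ∀ A ⊆ A₀, ∀ U ⊆ A, β ≤ U.card → G.HasGadget τ e A U by
    obtain ⟨A₀, β, h1, h2⟩ := h
    obtain ⟨K, lam, E, A, U, -, h3⟩ := exists_partialPool hG he0 hκ₁ hκ hd hr hτ0 hd0 hr0 h1 h2 N
      le_rfl
    exact ⟨K, lam, E, h3.isPool hκ⟩
  -- In the focused case the ambient set has `n` vertices and regions must keep half of them.
  -- Otherwise the ambient set `W` has at least `n / 2` vertices, second neighbourhoods taken inside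
  -- any `A ⊆ W` are small, and regions of size `6 * τ` suffice. Either way the margin `N * (4 * τ +
  -- d)` pays for `N` gadgets.
  by_cases hfoc : ∀ U : Finset V, n / 2 ≤ U.card →
      ∃ v ∈ U, τ ≤ ((U.filter fun u => ∃ s ∈ U, G.Adj v s ∧ G.Adj s u).card : ℝ)
  · refine ⟨Finset.univ, n / 2, ?_, fun A _ U hUA hU => ?_⟩
    · rw [Finset.card_univ]
      change _ ≤ n
      linarith
    · obtain ⟨v, hv, hball⟩ := hfoc U hU
      exact hG.hasGadget_of_vertex hUA he hτ hv hball
  · push Not at hfoc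
    obtain ⟨W, hW, hball⟩ := hfoc
    refine ⟨W, 6 * τ, by linarith, fun A hA U hUA hU => ?_⟩
    refine hG.hasGadget_of_small_balls hUA he hτ hU fun v hv => ?_
    refine lt_of_le_of_lt (Nat.cast_le.2 (Finset.card_le_card ?_)) (hball v (hA hv))
    intro u hu
    simp only [Finset.mem_filter] at hu ⊢
    obtain ⟨hu, s, hs, h1⟩ := hu
    exact ⟨hA hu, s, hA hs, h1⟩

end SimpleGraph

/-! ### Rooted structures, tokens, and what happens when one token hits another. -/

namespace SimpleGraph

open scoped Classical

variable {V : Type u}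

/-- The vertices of a footprint: a finite set `F` together with the cores listed in `J`. -/
def body (K : ℕ → Finset V) (F : Finset V) (J : Finset ℕ) : Set V :=
  {a | a ∈ F ∨ ∃ p ∈ J, a ∈ K p}

/-- The edge `vw` is the only edge between two disjoint footprints. -/
def JoinAt (G : SimpleGraph V) (K : ℕ → Finset V) (v : V) (F : Finset V) (J : Finset ℕ)
    (w : V) (F' : Finset V) (J' : Finset ℕ) : Prop :=
  G.Adj v w ∧ Disjoint J J' ∧
    ∀ a ∈ body K F J, ∀ b ∈ body K F' J', a ≠ b ∧ (G.Adj a b → a = v ∧ b = w)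

/-- `Head G K lam E N A R n v F J`: the vertex `v` is the root of an induced tree-like structure
with footprint `F` and cores `J`, in which `v` has `n` legs, and is the end of a spine whose `R`
further vertices have `A` legs each. Every leg contains a core. -/
inductive Head (G : SimpleGraph V) (K : ℕ → Finset V) (lam : ℕ → V → V) (E : ℕ → Finset V)
    (N A : ℕ) : ℕ → ℕ → V → Finset V → Finset ℕ → Prop
  | block {p : ℕ} {v : V} (hp : p < N) (hv : v ∈ E p) : Head G K lam E N A 0 0 v {v} ∅
  | attach {p : ℕ} {x : V} (hp : p < N) (hx : x ∈ E p) :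
      Head G K lam E N A 0 0 (lam p x) {lam p x} {p}
  | leg {R n R' n' : ℕ} {v w : V} {F F' : Finset V} {J J' : Finset ℕ}
      (h : Head G K lam E N A R n v F J) (h' : Head G K lam E N A R' n' w F' J')
      (hJ : J'.Nonempty) (hj : G.JoinAt K v F J w F' J') :
      Head G K lam E N A R (n + 1) v (F ∪ F') (J ∪ J')
  | spine {R n R' : ℕ} {v w : V} {F F' : Finset V} {J J' : Finset ℕ}
      (h : Head G K lam E N A R n v F J) (h' : Head G K lam E N A R' A w F' J')
      (hJ : J'.Nonempty) (hj : G.JoinAt K v F J w F' J') :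
      Head G K lam E N A (R' + 1) 0 v (F ∪ F') (J ∪ J')

/-- A family of rooted structures, one for each index in `I`, with common set of cores `J`. The
level `lev` encodes the length of the spine and the number of legs at the root, and `P` contains
all vertices of the footprints except the roots. -/
structure Token (V : Type u) where
  I : Finset V
  root : V → V
  F : V → Finset V
  J : Finset ℕ
  lev : ℕ
  P : Set V

namespace Token

/-- Restriction to fewer indices. -/
def restrict (T : Token V) (I : Finset V) : Token V := { T with I := I }

/-- The token whose roots are the vertices of `C`, with no further structure. -/
def source (C : Finset V) : Token V := ⟨C, id, fun v => {v}, ∅, 0, ∅⟩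

/-- Every root of `Z` gets the structure of `X` with index chosen by `d` as a new child. -/
noncomputable def merge (Z X : Token V) (d : V → V) (lev : ℕ) : Token V :=
  ⟨Z.I, Z.root, fun i => Z.F i ∪ X.F (d i), Z.J ∪ X.J, lev, Z.P ∪ X.P ∪ X.root '' X.I⟩

/-- The token really carries structures of its level. -/
def Valid (G : SimpleGraph V) (K : ℕ → Finset V) (lam : ℕ → V → V) (E : ℕ → Finset V)
    (N A b : ℕ) (T : Token V) : Prop :=
  ∀ i ∈ T.I, Head G K lam E N A (T.lev / (A + 1)) (T.lev % (A + 1)) (T.root i) (T.F i) T.J ∧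
    (T.F i).card ≤ b ∧ ∀ a ∈ body K (T.F i) T.J, a = T.root i ∨ a ∈ T.P

/-- Compatibility of two tokens; only edges between roots are allowed. -/
structure Compat (G : SimpleGraph V) (κ : ℝ) (T T' : Token V) : Prop where
  cores : Disjoint T.J T'.J
  inner : ∀ a ∈ T.P, ∀ b ∈ T'.P, a ≠ b ∧ ¬ G.Adj a b
  inner_root : ∀ a ∈ T.P, ∀ j ∈ T'.I, a ≠ T'.root j ∧ ¬ G.Adj a (T'.root j)
  root_ne : ∀ i ∈ T.I, ∀ j ∈ T'.I, T.root i ≠ T'.root j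
  sparse : ∀ i ∈ T.I, ((T'.I.filter fun j => G.Adj (T.root i) (T'.root j)).card : ℝ) ≤ κ

variable {G : SimpleGraph V} {K : ℕ → Finset V} {lam : ℕ → V → V} {E : ℕ → Finset V}
  {N A b : ℕ} {κ : ℝ} {T T' X Z : Token V}

theorem Valid.restrict (h : T.Valid G K lam E N A b) {I : Finset V} (hI : I ⊆ T.I) :
    (T.restrict I).Valid G K lam E N A b := fun i hi => h i (hI hi)

theorem Valid.mono (h : T.Valid G K lam E N A b) {b' : ℕ} (hb : b ≤ b') :
    T.Valid G K lam E N A b' := fun i hi => ⟨(h i hi).1, (h i hi).2.1.trans hb, (h i hi).2.2⟩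

theorem Compat.restrict (h : Compat G κ T T') {I I' : Finset V} (hI : I ⊆ T.I) (hI' : I' ⊆ T'.I) :
    Compat G κ (T.restrict I) (T'.restrict I') where
  cores := h.cores
  inner := h.inner
  inner_root a ha j hj := h.inner_root a ha j (hI' hj)
  root_ne i hi j hj := h.root_ne i (hI hi) j (hI' hj)
  sparse i hi := (Nat.cast_le.2 (Finset.card_le_card (Finset.filter_subset_filter _ hI'))).trans
    (h.sparse i (hI hi))

theorem valid_merge {d : V → V} {lev : ℕ} (hZ : Z.Valid G K lam E N A b)
    (hX : X.Valid G K lam E N A b) (hZX : Compat G κ Z X) (hXZ : Compat G κ X Z)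
    (hJ : X.J.Nonempty)
    (hd : ∀ i ∈ Z.I, d i ∈ X.I ∧ G.Adj (X.root (d i)) (Z.root i))
    (hlev : (Z.lev % (A + 1) ≠ A ∧ lev = Z.lev + 1) ∨ (X.lev % (A + 1) = A ∧ lev = X.lev + 1)) :
    (Z.merge X d lev).Valid G K lam E N A (b + b) := by
  intro i hi
  obtain ⟨hdi, hadj⟩ := hd i hi
  obtain ⟨z1, z2, z3⟩ := hZ i hi
  obtain ⟨x1, x2, x3⟩ := hX (d i) hdi
  have hj : G.JoinAt K (Z.root i) (Z.F i) Z.J (X.root (d i)) (X.F (d i)) X.J := by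
    refine ⟨hadj.symm, hZX.cores, fun a ha b hb => ?_⟩
    rcases z3 a ha with rfl | ha <;> rcases x3 b hb with rfl | hb
    · exact ⟨hZX.root_ne i hi _ hdi, fun _ => ⟨rfl, rfl⟩⟩
    · have := hXZ.inner_root b hb i hi
      exact ⟨this.1.symm, fun h => absurd h.symm this.2⟩
    · have := hZX.inner_root a ha _ hdi
      exact ⟨this.1, fun h => absurd h this.2⟩
    · have := hZX.inner a ha b hb
      exact ⟨this.1, fun h => absurd h this.2⟩
  refine ⟨?_, (Finset.card_union_le _ _).trans (Nat.add_le_add z2 x2), ?_⟩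
  · rcases hlev with ⟨h1, rfl⟩ | ⟨h1, rfl⟩
    · have hlt : Z.lev % (A + 1) < A + 1 := Nat.mod_lt _ (Nat.succ_pos _)
      have hm : (Z.lev + 1) % (A + 1) = Z.lev % (A + 1) + 1 := by
        rw [Nat.add_mod, Nat.mod_eq_of_lt (a := Z.lev % (A + 1) + 1 % (A + 1))]
        · rw [Nat.mod_eq_of_lt (a := 1)]; omega
        · rw [Nat.mod_eq_of_lt (a := 1)] <;> omega
      have hq : (Z.lev + 1) / (A + 1) = Z.lev / (A + 1) := by
        have e1 := Nat.div_add_mod Z.lev (A + 1)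
        have e2 := Nat.div_add_mod (Z.lev + 1) (A + 1)
        rw [hm] at e2
        have : (A + 1) * ((Z.lev + 1) / (A + 1)) = (A + 1) * (Z.lev / (A + 1)) := by omega
        exact Nat.eq_of_mul_eq_mul_left (Nat.succ_pos A) this
      change Head G K lam E N A ((Z.lev + 1) / (A + 1)) ((Z.lev + 1) % (A + 1)) _ _ _
      rw [hm, hq]
      exact Head.leg z1 x1 hJ hj
    · have hm : (X.lev + 1) % (A + 1) = 0 := by
        have e1 := Nat.div_add_mod X.lev (A + 1)
        have : X.lev + 1 = (A + 1) * (X.lev / (A + 1) + 1) := by rw [Nat.mul_add]; omega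
        rw [this, Nat.mul_mod_right]
      have hq : (X.lev + 1) / (A + 1) = X.lev / (A + 1) + 1 := by
        have e1 := Nat.div_add_mod X.lev (A + 1)
        have : X.lev + 1 = (A + 1) * (X.lev / (A + 1) + 1) := by rw [Nat.mul_add]; omega
        rw [this, Nat.mul_div_cancel_left _ (Nat.succ_pos A)]
      change Head G K lam E N A ((X.lev + 1) / (A + 1)) ((X.lev + 1) % (A + 1)) _ _ _
      rw [hm, hq]
      rw [h1] at x1
      exact Head.spine z1 x1 hJ hj
  · intro a ha
    have : a ∈ body K (Z.F i) Z.J ∨ a ∈ body K (X.F (d i)) X.J := by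
      rcases ha with ha | ⟨p, hp, ha⟩
      · rcases Finset.mem_union.1 ha with ha | ha
        · exact Or.inl (Or.inl ha)
        · exact Or.inr (Or.inl ha)
      · rcases Finset.mem_union.1 hp with hp | hp
        · exact Or.inl (Or.inr ⟨p, hp, ha⟩)
        · exact Or.inr (Or.inr ⟨p, hp, ha⟩)
    rcases this with ha | ha
    · exact (z3 a ha).imp_right fun h => Or.inl (Or.inl h)
    · right
      rcases x3 a ha with rfl | h
      · exact Or.inr ⟨d i, hdi, rfl⟩
      · exact Or.inl (Or.inr h)

/-- The roots of `X` become inner vertices, and inner vertices may have no edge to roots of `T`.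
This is the one new requirement, `hno`; it is met by restricting `T` to the indices in `clear`. -/
theorem Compat.merge_left {d : V → V} {lev : ℕ} (hZT : Compat G κ Z T) (hXT : Compat G κ X T)
    (hTX : Compat G κ T X) (hno : ∀ i ∈ X.I, ∀ j ∈ T.I, ¬ G.Adj (X.root i) (T.root j)) :
    Compat G κ (Z.merge X d lev) T where
  cores := by
    change Disjoint (Z.J ∪ X.J) T.J
    exact Finset.disjoint_union_left.2 ⟨hZT.cores, hXT.cores⟩
  inner a ha b hb := by
    rcases ha with (ha | ha) | ⟨i, hi, rfl⟩
    · exact hZT.inner a ha b hb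
    · exact hXT.inner a ha b hb
    · have := hTX.inner_root b hb i hi
      exact ⟨this.1.symm, fun h => this.2 h.symm⟩
  inner_root a ha j hj := by
    rcases ha with (ha | ha) | ⟨i, hi, rfl⟩
    · exact hZT.inner_root a ha j hj
    · exact hXT.inner_root a ha j hj
    · exact ⟨hXT.root_ne i hi j hj, hno i hi j hj⟩
  root_ne := hZT.root_ne
  sparse := hZT.sparse

theorem Compat.merge_right {d : V → V} {lev : ℕ} (hTZ : Compat G κ T Z) (hTX : Compat G κ T X) :
    Compat G κ T (Z.merge X d lev) where
  cores := by
    change Disjoint T.J (Z.J ∪ X.J)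
    exact Finset.disjoint_union_right.2 ⟨hTZ.cores, hTX.cores⟩
  inner a ha b hb := by
    rcases hb with (hb | hb) | ⟨i, hi, rfl⟩
    · exact hTZ.inner a ha b hb
    · exact hTX.inner a ha b hb
    · exact hTX.inner_root a ha i hi
  inner_root := hTZ.inner_root
  root_ne := hTZ.root_ne
  sparse := hTZ.sparse

/-- The indices of `T` whose roots have a neighbour among the roots of `X` indexed by `D`. -/
noncomputable def hits (G : SimpleGraph V) (X T : Token V) (D : Finset V) : Finset V :=
  T.I.filter fun i => ∃ j ∈ D, G.Adj (X.root j) (T.root i)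

/-- A minimal set of roots of `X` that hits some other token in more than a threshold. -/
theorem exists_first_hit {ι : Type*} (X : Token V) (S : Finset ι) (tok : ι → Token V)
    (thr : ι → ℝ) (hthr : ∀ t ∈ S, 0 < thr t) (hc : ∀ t ∈ S, Compat G κ X (tok t))
    (hex : ∃ t ∈ S, thr t ≤ (hits G X (tok t) X.I).card) :
    ∃ D ⊆ X.I, (∃ z ∈ S, thr z ≤ (hits G X (tok z) D).card) ∧
      ∀ t ∈ S, ((hits G X (tok t) D).card : ℝ) ≤ thr t + κ := by
  -- With `D` minimal, removing any one root brings all tokens below their thresholds, and by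
  -- sparsity that root accounts for at most `κ` hits. So no token loses more than its threshold
  -- plus `κ`.
  let 𝒟 := X.I.powerset.filter fun D : Finset V => ∃ z ∈ S, thr z ≤ (hits G X (tok z) D).card
  have h0 : X.I ∈ 𝒟 := by simpa [𝒟] using hex
  obtain ⟨D, hD, hmin⟩ := Finset.exists_min_image 𝒟 Finset.card ⟨_, h0⟩
  simp only [𝒟, Finset.mem_filter, Finset.mem_powerset] at hD hmin
  obtain ⟨hDI, hz⟩ := hD
  refine ⟨D, hDI, hz, fun t ht => ?_⟩
  have hne : D.Nonempty := by
    rw [Finset.nonempty_iff_ne_empty]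
    rintro rfl
    obtain ⟨z, hzS, hz⟩ := hz
    have := hthr z hzS
    simp [hits] at hz
    linarith
  obtain ⟨d, hd⟩ := hne
  have h1 : ((hits G X (tok t) (D.erase d)).card : ℝ) < thr t := by
    by_contra hlt
    push Not at hlt
    have := hmin (D.erase d) ⟨(Finset.erase_subset _ _).trans hDI, t, ht, hlt⟩
    rw [Finset.card_erase_of_mem hd] at this
    have := Finset.card_pos.2 ⟨d, hd⟩
    omega
  have h2 : hits G X (tok t) D ⊆ hits G X (tok t) (D.erase d) ∪
      (tok t).I.filter fun j => G.Adj (X.root d) ((tok t).root j) := by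
    intro i hi
    simp only [hits, Finset.mem_union, Finset.mem_filter, Finset.mem_erase] at hi ⊢
    obtain ⟨hi, j, hj, hadj⟩ := hi
    by_cases hjd : j = d
    · subst hjd; exact Or.inr ⟨hi, hadj⟩
    · exact Or.inl ⟨hi, j, ⟨hjd, hj⟩, hadj⟩
  have h3 : ((hits G X (tok t) D).card : ℝ) ≤ (hits G X (tok t) (D.erase d)).card +
      ((tok t).I.filter fun j => G.Adj (X.root d) ((tok t).root j)).card := by
    exact_mod_cast (Finset.card_le_card h2).trans (Finset.card_union_le _ _)
  have := (hc t ht).sparse d (hDI hd)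
  linarith

end Token

end SimpleGraph

/-! ### The game with rooted tokens. -/

namespace SimpleGraph

open scoped Classical

variable {V : Type u}

namespace Token

variable {G : SimpleGraph V} {K : ℕ → Finset V} {lam : ℕ → V → V} {E : ℕ → Finset V}
  {N A b : ℕ} {κ : ℝ}

/-- The indices of `T` not in `hits`. -/
noncomputable def clear (G : SimpleGraph V) (X T : Token V) (D : Finset V) : Finset V :=
  T.I \ hits G X T D

theorem card_clear (X T : Token V) (D : Finset V) :
    ((clear G X T D).card : ℝ) = T.I.card - (hits G X T D).card := by
  have : hits G X T D ⊆ T.I := Finset.filter_subset _ _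
  rw [clear, Finset.card_sdiff_of_subset this, Nat.cast_sub (Finset.card_le_card this)]

theorem clear_subset (X T : Token V) (D : Finset V) : clear G X T D ⊆ T.I := Finset.sdiff_subset

theorem hits_subset (X T : Token V) (D : Finset V) : hits G X T D ⊆ T.I := Finset.filter_subset _ _

theorem exists_child (G : SimpleGraph V) (X T : Token V) (D : Finset V) :
    ∃ d : V → V, ∀ i ∈ hits G X T D, d i ∈ D ∧ G.Adj (X.root (d i)) (T.root i) := by
  have : ∀ i, i ∈ hits G X T D → ∃ j, j ∈ D ∧ G.Adj (X.root j) (T.root i) :=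
    fun i hi => (Finset.mem_filter.1 hi).2
  choose! d hd using this
  exact ⟨d, hd⟩

theorem not_adj_of_clear {X T : Token V} {D : Finset V} :
    ∀ i ∈ D, ∀ j ∈ clear G X T D, ¬ G.Adj (X.root i) (T.root j) := by
  intro i hi j hj hadj
  rw [clear, Finset.mem_sdiff] at hj
  exact hj.2 (Finset.mem_filter.2 ⟨hj.1, i, hi, hadj⟩)

/-- The token obtained from `Z` when it is hit by the roots of `X` indexed by `D`. -/
noncomputable def hit (G : SimpleGraph V) (X Z : Token V) (D : Finset V) (lev : ℕ) : Token V :=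
  (Z.restrict (hits G X Z D)).merge (X.restrict D) (exists_child G X Z D).choose lev

theorem valid_hit {X Z : Token V} {D : Finset V} {lev : ℕ} (hD : D ⊆ X.I)
    (hZ : Z.Valid G K lam E N A b) (hX : X.Valid G K lam E N A b) (hZX : Compat G κ Z X)
    (hXZ : Compat G κ X Z) (hJ : X.J.Nonempty)
    (hlev : (Z.lev % (A + 1) ≠ A ∧ lev = Z.lev + 1) ∨ (X.lev % (A + 1) = A ∧ lev = X.lev + 1)) :
    (hit G X Z D lev).Valid G K lam E N A (b + b) :=
  valid_merge (hZ.restrict (hits_subset X Z D)) (hX.restrict hD)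
    (hZX.restrict (hits_subset X Z D) hD) (hXZ.restrict hD (hits_subset X Z D)) hJ
    (exists_child G X Z D).choose_spec hlev

theorem compat_hit_clear {X Z T : Token V} {D I : Finset V} {lev : ℕ} (hD : D ⊆ X.I)
    (hI : I ⊆ clear G X T D) (hZT : Compat G κ Z T) (hXT : Compat G κ X T) (hTX : Compat G κ T X) :
    Compat G κ (hit G X Z D lev) (T.restrict I) := by
  have hI' := hI.trans (clear_subset X T D)
  exact (hZT.restrict (hits_subset X Z D) hI').merge_left (hXT.restrict hD hI')
    (hTX.restrict hI' hD) (fun i hi j hj => not_adj_of_clear (X := X) (T := T) i hi j (hI hj))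

theorem compat_clear_hit {X Z T : Token V} {D I : Finset V} {lev : ℕ} (hD : D ⊆ X.I)
    (hI : I ⊆ T.I) (hTZ : Compat G κ T Z) (hTX : Compat G κ T X) :
    Compat G κ (T.restrict I) (hit G X Z D lev) :=
  (hTZ.restrict hI (hits_subset X Z D)).merge_right (hTX.restrict hI hD)

end Token

open Token

/-- There is a structure of level at least `L` with at most `b` vertices outside the cores. -/
def HasHead (G : SimpleGraph V) (K : ℕ → Finset V) (lam : ℕ → V → V) (E : ℕ → Finset V)
    (N A L b : ℕ) : Prop :=
  ∃ R n v F J, Head G K lam E N A R n v F J ∧ n ≤ A ∧ L ≤ R * (A + 1) + n ∧ F.card ≤ b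

theorem Token.Valid.hasHead {G : SimpleGraph V} {K : ℕ → Finset V} {lam : ℕ → V → V}
    {E : ℕ → Finset V} {N A b L : ℕ} {T : Token V} (h : T.Valid G K lam E N A b)
    (hne : T.I.Nonempty) (hL : L ≤ T.lev) : HasHead G K lam E N A L b := by
  obtain ⟨i, hi⟩ := hne
  obtain ⟨h1, h2, -⟩ := h i hi
  exact ⟨_, _, _, _, _, h1, Nat.lt_succ_iff.1 (Nat.mod_lt _ (Nat.succ_pos A)),
    by rw [Nat.mul_comm, Nat.div_add_mod]; exact hL, h2⟩

theorem HasHead.mono {G : SimpleGraph V} {K : ℕ → Finset V} {lam : ℕ → V → V}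
    {E : ℕ → Finset V} {N A L b b' : ℕ} (h : HasHead G K lam E N A L b) (hb : b ≤ b') :
    HasHead G K lam E N A L b' := by
  obtain ⟨R, n, v, F, J, h1, h2, h3, h4⟩ := h
  exact ⟨R, n, v, F, J, h1, h2, h3, h4.trans hb⟩

/-- A family of compatible tokens whose roots are their indices. -/
structure RootedFamily (G : SimpleGraph V) (K : ℕ → Finset V) (lam : ℕ → V → V)
    (E : ℕ → Finset V) (N A : ℕ) (κ : ℝ) (M : Finset ℕ) (tok : ℕ → Token V) (b : ℕ) (σ : ℝ) :
    Prop where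
  valid : ∀ s ∈ M, (tok s).Valid G K lam E N A b
  compat : ∀ s ∈ M, ∀ t ∈ M, s ≠ t → Compat G κ (tok s) (tok t)
  cores_nonempty : ∀ s ∈ M, (tok s).J.Nonempty
  root_eq : ∀ s ∈ M, ∀ i ∈ (tok s).I, (tok s).root i = i
  card_le : ∀ s ∈ M, σ ≤ (tok s).I.card

theorem sum_change {S : Finset ℕ} {f g : ℕ → ℕ} {z : ℕ} (hz : z ∈ S)
    (h : ∀ t ∈ S, t ≠ z → g t = f t) : ∑ t ∈ S, g t + f z = ∑ t ∈ S, f t + g z := by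
  rw [← Finset.add_sum_erase S g hz, ← Finset.add_sum_erase S f hz,
    Finset.sum_congr rfl fun t ht => h t (Finset.mem_of_mem_erase ht) (Finset.ne_of_mem_erase ht)]
  ring

/-- A player chosen among tokens: a full one of largest level, or one of smallest level if there
are no full ones. -/
theorem exists_player (A : ℕ) {M : Finset ℕ} (hM : M.Nonempty) (lev : ℕ → ℕ) :
    ∃ x ∈ M, (lev x % (A + 1) = A ∧ ∀ y ∈ M, lev y % (A + 1) = A → lev y ≤ lev x) ∨
      ((∀ y ∈ M, lev y % (A + 1) ≠ A) ∧ ∀ y ∈ M, lev x ≤ lev y) := by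
  by_cases hf : (M.filter fun y => lev y % (A + 1) = A).Nonempty
  · obtain ⟨x, hx, hmax⟩ := Finset.exists_max_image _ lev hf
    rw [Finset.mem_filter] at hx
    exact ⟨x, hx.1, Or.inl ⟨hx.2, fun y hy hy' => hmax y (Finset.mem_filter.2 ⟨hy, hy'⟩)⟩⟩
  · rw [Finset.not_nonempty_iff_eq_empty, Finset.filter_eq_empty_iff] at hf
    obtain ⟨x, hx, hmin⟩ := Finset.exists_min_image M lev hM
    exact ⟨x, hx, Or.inr ⟨fun y hy => hf hy, hmin⟩⟩

variable [Fintype V] {G : SimpleGraph V} {e : ℝ}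

/-- Roots equal to their indices are distinct vertices, so `e` roots missed by `X` would form a set
of `e` vertices anticomplete to the roots of `X`. -/
theorem CoherentAt.le_card_hits (hG : G.CoherentAt e) {X T : Token V} {κ : ℝ}
    (hXT : Compat G κ X T) (hX : ∀ i ∈ X.I, X.root i = i) (hT : ∀ i ∈ T.I, T.root i = i)
    (hc : e ≤ X.I.card) : (T.I.card : ℝ) - e ≤ (hits G X T X.I).card := by
  by_contra hlt
  push Not at hlt
  have h1 : e ≤ (clear G X T X.I).card := by rw [card_clear]; linarith
  obtain ⟨a, ha, b, hb, hab⟩ := hG.exists_adj X.I (clear G X T X.I) (by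
    rw [Finset.disjoint_left]
    intro i hi hi'
    have hi' := clear_subset _ _ _ hi'
    exact hXT.root_ne i hi i hi' ((hX i hi).trans (hT i hi').symm)) hc h1
  have := not_adj_of_clear a ha b hb
  rw [hX a ha, hT b (clear_subset _ _ _ hb)] at this
  exact this hab

/-- Each move uses up the player `x` and raises the hit token to level `max + 1`, so `∑ 2 ^ lev`
does not decrease: `2 ^ l + 2 ^ l' ≤ 2 ^ (max l l' + 1)`. A single remaining token must then have
level at least `L`. With `θ = 4 ^ k * s₀`, a token of size `4 * θ` that is not hit loses at most `θ
+ κ ≤ 2 * θ`, and the hit one keeps at least `θ`. Each move at most doubles the footprint bound `b`.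
-/
theorem RootedFamily.hasHead (hG : G.CoherentAt e) {K : ℕ → Finset V} {lam : ℕ → V → V}
    {E : ℕ → Finset V} {N A L : ℕ} {κ s₀ : ℝ} (hs₀ : 0 < s₀) (hes : e ≤ s₀) (hκs : κ ≤ s₀) :
    ∀ (k : ℕ) (M : Finset ℕ) (tok : ℕ → Token V) (b : ℕ), M.card = k → 0 < k →
      RootedFamily G K lam E N A κ M tok b (4 ^ k * s₀) → 2 ^ L ≤ ∑ s ∈ M, 2 ^ (tok s).lev →
      HasHead G K lam E N A L (b * 2 ^ k) := by
  intro k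
  induction k with
  | zero => intro M tok b _ h0; omega
  | succ k ih =>
    intro M tok b hMk _ h hsum
    have hpow : (0 : ℝ) < 4 ^ k * s₀ := by positivity
    have hs1 : (4 : ℝ) ^ (k + 1) * s₀ = 4 * (4 ^ k * s₀) := by ring
    have hs2 : s₀ ≤ 4 ^ k * s₀ := le_mul_of_one_le_left hs₀.le (one_le_pow₀ (by norm_num))
    set θ : ℝ := 4 ^ k * s₀
    have hne : ∀ s ∈ M, (tok s).I.Nonempty := by
      intro s hs
      have := h.card_le s hs
      rw [← Finset.card_pos]
      have : (0 : ℝ) < (tok s).I.card := by linarith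
      exact_mod_cast this
    by_cases hwin : ∃ s ∈ M, L ≤ (tok s).lev
    · obtain ⟨s, hs, hL⟩ := hwin
      exact ((h.valid s hs).hasHead (hne s hs) hL).mono
        (Nat.le_mul_of_pos_right _ (by positivity))
    push Not at hwin
    obtain ⟨x, hx, hxp⟩ := exists_player A (M := M) (by rw [← Finset.card_pos]; omega)
      (fun s => (tok s).lev)
    have hk : 0 < k := by
      by_contra hk0
      have : M.card = 1 := by omega
      obtain ⟨y, rfl⟩ := Finset.card_eq_one.1 this
      rw [Finset.sum_singleton] at hsum
      have := hwin y (by simp)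
      exact absurd hsum (not_le.2 (Nat.pow_lt_pow_right (by norm_num) this))
    have hcompx : ∀ t ∈ M.erase x, Compat G κ (tok x) (tok t) := fun t ht =>
      h.compat x hx t (Finset.mem_of_mem_erase ht) (Finset.ne_of_mem_erase ht).symm
    have hcompx' : ∀ t ∈ M.erase x, Compat G κ (tok t) (tok x) := fun t ht =>
      h.compat t (Finset.mem_of_mem_erase ht) x hx (Finset.ne_of_mem_erase ht)
    have hexh : ∃ t ∈ M.erase x, θ ≤ (hits G (tok x) (tok t) (tok x).I).card := by
      have : (M.erase x).Nonempty := by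
        rw [← Finset.card_pos, Finset.card_erase_of_mem hx]; omega
      obtain ⟨t, ht⟩ := this
      refine ⟨t, ht, ?_⟩
      have htM := Finset.mem_of_mem_erase ht
      have h1 := hG.le_card_hits (hcompx t ht) (h.root_eq x hx) (h.root_eq t htM)
        (by have := h.card_le x hx; linarith)
      have h2 := h.card_le t htM
      linarith
    obtain ⟨D, hD, ⟨z, hz, hzθ⟩, hloss⟩ := exists_first_hit (tok x) (M.erase x) tok (fun _ => θ)
      (fun _ _ => hpow) hcompx hexh
    have hzM := Finset.mem_of_mem_erase hz
    have hzx := Finset.ne_of_mem_erase hz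
    -- The choice of player makes this level attainable. A full player has the largest level among
    -- full tokens, so a higher `z` is not full and takes a leg, while any other `z` prolongs the
    -- spine of `x`. If no token is full, `x` has the smallest level and `z` takes a leg.
    let nl : ℕ := max (tok x).lev (tok z).lev + 1
    have hnl : ((tok z).lev % (A + 1) ≠ A ∧ nl = (tok z).lev + 1) ∨
        ((tok x).lev % (A + 1) = A ∧ nl = (tok x).lev + 1) := by
      rcases hxp with ⟨h1, h2⟩ | ⟨h1, h2⟩
      · rcases le_or_gt (tok z).lev (tok x).lev with hle | hlt
        · exact Or.inr ⟨h1, by simp only [nl]; omega⟩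
        · refine Or.inl ⟨fun hf => ?_, by simp only [nl]; omega⟩
          have := h2 z hzM hf
          omega
      · have := h2 z hzM
        exact Or.inl ⟨h1 z hzM, by simp only [nl]; omega⟩
    let tok' : ℕ → Token V := fun t => if t = z then hit G (tok x) (tok z) D nl
      else (tok t).restrict (clear G (tok x) (tok t) D)
    have tz : tok' z = hit G (tok x) (tok z) D nl := if_pos rfl
    have tn : ∀ t, t ≠ z → tok' t = (tok t).restrict (clear G (tok x) (tok t) D) :=
      fun t ht => if_neg ht
    clear_value tok'
    have := ih (M.erase x) tok' (b + b) (by rw [Finset.card_erase_of_mem hx]; omega) hk ?_ ?_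
    · exact this.mono (by rw [pow_succ, Nat.mul_left_comm, ← Nat.two_mul, Nat.mul_comm]; ring_nf; rfl)
    · constructor
      · intro s hs
        have hsM := Finset.mem_of_mem_erase hs
        by_cases hsz : s = z
        · subst hsz
          rw [tz]
          exact valid_hit hD (h.valid s hsM) (h.valid x hx) (hcompx' s hs) (hcompx s hs)
            (h.cores_nonempty x hx) hnl
        · rw [tn s hsz]
          exact ((h.valid s hsM).restrict (clear_subset _ _ _)).mono (by omega)
      · intro s hs t ht hst
        have hsM := Finset.mem_of_mem_erase hs
        have htM := Finset.mem_of_mem_erase ht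
        by_cases hsz : s = z
        · subst hsz
          rw [tz, tn t hst.symm]
          exact compat_hit_clear hD subset_rfl (h.compat s hsM t htM hst) (hcompx t ht)
            (hcompx' t ht)
        · rw [tn s hsz]
          by_cases htz : t = z
          · subst htz
            rw [tz]
            exact compat_clear_hit hD (clear_subset _ _ _) (h.compat s hsM t htM hst)
              (hcompx' s hs)
          · rw [tn t htz]
            exact (h.compat s hsM t htM hst).restrict (clear_subset _ _ _) (clear_subset _ _ _)
      · intro s hs
        have hsM := Finset.mem_of_mem_erase hs
        by_cases hsz : s = z
        · subst hsz
          rw [tz]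
          exact (h.cores_nonempty s hsM).mono Finset.subset_union_left
        · rw [tn s hsz]; exact h.cores_nonempty s hsM
      · intro s hs i hi
        have hsM := Finset.mem_of_mem_erase hs
        by_cases hsz : s = z
        · subst hsz
          rw [tz] at hi ⊢
          exact h.root_eq s hsM i (hits_subset _ _ _ hi)
        · rw [tn s hsz] at hi ⊢; exact h.root_eq s hsM i (clear_subset _ _ _ hi)
      · intro s hs
        have hsM := Finset.mem_of_mem_erase hs
        by_cases hsz : s = z
        · subst hsz
          rw [tz]
          exact hzθ
        · rw [tn s hsz]
          change θ ≤ ((clear G (tok x) (tok s) D).card : ℝ)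
          rw [card_clear]
          have h1 := h.card_le s hsM
          have h2 := hloss s hs
          linarith
    · have h1 : ∑ t ∈ M.erase x, 2 ^ (tok' t).lev + 2 ^ (tok z).lev =
          ∑ t ∈ M.erase x, 2 ^ (tok t).lev + 2 ^ (tok' z).lev :=
        sum_change (f := fun t => 2 ^ (tok t).lev) (g := fun t => 2 ^ (tok' t).lev) hz
          (fun t _ htz => by simp only [tn t htz]; rfl)
      have h2 : 2 ^ (tok x).lev + ∑ t ∈ M.erase x, 2 ^ (tok t).lev = ∑ t ∈ M, 2 ^ (tok t).lev :=
        Finset.add_sum_erase M (fun t => 2 ^ (tok t).lev) hx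
      have h3 : (tok' z).lev = nl := by rw [tz]; rfl
      have h4 : 2 ^ (tok x).lev ≤ 2 ^ (max (tok x).lev (tok z).lev) :=
        Nat.pow_le_pow_right (by norm_num) (le_max_left _ _)
      have h5 : 2 ^ (tok z).lev ≤ 2 ^ (max (tok x).lev (tok z).lev) :=
        Nat.pow_le_pow_right (by norm_num) (le_max_right _ _)
      have h6 : 2 ^ nl = 2 * 2 ^ (max (tok x).lev (tok z).lev) := by
        simp only [nl, pow_succ]; ring
      rw [h3, h6] at h1
      omega

end SimpleGraph

/-! ### The game with attachment tokens: a single move. -/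

namespace SimpleGraph

open scoped Classical

open Token

variable {V : Type u}

/-- A state of the game on a pool: tokens `L` that consist of attachments, tokens `M` whose roots
are their indices, and a set `C` of unused block vertices. -/
structure GameState (G : SimpleGraph V) (K : ℕ → Finset V) (lam : ℕ → V → V)
    (E : ℕ → Finset V) (N A : ℕ) (κ : ℝ) (L M : Finset ℕ) (tok : ℕ → Token V) (C : Finset V)
    (b : ℕ) (σ : ℝ) : Prop where
  disjoint : Disjoint L M
  valid : ∀ s ∈ L ∪ M, (tok s).Valid G K lam E N A b
  source_subset : ∀ v ∈ C, ∃ p < N, v ∈ E p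
  compat : ∀ s ∈ L ∪ M, ∀ t ∈ L ∪ M, s ≠ t → Compat G κ (tok s) (tok t)
  compat_source : ∀ s ∈ L ∪ M, Compat G κ (tok s) (source C)
  source_compat : ∀ s ∈ L ∪ M, Compat G κ (source C) (tok s)
  cores_nonempty : ∀ s ∈ L ∪ M, (tok s).J.Nonempty
  card_le : ∀ s ∈ L ∪ M, σ ≤ (tok s).I.card
  source_card : σ ≤ C.card
  adj_root : ∀ s ∈ L, ∀ i ∈ (tok s).I, i ∈ C ∧ G.Adj ((tok s).root i) i
  root_eq : ∀ s ∈ M, ∀ i ∈ (tok s).I, (tok s).root i = i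

/-- Admissible players. -/
def CanPlay (A : ℕ) (L M : Finset ℕ) (lev : ℕ → ℕ) (x : ℕ) : Prop :=
  x ∈ L ∪ M ∧ ((lev x % (A + 1) = A ∧ ∀ y ∈ L ∪ M, lev y % (A + 1) = A → lev y ≤ lev x) ∨
    (x ∈ L ∧ (∀ y ∈ L ∪ M, lev y % (A + 1) ≠ A) ∧ ∀ y ∈ L, lev x ≤ lev y))

/-- The level of a token of level `l'` after it has been hit by a token of level `l`. -/
def hitLevel (A l l' : ℕ) : ℕ := if l % (A + 1) = A then max l l' + 1 else l' + 1

variable {G : SimpleGraph V} {K : ℕ → Finset V} {lam : ℕ → V → V}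
  {E : ℕ → Finset V} {N A b : ℕ} {κ σ : ℝ} {L M : Finset ℕ} {tok : ℕ → Token V} {C : Finset V}

/-- A player that is not full is lowest only among the tokens of `L`. A hit token of `M` may be
lower still, and then it gains just one leg, which is why `hitLevel` is not always `max + 1`. -/
theorem CanPlay.hitLevel_spec {lev : ℕ → ℕ} {x z : ℕ} (h : CanPlay A L M lev x)
    (hz : z ∈ L ∪ M) :
    (lev z % (A + 1) ≠ A ∧ hitLevel A (lev x) (lev z) = lev z + 1) ∨
      (lev x % (A + 1) = A ∧ hitLevel A (lev x) (lev z) = lev x + 1) := by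
  unfold hitLevel
  obtain ⟨hx, ⟨h1, h2⟩ | ⟨-, h1, h2⟩⟩ := h
  · rw [if_pos h1]
    rcases le_or_gt (lev z) (lev x) with hle | hlt
    · exact Or.inr ⟨h1, by omega⟩
    · refine Or.inl ⟨fun hf => ?_, by omega⟩
      have := h2 z hz hf
      omega
  · rw [if_neg (h1 x hx)]
    exact Or.inl ⟨h1 z hz, rfl⟩

/-- Bare block vertices have level `0`; the condition `0 < A` ensures that this level is not full.
-/
theorem hitLevel_zero_spec (hA : 0 < A) (l : ℕ) :
    (0 % (A + 1) ≠ A ∧ hitLevel A l 0 = 0 + 1) ∨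
      (l % (A + 1) = A ∧ hitLevel A l 0 = l + 1) := by
  unfold hitLevel
  by_cases h : l % (A + 1) = A
  · rw [if_pos h]; exact Or.inr ⟨h, by simp⟩
  · rw [if_neg h]; exact Or.inl ⟨by simp; omega, rfl⟩

theorem source_compat_source {C₁ C₂ : Finset V} (hd : Disjoint C₁ C₂)
    (hκ : ∀ v, ((C₂.filter fun u => G.Adj v u).card : ℝ) ≤ κ) :
    Compat G κ (source C₁) (source C₂) where
  cores := Finset.disjoint_empty_left _
  inner a ha := absurd ha (Set.notMem_empty a)
  inner_root a ha := absurd ha (Set.notMem_empty a)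
  root_ne i hi j hj hij := Finset.disjoint_left.1 hd hi (by
    have : i = j := hij
    rw [this]; exact hj)
  sparse i _ := hκ i

theorem GameState.valid_source (h : GameState G K lam E N A κ L M tok C b σ) (hb : 1 ≤ b) :
    (source C).Valid G K lam E N A b := by
  intro i hi
  obtain ⟨p, hp, hip⟩ := h.source_subset i hi
  refine ⟨?_, by simpa [source] using hb, ?_⟩
  · have : (source C).lev = 0 := rfl
    rw [this, Nat.zero_div, Nat.zero_mod]
    exact Head.block hp hip
  · intro a ha
    left
    rcases ha with ha | ⟨p, hp, -⟩
    · exact Finset.mem_singleton.1 ha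
    · exact absurd hp (Finset.notMem_empty p)

variable [Fintype V] {e : ℝ}

/-- One move of the game. -/
theorem GameState.move (hG : G.CoherentAt e) (hA : 0 < A) (hb : 1 ≤ b) {θ : ℝ} (hθ : 0 < θ)
    (heκ : e ≤ κ) (hκθ : κ ≤ θ)
    (h : GameState G K lam E N A κ L M tok C b (8 * θ)) {x : ℕ}
    (hx : CanPlay A L M (fun s => (tok s).lev) x) :
    ∃ tok' C', (∃ z ∈ (L ∪ M).erase x,
        GameState G K lam E N A κ (L.erase x) (M.erase x) tok' C' (b + b) θ ∧
        (tok' z).lev = hitLevel A (tok x).lev (tok z).lev ∧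
        ∀ t, t ≠ z → (tok' t).lev = (tok t).lev) ∨
      (GameState G K lam E N A κ (L.erase x) (insert x M) tok' C' (b + b) θ ∧
        (tok' x).lev = hitLevel A (tok x).lev 0 ∧
        ∀ t, t ≠ x → (tok' t).lev = (tok t).lev) := by
  have hxS := hx.1
  let S : Finset (Option ℕ) := Finset.insertNone ((L ∪ M).erase x)
  let tokO : Option ℕ → Token V := fun o => o.elim (source C) tok
  -- `none` stands for the source. Its threshold is lower because tokens of `L` also lose the
  -- indices that leave the source. Starting from `8 * θ`, a token that is not hit keeps at least `8
  -- * θ - (4 * θ + κ) - (θ + κ) ≥ θ`.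
  let thr : Option ℕ → ℝ := fun o => o.elim θ fun _ => 4 * θ
  have hcompx : ∀ t ∈ (L ∪ M).erase x, Compat G κ (tok x) (tok t) := fun t ht =>
    h.compat x hxS t (Finset.mem_of_mem_erase ht) (Finset.ne_of_mem_erase ht).symm
  have hcompx' : ∀ t ∈ (L ∪ M).erase x, Compat G κ (tok t) (tok x) := fun t ht =>
    h.compat t (Finset.mem_of_mem_erase ht) x hxS (Finset.ne_of_mem_erase ht)
  have hcO : ∀ t ∈ S, Compat G κ (tok x) (tokO t) := by
    rintro (_ | t) ht
    · exact h.compat_source x hxS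
    · exact hcompx t (Finset.some_mem_insertNone.1 ht)
  have hthr : ∀ t ∈ S, 0 < thr t := by
    rintro (_ | t) -
    · exact hθ
    · change 0 < 4 * θ; linarith
  have hxc := h.card_le x hxS
  have hCc := h.source_card
  have hex : ∃ t ∈ S, thr t ≤ (hits G (tok x) (tokO t) (tok x).I).card := by
    refine ⟨none, Finset.none_mem_insertNone, ?_⟩
    change θ ≤ ((hits G (tok x) (source C) (tok x).I).card : ℝ)
    -- A token of `L` hits its own indices, which are source vertices. A token of `M` has distinct
    -- roots, and coherence applies.
    rcases Finset.mem_union.1 hxS with hxL | hxM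
    · have : (tok x).I ⊆ hits G (tok x) (source C) (tok x).I := by
        intro i hi
        obtain ⟨h1, h2⟩ := h.adj_root x hxL i hi
        exact Finset.mem_filter.2 ⟨h1, i, hi, h2⟩
      have : ((tok x).I.card : ℝ) ≤ (hits G (tok x) (source C) (tok x).I).card := by
        exact_mod_cast Finset.card_le_card this
      linarith
    · have := hG.le_card_hits (h.compat_source x hxS) (h.root_eq x hxM) (fun _ _ => rfl)
        (by linarith)
      have h2 : ((source C).I.card : ℝ) = C.card := rfl
      linarith
  obtain ⟨D, hD, ⟨z, hz, hzθ⟩, hloss⟩ := exists_first_hit (tok x) S tokO thr hthr hcO hex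
  have hlC : ((hits G (tok x) (source C) D).card : ℝ) ≤ θ + κ :=
    hloss none Finset.none_mem_insertNone
  have hlt : ∀ t ∈ (L ∪ M).erase x, ((hits G (tok x) (tok t) D).card : ℝ) ≤ 4 * θ + κ :=
    fun t ht => hloss (some t) (Finset.some_mem_insertNone.2 ht)
  let C' : Finset V := clear G (tok x) (source C) D
  have hC'C : C' ⊆ C := clear_subset _ (source C) _
  have hC' : θ ≤ C'.card := by
    have h1 := card_clear (G := G) (tok x) (source C) D
    have h2 : ((source C).I.card : ℝ) = C.card := rfl
    change θ ≤ ((clear G (tok x) (source C) D).card : ℝ)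
    linarith
  have hsC : ∀ I : Finset V, I ⊆ C → I ⊆ C' ∪ hits G (tok x) (source C) D := by
    intro I hI i hi
    have : i ∈ (source C).I := hI hi
    simp only [C', clear, Finset.mem_union, Finset.mem_sdiff]
    tauto
  have hcardL : ∀ s ∈ L, ∀ I ⊆ (tok s).I, (I.card : ℝ) - (θ + κ) ≤ (I ∩ C').card := by
    intro s hs I hI
    have h1 : I ⊆ (I ∩ C') ∪ hits G (tok x) (source C) D := by
      intro i hi
      have := hsC I (fun j hj => (h.adj_root s hs j (hI hj)).1) hi
      simp only [Finset.mem_union, Finset.mem_inter] at this ⊢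
      tauto
    have h2 : (I.card : ℝ) ≤ (I ∩ C').card + (hits G (tok x) (source C) D).card := by
      exact_mod_cast (Finset.card_le_card h1).trans (Finset.card_union_le _ _)
    linarith
  -- Indices of tokens in `L` must stay in the source, so that these tokens remain able to hit it.
  let cut : ℕ → Finset V → Finset V := fun t I => if t ∈ L then I ∩ C' else I
  have cut_sub : ∀ t I, cut t I ⊆ I := by
    intro t I
    by_cases ht : t ∈ L
    · simp only [cut, if_pos ht]; exact Finset.inter_subset_left
    · simp only [cut, if_neg ht]; exact subset_rfl
  have cut_L : ∀ t ∈ L, ∀ I, cut t I ⊆ C' := by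
    intro t ht I
    simp only [cut, if_pos ht]; exact Finset.inter_subset_right
  have cut_card : ∀ t, ∀ I ⊆ (tok t).I, (I.card : ℝ) - (θ + κ) ≤ (cut t I).card := by
    intro t I hI
    by_cases ht : t ∈ L
    · simp only [cut, if_pos ht]; exact hcardL t ht I hI
    · simp only [cut, if_neg ht]
      have : 0 ≤ κ := by
        have := hG.degree_lt
        by_cases hV : Nonempty V
        · exact (hG.pos hV.some).le.trans heκ
        · have : IsEmpty V := not_nonempty_iff.1 hV
          have h0 : C'.card = 0 := by simp [Finset.eq_empty_of_isEmpty]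
          rw [h0] at hC'
          simp at hC'
          linarith
      linarith
  clear_value cut
  have hCc' : ∀ s ∈ L ∪ M, ∀ I ⊆ (tok s).I, Compat G κ ((tok s).restrict I) (source C') :=
    fun s hs I hI => (h.compat_source s hs).restrict hI hC'C
  have hCc : ∀ s ∈ L ∪ M, ∀ I ⊆ (tok s).I, Compat G κ (source C') ((tok s).restrict I) :=
    fun s hs I hI => (h.source_compat s hs).restrict hC'C hI
  rcases z with _ | z
  · -- the source is hit
    let Ch : Finset V := hits G (tok x) (source C) D
    have hChC : Ch ⊆ C := hits_subset (tok x) (source C) D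
    let nl := hitLevel A (tok x).lev 0
    let tok' : ℕ → Token V := fun t => if t = x then hit G (tok x) (source C) D nl
      else (tok t).restrict (cut t (clear G (tok x) (tok t) D))
    have tx : tok' x = hit G (tok x) (source C) D nl := if_pos rfl
    have tn : ∀ t, t ≠ x → tok' t = (tok t).restrict (cut t (clear G (tok x) (tok t) D)) :=
      fun t ht => if_neg ht
    have txI : (tok' x).I = Ch := by rw [tx]; rfl
    clear_value tok'
    have hmem : ∀ s ∈ L.erase x ∪ insert x M, s ≠ x → s ∈ (L ∪ M).erase x := by
      intro s hs hsx
      simp only [Finset.mem_union, Finset.mem_erase, Finset.mem_insert] at hs ⊢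
      tauto
    have hcs : ∀ t, cut t (clear G (tok x) (tok t) D) ⊆ (tok t).I := fun t =>
      (cut_sub _ _).trans (clear_subset _ _ _)
    refine ⟨tok', C', Or.inr ⟨?_, by rw [tx]; rfl, fun t ht => by rw [tn t ht]; rfl⟩⟩
    constructor
    · rw [Finset.disjoint_left]
      intro a ha ha'
      rw [Finset.mem_erase] at ha
      rw [Finset.mem_insert] at ha'
      exact Finset.disjoint_left.1 h.disjoint ha.2 (ha'.resolve_left ha.1)
    · intro s hs
      by_cases hsx : s = x
      · subst hsx
        rw [tx]
        exact valid_hit hD (h.valid_source hb) (h.valid s hxS) (h.source_compat s hxS)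
          (h.compat_source s hxS) (h.cores_nonempty s hxS) (hitLevel_zero_spec hA _)
      · rw [tn s hsx]
        exact ((h.valid s (Finset.mem_of_mem_erase (hmem s hs hsx))).restrict (hcs s)).mono
          (by omega)
    · exact fun v hv => h.source_subset v (hC'C hv)
    · intro s hs t ht hst
      by_cases hsx : s = x
      · subst hsx
        have ht' := hmem t ht hst.symm
        rw [tx, tn t hst.symm]
        exact compat_hit_clear hD (cut_sub _ _) (h.source_compat t (Finset.mem_of_mem_erase ht'))
          (hcompx t ht') (hcompx' t ht')
      · have hs' := hmem s hs hsx
        rw [tn s hsx]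
        by_cases htx : t = x
        · subst htx
          rw [tx]
          exact compat_clear_hit hD (hcs s) (h.compat_source s (Finset.mem_of_mem_erase hs'))
            (hcompx' s hs')
        · have ht' := hmem t ht htx
          rw [tn t htx]
          exact (h.compat s (Finset.mem_of_mem_erase hs') t (Finset.mem_of_mem_erase ht')
            hst).restrict (hcs s) (hcs t)
    · intro s hs
      by_cases hsx : s = x
      · subst hsx
        rw [tx]
        have hcc : Compat G κ (source Ch) (source C') := source_compat_source
          (Finset.disjoint_sdiff) (fun v => (hG.card_filter_adj_lt _ v).le.trans heκ)
        exact hcc.merge_left ((h.compat_source s hxS).restrict hD hC'C)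
          ((h.source_compat s hxS).restrict hC'C hD)
          (fun i hi j hj => not_adj_of_clear (X := tok s) (T := source C) i hi j hj)
      · rw [tn s hsx]
        exact hCc' s (Finset.mem_of_mem_erase (hmem s hs hsx)) _ (hcs s)
    · intro s hs
      by_cases hsx : s = x
      · subst hsx
        rw [tx]
        have hcc : Compat G κ (source C') (source Ch) := source_compat_source
          (Finset.disjoint_sdiff.symm) (fun v => (hG.card_filter_adj_lt _ v).le.trans heκ)
        exact hcc.merge_right ((h.source_compat s hxS).restrict hC'C hD)
      · rw [tn s hsx]
        exact hCc s (Finset.mem_of_mem_erase (hmem s hs hsx)) _ (hcs s)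
    · intro s hs
      by_cases hsx : s = x
      · subst hsx
        rw [tx]
        exact (h.cores_nonempty s hxS).mono Finset.subset_union_right
      · rw [tn s hsx]
        exact h.cores_nonempty s (Finset.mem_of_mem_erase (hmem s hs hsx))
    · intro s hs
      by_cases hsx : s = x
      · subst hsx
        rw [txI]
        exact hzθ
      · have hs' := hmem s hs hsx
        rw [tn s hsx]
        have h1 := h.card_le s (Finset.mem_of_mem_erase hs')
        have h2 := hlt s hs'
        have h3 := cut_card s _ (clear_subset (G := G) (tok x) (tok s) D)
        rw [card_clear] at h3
        change θ ≤ ((cut s (clear G (tok x) (tok s) D)).card : ℝ)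
        linarith
    · exact hC'
    · intro s hs i hi
      have hsx := Finset.ne_of_mem_erase hs
      have hsL := Finset.mem_of_mem_erase hs
      rw [tn s hsx] at hi ⊢
      exact ⟨cut_L s hsL _ hi, (h.adj_root s hsL i (hcs s hi)).2⟩
    · intro s hs i hi
      by_cases hsx : s = x
      · subst hsx
        rw [tx]; rfl
      · rw [tn s hsx] at hi ⊢
        exact h.root_eq s ((Finset.mem_insert.1 hs).resolve_left hsx) i (hcs s hi)
  · -- another token is hit
    have hzS : z ∈ (L ∪ M).erase x := Finset.some_mem_insertNone.1 hz
    have hzLM := Finset.mem_of_mem_erase hzS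
    have hzθ' : 4 * θ ≤ ((hits G (tok x) (tok z) D).card : ℝ) := hzθ
    let nl := hitLevel A (tok x).lev (tok z).lev
    let tok' : ℕ → Token V := fun t => if t = z then
        (hit G (tok x) (tok z) D nl).restrict (cut z (hits G (tok x) (tok z) D))
      else (tok t).restrict (cut t (clear G (tok x) (tok t) D))
    have tz : tok' z = (hit G (tok x) (tok z) D nl).restrict
      (cut z (hits G (tok x) (tok z) D)) := if_pos rfl
    have tn : ∀ t, t ≠ z → tok' t = (tok t).restrict (cut t (clear G (tok x) (tok t) D)) :=
      fun t ht => if_neg ht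
    clear_value tok'
    have hmem : ∀ s ∈ L.erase x ∪ M.erase x, s ∈ (L ∪ M).erase x := by
      intro s hs
      simp only [Finset.mem_union, Finset.mem_erase] at hs ⊢
      tauto
    have hcs : ∀ t, cut t (clear G (tok x) (tok t) D) ⊆ (tok t).I := fun t =>
      (cut_sub _ _).trans (clear_subset _ _ _)
    have hch : cut z (hits G (tok x) (tok z) D) ⊆ (hit G (tok x) (tok z) D nl).I := cut_sub _ _
    have rself : ∀ T : Token V, T.restrict T.I = T := fun _ => rfl
    refine ⟨tok', C', Or.inl ⟨z, hzS, ?_, by rw [tz]; rfl, fun t ht => by rw [tn t ht]; rfl⟩⟩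
    constructor
    · exact h.disjoint.mono (Finset.erase_subset _ _) (Finset.erase_subset _ _)
    · intro s hs
      have hs' := hmem s hs
      have hsLM := Finset.mem_of_mem_erase hs'
      by_cases hsz : s = z
      · subst hsz
        rw [tz]
        exact (valid_hit hD (h.valid s hsLM) (h.valid x hxS) (hcompx' s hs') (hcompx s hs')
          (h.cores_nonempty x hxS) (hx.hitLevel_spec hsLM)).restrict hch
      · rw [tn s hsz]
        exact ((h.valid s hsLM).restrict (hcs s)).mono (by omega)
    · exact fun v hv => h.source_subset v (hC'C hv)
    · intro s hs t ht hst
      have hs' := hmem s hs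
      have hsLM := Finset.mem_of_mem_erase hs'
      have ht' := hmem t ht
      have htLM := Finset.mem_of_mem_erase ht'
      by_cases hsz : s = z
      · subst hsz
        rw [tz, tn t hst.symm]
        have := compat_hit_clear (lev := nl) hD (cut_sub t (clear G (tok x) (tok t) D))
          (h.compat s hsLM t htLM hst) (hcompx t ht') (hcompx' t ht')
        exact this.restrict hch subset_rfl
      · rw [tn s hsz]
        by_cases htz : t = z
        · subst htz
          rw [tz]
          have := compat_clear_hit (lev := nl) hD (hcs s) (h.compat s hsLM t htLM hst)
            (hcompx' s hs')
          exact this.restrict subset_rfl hch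
        · rw [tn t htz]
          exact (h.compat s hsLM t htLM hst).restrict (hcs s) (hcs t)
    · intro s hs
      have hs' := hmem s hs
      have hsLM := Finset.mem_of_mem_erase hs'
      by_cases hsz : s = z
      · subst hsz
        rw [tz]
        have := compat_hit_clear (X := tok x) (Z := tok s) (T := source C) (I := C') (lev := nl) hD
          subset_rfl (h.compat_source s hsLM) (h.compat_source x hxS) (h.source_compat x hxS)
        exact this.restrict hch subset_rfl
      · rw [tn s hsz]
        exact hCc' s hsLM _ (hcs s)
    · intro s hs
      have hs' := hmem s hs
      have hsLM := Finset.mem_of_mem_erase hs'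
      by_cases hsz : s = z
      · subst hsz
        rw [tz]
        have := compat_clear_hit (X := tok x) (Z := tok s) (T := source C) (I := C') (lev := nl) hD
          hC'C (h.source_compat s hsLM) (h.source_compat x hxS)
        exact this.restrict subset_rfl hch
      · rw [tn s hsz]
        exact hCc s hsLM _ (hcs s)
    · intro s hs
      have hs' := hmem s hs
      have hsLM := Finset.mem_of_mem_erase hs'
      by_cases hsz : s = z
      · subst hsz
        rw [tz]
        exact (h.cores_nonempty s hsLM).mono Finset.subset_union_left
      · rw [tn s hsz]
        exact h.cores_nonempty s hsLM
    · intro s hs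
      have hs' := hmem s hs
      have hsLM := Finset.mem_of_mem_erase hs'
      by_cases hsz : s = z
      · subst hsz
        rw [tz]
        have h3 := cut_card s _ (hits_subset (G := G) (tok x) (tok s) D)
        change θ ≤ ((cut s (hits G (tok x) (tok s) D)).card : ℝ)
        linarith
      · rw [tn s hsz]
        have h1 := h.card_le s hsLM
        have h2 := hlt s hs'
        have h3 := cut_card s _ (clear_subset (G := G) (tok x) (tok s) D)
        rw [card_clear] at h3
        change θ ≤ ((cut s (clear G (tok x) (tok s) D)).card : ℝ)
        linarith
    · exact hC'
    · intro s hs i hi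
      have hsL := Finset.mem_of_mem_erase hs
      by_cases hsz : s = z
      · subst hsz
        rw [tz] at hi ⊢
        exact ⟨cut_L s hsL _ hi, (h.adj_root s hsL i (hits_subset _ _ _ (hch hi))).2⟩
      · rw [tn s hsz] at hi ⊢
        exact ⟨cut_L s hsL _ hi, (h.adj_root s hsL i (hcs s hi)).2⟩
    · intro s hs i hi
      have hsM := Finset.mem_of_mem_erase hs
      by_cases hsz : s = z
      · subst hsz
        rw [tz] at hi ⊢
        exact h.root_eq s hsM i (hits_subset _ _ _ (hch hi))
      · rw [tn s hsz] at hi ⊢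
        exact h.root_eq s hsM i (hcs s hi)

end SimpleGraph

/-! ### The potential of the game, and why it forces a high level. -/

namespace SimpleGraph

open scoped Classical

open Token

/-- The potential of a token of level `l`, with parameter `m`; attachments weigh more. -/
noncomputable def tokenWeight (β m : ℕ) (isL : Prop) (l : ℕ) : ℕ :=
  if isL then β ^ (2 * l + 1) else 2 ^ l * m + β ^ (2 * l)

theorem tokenWeight_mono_level {β m : ℕ} (hβ : 0 < β) (p : Prop) {l l' : ℕ} (h : l ≤ l') :
    tokenWeight β m p l ≤ tokenWeight β m p l' := by
  unfold tokenWeight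
  split_ifs
  · exact Nat.pow_le_pow_right hβ (by omega)
  · exact Nat.add_le_add (Nat.mul_le_mul_right _ (Nat.pow_le_pow_right (by norm_num) h))
      (Nat.pow_le_pow_right hβ (by omega))

theorem tokenWeight_mono_param {β m m' : ℕ} (p : Prop) (l : ℕ) (h : m ≤ m') :
    tokenWeight β m p l ≤ tokenWeight β m' p l := by
  unfold tokenWeight
  split_ifs
  · exact le_rfl
  · exact Nat.add_le_add_right (Nat.mul_le_mul_left _ h) _

/-- This covers a full player. The exponent grows by two per level, so one level gains a factor `β ^
2`, enough to absorb two weights of level `s`. The choice `β = 2 ^ (T + 1)` gives `2 * 2 ^ s ≤ β`,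
which handles the summand `2 ^ s * m` when the hit token lies in `L`. -/
theorem tokenWeight_add_le {T β m l t : ℕ} (hT : 1 ≤ T) (hβ : β = 2 ^ (T + 1)) (p q : Prop)
    (hl : l < T) (ht : t < T) (hm : q → m ≤ β ^ (2 * t + 1)) :
    tokenWeight β m p l + tokenWeight β m q t ≤ tokenWeight β m q (max l t + 1) := by
  set s := max l t with hs
  have hβ4 : 4 ≤ β := by
    rw [hβ]
    calc 4 = 2 ^ 2 := by norm_num
      _ ≤ 2 ^ (T + 1) := Nat.pow_le_pow_right (by norm_num) (by omega)
  have hβ0 : 0 < β := by omega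
  refine (Nat.add_le_add (tokenWeight_mono_level hβ0 p (le_max_left l t))
    (tokenWeight_mono_level hβ0 q (le_max_right l t))).trans ?_
  rw [← hs]
  have hsT : s + 1 ≤ T := by omega
  have h2s : 2 * 2 ^ s ≤ β := by
    rw [hβ, ← pow_succ']
    exact Nat.pow_le_pow_right (by norm_num) (by omega)
  have hmX : q → m ≤ β * β ^ (2 * s) := fun hq => (hm hq).trans (by
    rw [← pow_succ']; exact Nat.pow_le_pow_right hβ0 (by omega))
  have e1 : β ^ (2 * s + 1) = β * β ^ (2 * s) := by ring
  have e2 : β ^ (2 * (s + 1) + 1) = β * (β * (β * β ^ (2 * s))) := by ring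
  have e3 : β ^ (2 * (s + 1)) = β * (β * β ^ (2 * s)) := by ring
  have e4 : 2 ^ (s + 1) * m = 2 * (2 ^ s * m) := by ring
  unfold tokenWeight
  rw [e1, e2, e3, e4]
  generalize β ^ (2 * s) = X at *
  have hX1 : 4 * X ≤ β * X := Nat.mul_le_mul_right _ hβ4
  have hX2 : 4 * (β * X) ≤ β * (β * X) := Nat.mul_le_mul_right _ hβ4
  have hX3 : 4 * (β * (β * X)) ≤ β * (β * (β * X)) := Nat.mul_le_mul_right _ hβ4
  by_cases hq : q
  · have h5 : 2 * (2 ^ s * m) ≤ β * (β * X) := by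
      rw [← Nat.mul_assoc]
      exact Nat.mul_le_mul h2s (hmX hq)
    rw [if_pos hq, if_pos hq]
    split_ifs <;> omega
  · rw [if_neg hq, if_neg hq]
    split_ifs <;> omega

/-- This covers a player in `L` that is not full, of weight exactly `m`. A hit token of `M` may have
much lower level, where powers of `β` gain too little; its summand `2 ^ t * m` doubles and thereby
absorbs `m`. -/
theorem tokenWeight_min_add_le {β l t : ℕ} (hβ4 : 4 ≤ β) (q : Prop) (hm : q → l ≤ t) :
    β ^ (2 * l + 1) + tokenWeight β (β ^ (2 * l + 1)) q t ≤
      tokenWeight β (β ^ (2 * l + 1)) q (t + 1) := by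
  have hβ0 : 0 < β := by omega
  unfold tokenWeight
  have e1 : β ^ (2 * t + 1) = β * β ^ (2 * t) := by ring
  have e2 : β ^ (2 * (t + 1) + 1) = β * (β * (β * β ^ (2 * t))) := by ring
  have e3 : β ^ (2 * (t + 1)) = β * (β * β ^ (2 * t)) := by ring
  have hX1 : 4 * β ^ (2 * t) ≤ β * β ^ (2 * t) := Nat.mul_le_mul_right _ hβ4
  have hX2 : 4 * (β * β ^ (2 * t)) ≤ β * (β * β ^ (2 * t)) := Nat.mul_le_mul_right _ hβ4
  have hX3 : 4 * (β * (β * β ^ (2 * t))) ≤ β * (β * (β * β ^ (2 * t))) :=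
    Nat.mul_le_mul_right _ hβ4
  by_cases hq : q
  · rw [if_pos hq, if_pos hq]
    have : β ^ (2 * l + 1) ≤ β ^ (2 * t + 1) :=
      Nat.pow_le_pow_right hβ0 (by have := hm hq; omega)
    rw [e1] at this ⊢
    rw [e2]
    omega
  · rw [if_neg hq, if_neg hq, e3]
    have : 1 * β ^ (2 * l + 1) ≤ 2 ^ t * β ^ (2 * l + 1) :=
      Nat.mul_le_mul_right _ Nat.one_le_two_pow
    have e4 : 2 ^ (t + 1) * β ^ (2 * l + 1) = 2 * (2 ^ t * β ^ (2 * l + 1)) := by ring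
    omega

variable {V : Type u} {G : SimpleGraph V} {K : ℕ → Finset V} {lam : ℕ → V → V}
  {E : ℕ → Finset V} {N A : ℕ} {κ : ℝ}

theorem le_hitLevel (A l l' : ℕ) : l' + 1 ≤ hitLevel A l l' := by
  unfold hitLevel
  split_ifs <;> omega

variable [Fintype V] {e : ℝ}

/-- A game state of large potential leads to a structure of high level. -/
theorem GameState.hasHead (hG : G.CoherentAt e) (hA : 0 < A) {T β : ℕ} (hT : 1 ≤ T)
    (hβ : β = 2 ^ (T + 1)) {s₀ : ℝ} (hs₀ : 0 < s₀) (heκ : e ≤ κ) (hκs : κ ≤ s₀) :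
    ∀ (f : ℕ) (L M : Finset ℕ) (tok : ℕ → Token V) (C : Finset V) (b m : ℕ), 1 ≤ b →
      GameState G K lam E N A κ L M tok C b (8 ^ f * (4 ^ (2 ^ T) * s₀)) →
      ∑ s ∈ L ∪ M, (if s ∈ L then T + 1 else T - (tok s).lev) ≤ f →
      (∀ s ∈ L, m ≤ β ^ (2 * (tok s).lev + 1)) → m ≤ β ^ (2 * T + 1) →
      2 ^ T * (2 ^ T * β ^ (2 * T + 1) + β ^ (2 * T)) <
        ∑ s ∈ L ∪ M, tokenWeight β m (s ∈ L) (tok s).lev →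
      HasHead G K lam E N A T (b * 2 ^ f * 2 ^ (2 ^ T)) := by
  have hβ4 : 4 ≤ β := by
    rw [hβ]
    calc 4 = 2 ^ 2 := by norm_num
      _ ≤ 2 ^ (T + 1) := Nat.pow_le_pow_right (by norm_num) (by omega)
  have hβ0 : 0 < β := by omega
  have h4 : (0 : ℝ) < 4 ^ (2 ^ T) * s₀ := by positivity
  have h4' : s₀ ≤ 4 ^ (2 ^ T) * s₀ := le_mul_of_one_le_left hs₀.le (one_le_pow₀ (by norm_num))
  -- `f` bounds the number of remaining moves. The player disappears, or passes from `L` (worth `T +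
  -- 1`) to `M`, or is a full token of `M` whose level rises; in each case the sum drops.
  intro f
  induction f with
  | zero =>
    intro L M tok C b m hb h hμ hm hmT hΦ
    by_cases hwin : ∃ s ∈ L ∪ M, T ≤ (tok s).lev
    · obtain ⟨s, hs, hL⟩ := hwin
      refine ((h.valid s hs).hasHead ?_ hL).mono ?_
      · rw [← Finset.card_pos]
        have := h.card_le s hs
        have : (0 : ℝ) < (tok s).I.card := by linarith
        exact_mod_cast this
      · rw [Nat.mul_assoc]
        exact Nat.le_mul_of_pos_right _ (by positivity)
    · push Not at hwin
      -- Below level `T` every token contributes at least one to the sum bounded by `f = 0`. So none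
      -- is left, against the lower bound on the potential.
      have hS : L ∪ M = ∅ := by
        rw [Finset.eq_empty_iff_forall_notMem]
        intro s hs
        have h1 := Finset.single_le_sum (f := fun s => if s ∈ L then T + 1 else T - (tok s).lev)
          (fun _ _ => Nat.zero_le _) hs
        have := hwin s hs
        split_ifs at h1 <;> omega
      rw [hS] at hΦ
      simp at hΦ
  | succ f ih =>
    intro L M tok C b m hb h hμ hm hmT hΦ
    have hpow : (0 : ℝ) < 8 ^ f * (4 ^ (2 ^ T) * s₀) := by positivity
    have h8 : (8 : ℝ) ^ (f + 1) * (4 ^ (2 ^ T) * s₀) = 8 * (8 ^ f * (4 ^ (2 ^ T) * s₀)) := by ring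
    have h8' : 4 ^ (2 ^ T) * s₀ ≤ 8 ^ f * (4 ^ (2 ^ T) * s₀) :=
      le_mul_of_one_le_left h4.le (one_le_pow₀ (by norm_num))
    rw [h8] at h
    set θ : ℝ := 8 ^ f * (4 ^ (2 ^ T) * s₀)
    by_cases hwin : ∃ s ∈ L ∪ M, T ≤ (tok s).lev
    · obtain ⟨s, hs, hL⟩ := hwin
      refine ((h.valid s hs).hasHead ?_ hL).mono ?_
      · rw [← Finset.card_pos]
        have := h.card_le s hs
        have : (0 : ℝ) < (tok s).I.card := by linarith
        exact_mod_cast this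
      · rw [Nat.mul_assoc]
        exact Nat.le_mul_of_pos_right _ (by positivity)
    push Not at hwin
    -- `2 ^ T` rooted tokens, each of level at least `0`, already win the rooted game.
    by_cases hM : 2 ^ T ≤ M.card
    · obtain ⟨M', hM'M, hM'c⟩ := Finset.exists_subset_card_eq hM
      have hsub : ∀ s ∈ M', s ∈ L ∪ M := fun s hs => Finset.mem_union_right _ (hM'M hs)
      have := RootedFamily.hasHead (K := K) (lam := lam) (E := E) (N := N) (A := A) (L := T)
        (κ := κ) hG hs₀ (heκ.trans hκs) hκs (2 ^ T) M' tok b hM'c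
        (by positivity) ⟨fun s hs => h.valid s (hsub s hs),
          fun s hs t ht => h.compat s (hsub s hs) t (hsub t ht),
          fun s hs => h.cores_nonempty s (hsub s hs), fun s hs => h.root_eq s (hM'M hs),
          fun s hs => by have := h.card_le s (hsub s hs); linarith⟩ (by
          calc 2 ^ T = ∑ s ∈ M', 1 := by simp [hM'c]
            _ ≤ _ := Finset.sum_le_sum fun s _ => Nat.one_le_two_pow)
      refine this.mono ?_
      rw [Nat.mul_assoc]
      exact Nat.mul_le_mul_left _ (Nat.le_mul_of_pos_left _ (by positivity))
    push Not at hM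
    -- the player
    obtain ⟨x, m', hx, hmm', hm', hm'T, hxm⟩ : ∃ x m', CanPlay A L M (fun s => (tok s).lev) x ∧
        m ≤ m' ∧ (∀ s ∈ L, m' ≤ β ^ (2 * (tok s).lev + 1)) ∧ m' ≤ β ^ (2 * T + 1) ∧
        ((tok x).lev % (A + 1) = A ∨ (x ∈ L ∧ m' = β ^ (2 * (tok x).lev + 1) ∧
          ∀ s ∈ L, (tok x).lev ≤ (tok s).lev)) := by
      have hS : (L ∪ M).Nonempty := by
        rw [Finset.nonempty_iff_ne_empty]
        intro hS
        rw [hS] at hΦ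
        simp at hΦ
      obtain ⟨x, hx, ⟨h1, h2⟩ | ⟨h1, -⟩⟩ := exists_player A hS fun s => (tok s).lev
      · exact ⟨x, m, ⟨hx, Or.inl ⟨h1, h2⟩⟩, le_rfl, hm, hmT, Or.inl h1⟩
      -- If `L` were empty, there would be fewer than `2 ^ T` tokens, each of weight at most that of
      -- a token of `M` at level `T`, contradicting `hΦ`.
      · have hL : L.Nonempty := by
          rw [Finset.nonempty_iff_ne_empty]
          intro hL
          subst hL
          simp only [Finset.empty_union, Finset.notMem_empty] at hΦ hwin
          have h3 : ∑ s ∈ M, tokenWeight β m False (tok s).lev ≤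
              ∑ s ∈ M, (2 ^ T * β ^ (2 * T + 1) + β ^ (2 * T)) := by
            refine Finset.sum_le_sum fun s hs => ?_
            refine (tokenWeight_mono_level hβ0 False (hwin s hs).le).trans ?_
            unfold tokenWeight
            rw [if_neg id]
            exact Nat.add_le_add_right (Nat.mul_le_mul_left _ hmT) _
          rw [Finset.sum_const, smul_eq_mul] at h3
          have h4 := Nat.mul_le_mul_right (2 ^ T * β ^ (2 * T + 1) + β ^ (2 * T)) hM.le
          omega
        obtain ⟨y, hy, hmin⟩ := Finset.exists_min_image L (fun s => (tok s).lev) hL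
        have hyT := hwin y (Finset.mem_union_left _ hy)
        refine ⟨y, β ^ (2 * (tok y).lev + 1), ⟨Finset.mem_union_left _ hy, Or.inr ⟨hy, h1, hmin⟩⟩,
          hm y hy, fun s hs => ?_, ?_, Or.inr ⟨hy, rfl, hmin⟩⟩
        · exact Nat.pow_le_pow_right hβ0 (by have := hmin s hs; omega)
        · exact Nat.pow_le_pow_right hβ0 (by omega)
    have hxS := hx.1
    have hxT := hwin x hxS
    have hΦ' : 2 ^ T * (2 ^ T * β ^ (2 * T + 1) + β ^ (2 * T)) <
        ∑ s ∈ L ∪ M, tokenWeight β m' (s ∈ L) (tok s).lev :=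
      hΦ.trans_le (Finset.sum_le_sum fun s _ => tokenWeight_mono_param _ _ hmm')
    have hbb : (b + b) * 2 ^ f * 2 ^ 2 ^ T = b * 2 ^ (f + 1) * 2 ^ 2 ^ T := by ring
    obtain ⟨tok', C', ⟨z, hz, h', hzl, htl⟩ | ⟨h', hxl, htl⟩⟩ :=
      h.move hG hA hb hpow heκ (by linarith) hx
    · have hzS := Finset.mem_of_mem_erase hz
      have hzT := hwin z hzS
      have hle : ∀ t, (tok t).lev ≤ (tok' t).lev := by
        intro t
        by_cases htz : t = z
        · subst htz; rw [hzl]; have := le_hitLevel A (tok x).lev (tok t).lev; omega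
        · rw [htl t htz]
      have hS' : L.erase x ∪ M.erase x = (L ∪ M).erase x := (Finset.erase_union_distrib L M x).symm
      have hLmem : ∀ t ∈ (L ∪ M).erase x, (t ∈ L.erase x) = (t ∈ L) := fun t ht => by
        rw [Finset.mem_erase, eq_iff_iff]
        exact and_iff_right (Finset.ne_of_mem_erase ht)
      have := ih (L.erase x) (M.erase x) tok' C' (b + b) m' (by omega) h' ?_ ?_ hm'T ?_
      · rw [hbb] at this
        exact this
      · rw [hS']
        have h1 : ∑ s ∈ (L ∪ M).erase x, (if s ∈ L.erase x then T + 1 else T - (tok' s).lev) ≤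
            ∑ s ∈ (L ∪ M).erase x, (if s ∈ L then T + 1 else T - (tok s).lev) := by
          refine Finset.sum_le_sum fun s hs => ?_
          simp only [hLmem s hs]
          have := hle s
          split_ifs <;> omega
        have h2 := Finset.add_sum_erase (L ∪ M)
          (fun s => if s ∈ L then T + 1 else T - (tok s).lev) hxS
        have h3 : 1 ≤ if x ∈ L then T + 1 else T - (tok x).lev := by split_ifs <;> omega
        omega
      · intro s hs
        exact (hm' s (Finset.mem_of_mem_erase hs)).trans
          (Nat.pow_le_pow_right hβ0 (by have := hle s; omega))
      · rw [hS']
        refine hΦ'.trans_le ?_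
        have h1 := sum_change (f := fun s => tokenWeight β m' (s ∈ L) (tok s).lev)
          (g := fun s => tokenWeight β m' (s ∈ L) (tok' s).lev) hz
          (fun t _ htz => by simp only [htl t htz])
        have h2 := Finset.add_sum_erase (L ∪ M)
          (fun s => tokenWeight β m' (s ∈ L) (tok s).lev) hxS
        have h3 : ∑ s ∈ (L ∪ M).erase x, tokenWeight β m' (s ∈ L.erase x) (tok' s).lev =
            ∑ s ∈ (L ∪ M).erase x, tokenWeight β m' (s ∈ L) (tok' s).lev :=
          Finset.sum_congr rfl fun s hs => by rw [hLmem s hs]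
        have h4 : tokenWeight β m' (x ∈ L) (tok x).lev + tokenWeight β m' (z ∈ L) (tok z).lev ≤
            tokenWeight β m' (z ∈ L) (tok' z).lev := by
          rw [hzl]
          unfold hitLevel
          by_cases hfull : (tok x).lev % (A + 1) = A
          · rw [if_pos hfull]
            exact tokenWeight_add_le hT hβ _ _ hxT hzT (hm' z)
          · rw [if_neg hfull]
            obtain ⟨hxL, hme, hmin⟩ := hxm.resolve_left hfull
            have := tokenWeight_min_add_le (β := β) (l := (tok x).lev) (t := (tok z).lev) hβ4
              (z ∈ L) (hmin z)
            rw [← hme] at this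
            refine le_trans (Nat.add_le_add_right ?_ _) this
            unfold tokenWeight
            rw [if_pos hxL, hme]
        rw [h3]
        omega
    · have hS' : L.erase x ∪ insert x M = L ∪ M := by
        ext t
        simp only [Finset.mem_union, Finset.mem_erase, Finset.mem_insert] at hxS ⊢
        by_cases htx : t = x
        · subst htx; tauto
        · tauto
      have hLmem : ∀ t, t ≠ x → ((t ∈ L.erase x) = (t ∈ L)) := fun t ht => by
        rw [Finset.mem_erase, eq_iff_iff]
        exact and_iff_right ht
      have hxL' : x ∉ L.erase x := Finset.notMem_erase x L
      have hlx : 1 ≤ (tok' x).lev ∧ ((tok x).lev % (A + 1) = A → (tok' x).lev = (tok x).lev + 1) := by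
        rw [hxl]
        refine ⟨le_hitLevel A _ 0, fun hf => ?_⟩
        unfold hitLevel
        rw [if_pos hf]
        simp
      have := ih (L.erase x) (insert x M) tok' C' (b + b) m' (by omega) h' ?_ ?_ hm'T ?_
      · rw [hbb] at this
        exact this
      · rw [hS']
        have h1 := sum_change (f := fun s => if s ∈ L then T + 1 else T - (tok s).lev)
          (g := fun s => if s ∈ L.erase x then T + 1 else T - (tok' s).lev) hxS
          (fun t _ htx => by simp only [htl t htx, hLmem t htx])
        simp only [if_neg hxL'] at h1
        have h3 : T - (tok' x).lev < if x ∈ L then T + 1 else T - (tok x).lev := by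
          by_cases hxL : x ∈ L
          · rw [if_pos hxL]; omega
          · rw [if_neg hxL]
            have := hlx.2 (hxm.resolve_right fun h => hxL h.1)
            omega
        omega
      · intro s hs
        have := hm' s (Finset.mem_of_mem_erase hs)
        rwa [htl s (Finset.ne_of_mem_erase hs)]
      · rw [hS']
        refine hΦ'.trans_le ?_
        have h1 := sum_change (f := fun s => tokenWeight β m' (s ∈ L) (tok s).lev)
          (g := fun s => tokenWeight β m' (s ∈ L.erase x) (tok' s).lev) hxS
          (fun t _ htx => by simp only [htl t htx, hLmem t htx])
        -- A full player rises one level, and `β ^ (2 * (l + 1))` exceeds the weight `β ^ (2 * l +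
        -- 1)` it had in `L`. A player that is not full had weight exactly `m'`, which its new
        -- weight in `M` contains with a positive coefficient.
        have h4 : tokenWeight β m' (x ∈ L) (tok x).lev ≤
            tokenWeight β m' (x ∈ L.erase x) (tok' x).lev := by
          have hpp : tokenWeight β m' (x ∈ L.erase x) (tok' x).lev =
              2 ^ (tok' x).lev * m' + β ^ (2 * (tok' x).lev) := if_neg hxL'
          rcases hxm with hf | ⟨hxL, hme, -⟩
          · have hl := hlx.2 hf
            rw [hpp, hl]
            unfold tokenWeight
            split_ifs
            · refine le_trans ?_ (Nat.le_add_left _ _)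
              exact Nat.pow_le_pow_right hβ0 (by omega)
            · exact Nat.add_le_add (Nat.mul_le_mul_right _
                (Nat.pow_le_pow_right (by norm_num) (by omega)))
                (Nat.pow_le_pow_right hβ0 (by omega))
          · rw [hpp]
            unfold tokenWeight
            rw [if_pos hxL, ← hme]
            exact le_trans (Nat.le_mul_of_pos_left _ (by positivity)) (Nat.le_add_right _ _)
        omega

end SimpleGraph

/-! ### The starting position provided by a pool. -/

namespace SimpleGraph

open scoped Classical

open Token

variable {V : Type u} {G : SimpleGraph V} {K : ℕ → Finset V} {lam : ℕ → V → V}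
  {E : ℕ → Finset V} {N A : ℕ} {κ σ e : ℝ}

theorem IsPool.restrict (h : G.IsPool N K lam E κ σ) {E' : ℕ → Finset V} {σ' : ℝ}
    (hE : ∀ p < N, E' p ⊆ E p) (hσ : ∀ p < N, σ' ≤ (E' p).card) :
    G.IsPool N K lam E' κ σ' where
  conn := h.conn
  core_anti := h.core_anti
  lam_adj p hp x hx := h.lam_adj p hp x (hE p hp hx)
  lam_core p hp x hx := h.lam_core p hp x (hE p hp hx)
  lam_notMem p hp x hx := h.lam_notMem p hp x (hE p hp hx)
  lam_anti p hp q hq hpq x hx := h.lam_anti p hp q hq hpq x (hE p hp hx)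
  block_anti p hp q hq x hx := h.block_anti p hp q hq x (hE p hp hx)
  block_disjoint p hp q hq hpq :=
    Finset.disjoint_of_subset_left (hE p hp) (Finset.disjoint_of_subset_right (hE q hq)
      (h.block_disjoint p hp q hq hpq))
  block_card := hσ
  lam_lam p hp q hq hpq i hi := (Nat.cast_le.2 (Finset.card_le_card
    (Finset.filter_subset_filter _ (hE p hp)))).trans (h.lam_lam p hp q hq hpq i (hE q hq hi))
  lam_block p hp q hq i hi := (Nat.cast_le.2 (Finset.card_le_card
    (Finset.filter_subset_filter _ (hE p hp)))).trans (h.lam_block p hp q hq i (hE q hq hi))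

theorem IsPool.lam_ne_lam (h : G.IsPool N K lam E κ σ) {p q : ℕ} (hp : p < N) (hq : q < N)
    (hpq : p ≠ q) {x y : V} (hx : x ∈ E p) (hy : y ∈ E q) : lam p x ≠ lam q y := by
  intro heq
  obtain ⟨z, hz, hadj⟩ := h.lam_core p hp x hx
  exact (h.lam_anti q hq p hp hpq.symm y hy z hz).2 (heq ▸ hadj)

theorem IsPool.lam_ne_block (h : G.IsPool N K lam E κ σ) {p q : ℕ} (hp : p < N) (hq : q < N)
    {x y : V} (hx : x ∈ E p) (hy : y ∈ E q) : lam p x ≠ y := by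
  rintro rfl
  obtain ⟨z, hz, hadj⟩ := h.lam_core p hp x hx
  exact (h.block_anti q hq p hp _ hy z hz).2 hadj

/-- The token consisting of the attachments of a gadget. -/
def attachToken (K : ℕ → Finset V) (lam : ℕ → V → V) (E : ℕ → Finset V) (p : ℕ) : Token V :=
  ⟨E p, lam p, fun x => {lam p x}, {p}, 0, K p⟩

variable [Fintype V]

theorem IsPool.gameState (h : G.IsPool N K lam E κ σ) (hG : G.CoherentAt e) (heκ : e ≤ κ)
    (hN : 0 < N) : GameState G K lam E N A κ (Finset.range N) ∅ (attachToken K lam E)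
      ((Finset.range N).biUnion E) 1 σ := by
  have hmem : ∀ {p}, p ∈ Finset.range N ∪ ∅ → p < N := fun hp => by simpa using hp
  have hC : ∀ {v}, v ∈ (Finset.range N).biUnion E → ∃ p < N, v ∈ E p := fun hv => by
    simpa using hv
  refine ⟨Finset.disjoint_empty_right _, ?_, fun v => hC, ?_, ?_, ?_, ?_, ?_, ?_, ?_, ?_⟩
  · intro p hp i hi
    refine ⟨?_, by simp [attachToken], ?_⟩
    · simpa [attachToken] using Head.attach (hmem hp) hi
    · rintro a (ha | ⟨q, hq, ha⟩)
      · left; simpa [attachToken] using ha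
      · right
        have : q = p := by simpa [attachToken] using hq
        subst this
        exact ha
  · intro p hp q hq hpq
    have hp := hmem hp
    have hq := hmem hq
    refine ⟨by simpa [attachToken] using hpq, h.core_anti p hp q hq hpq, ?_, ?_, ?_⟩
    · intro a ha j hj
      have := h.lam_anti q hq p hp hpq.symm j hj a ha
      exact ⟨this.1.symm, fun h => this.2 h.symm⟩
    · exact fun i hi j hj => h.lam_ne_lam hp hq hpq hi hj
    · intro i hi
      refine le_trans (Nat.cast_le.2 (Finset.card_le_card fun x hx => ?_))
        (h.lam_lam q hq p hp hpq.symm i hi)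
      rw [Finset.mem_filter] at hx ⊢
      exact ⟨hx.1, hx.2.symm⟩
  · intro p hp
    have hp := hmem hp
    refine ⟨Finset.disjoint_empty_right _, fun a _ b hb => absurd hb (Set.notMem_empty b), ?_, ?_, ?_⟩
    · intro a ha j hj
      obtain ⟨q, hq, hjq⟩ := hC hj
      have := h.block_anti q hq p hp j hjq a ha
      exact ⟨this.1.symm, fun h => this.2 h.symm⟩
    · intro i hi j hj
      obtain ⟨q, hq, hjq⟩ := hC hj
      exact h.lam_ne_block hp hq hi hjq
    · exact fun i _ => ((hG.card_filter_adj_lt _ _).trans_le heκ).le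
  · intro p hp
    have hp := hmem hp
    refine ⟨Finset.disjoint_empty_left _, fun a ha => absurd ha (Set.notMem_empty a),
      fun a ha => absurd ha (Set.notMem_empty a), ?_, ?_⟩
    · intro j hj i hi
      obtain ⟨q, hq, hjq⟩ := hC hj
      exact (h.lam_ne_block hp hq hi hjq).symm
    · intro j hj
      obtain ⟨q, hq, hjq⟩ := hC hj
      refine le_trans (Nat.cast_le.2 (Finset.card_le_card fun x hx => ?_))
        (h.lam_block p hp q hq j hjq)
      rw [Finset.mem_filter] at hx ⊢
      exact ⟨hx.1, hx.2.symm⟩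
  · exact fun p _ => Finset.singleton_nonempty p
  · exact fun p hp => h.block_card p (hmem hp)
  · refine (h.block_card 0 hN).trans (Nat.cast_le.2 (Finset.card_le_card ?_))
    exact Finset.subset_biUnion_of_mem E (Finset.mem_range.2 hN)
  · intro p hp i hi
    exact ⟨Finset.mem_biUnion.2 ⟨p, hp, hi⟩, (h.lam_adj p (Finset.mem_range.1 hp) i hi).symm⟩
  · exact fun p hp => absurd hp (Finset.notMem_empty p)

/-- The initial `N` tokens have level `0`, weight `β` and `m = 0`, so the potential is `N * β`; each
is worth `T + 1` in the move count. Footprints start with one vertex and double at most `N * (T +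
1)` times, and `2 ^ T` more times in the rooted game. -/
theorem IsPool.hasHead (hG : G.CoherentAt e) (hA : 0 < A) {T β : ℕ} (hT : 1 ≤ T)
    (hβ : β = 2 ^ (T + 1)) {s₀ : ℝ} (hs₀ : 0 < s₀) (heκ : e ≤ κ) (hκs : κ ≤ s₀)
    (hN : 2 ^ T * (2 ^ T * β ^ (2 * T + 1) + β ^ (2 * T)) < N * β)
    (h : G.IsPool N K lam E κ (8 ^ (N * (T + 1)) * (4 ^ (2 ^ T) * s₀))) :
    HasHead G K lam E N A T (2 ^ (N * (T + 1)) * 2 ^ (2 ^ T)) := by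
  have hN0 : 0 < N := by
    rcases Nat.eq_zero_or_pos N with rfl | h
    · simp at hN
    · exact h
  have := GameState.hasHead hG hA hT hβ hs₀ heκ hκs (N * (T + 1)) (Finset.range N) ∅
    (attachToken K lam E) ((Finset.range N).biUnion E) 1 0 le_rfl (h.gameState hG heκ hN0)
    (by simp +contextual)
    (fun _ _ => Nat.zero_le _) (Nat.zero_le _) (by
      rw [Finset.union_empty, Finset.sum_congr rfl (g := fun _ => β)]
      · simpa using hN
      · intro p hp
        simp [tokenWeight, attachToken, Finset.mem_range.1 hp])
  simpa using this

end SimpleGraph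

/-! ### Chordless paths through connected sets, and assembling a filleting. -/

namespace SimpleGraph

open scoped Classical

namespace Walk

variable {V : Type*} {G : SimpleGraph V} {u v : V}

/-- A shortest walk has no chords. -/
theorem isChordless_of_length_eq_dist (p : G.Walk u v) (hp : p.length = G.dist u v) :
    p.IsChordless := by
  have key : ∀ i j, i < j → j ≤ p.length → G.Adj (p.getVert i) (p.getVert j) → j = i + 1 := by
    intro i j hij hj hadj
    have h := dist_le ((p.take i).append (cons hadj (p.drop j)))
    rw [length_append, length_cons, take_length, drop_length] at h
    omega
  rw [isChordless_iff_forall_mem_edges]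
  intro x y hx hy hadj
  obtain ⟨i, rfl, hi⟩ := mem_support_iff_exists_getVert.1 hx
  obtain ⟨j, rfl, hj⟩ := mem_support_iff_exists_getVert.1 hy
  rw [mk_mem_edges_iff_exists]
  rcases lt_trichotomy i j with hij | rfl | hij
  · obtain rfl := key i j hij hj hadj
    exact ⟨i, by omega, rfl⟩
  · exact absurd hadj (G.loopless.irrefl _)
  · obtain rfl := key j i hij hi hadj.symm
    exact ⟨j, by omega, Sym2.eq_swap⟩

theorem IsChordless.reverse {p : G.Walk u v} (h : p.IsChordless) : p.reverse.IsChordless := by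
  rw [isChordless_iff_forall_mem_edges] at h ⊢
  simpa using h

theorem length_induce (s : Set V) (p : G.Walk u v) (hp : ∀ x ∈ p.support, x ∈ s) :
    (p.induce s hp).length = p.length := by
  induction p with
  | nil => rfl
  | cons h q ih => simp [ih]

theorem induce_eq_reverse (s : Set V) {p : G.Walk u v} {q : G.Walk v u} (h : p = q.reverse)
    (hp : ∀ x ∈ p.support, x ∈ s) (hq : ∀ x ∈ q.support, x ∈ s) :
    p.induce s hp = (q.induce s hq).reverse := by
  subst h
  apply ext_support
  rw [support_reverse, support_induce, support_induce]
  apply List.map_injective_iff.2 Subtype.val_injective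
  simp

theorem mem_edges_induce (s : Set V) (p : G.Walk u v) (hp : ∀ x ∈ p.support, x ∈ s) {x y : s}
    (h : s((x : V), (y : V)) ∈ p.edges) : s(x, y) ∈ (p.induce s hp).edges := by
  induction p with
  | nil => simp at h
  | cons hadj q ih =>
    rw [edges_cons, List.mem_cons] at h
    rw [induce_cons, edges_cons, List.mem_cons]
    rcases h with h | h
    · left
      rw [Sym2.eq_iff] at h ⊢
      simpa [Subtype.ext_iff] using h
    · exact Or.inr (ih _ h)

end Walk

/-- Two vertices with neighbours in a connected set are joined by a chordless path through it. -/
theorem ConnSet.exists_chordless {V : Type u} {G : SimpleGraph V} {C : Set V} (hC : G.ConnSet C)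
    {a b : V} (ha : ∃ z ∈ C, G.Adj a z) (hb : ∃ z ∈ C, G.Adj b z) :
    ∃ q : G.Walk a b, q.IsPath ∧ q.IsChordless ∧ ∀ x ∈ q.support, x = a ∨ x = b ∨ x ∈ C := by
  obtain ⟨z, hz, haz⟩ := ha
  obtain ⟨z', hz', hbz⟩ := hb
  have h1 : G.ConnSet (insert a C) := hC.insert_of_adj hz haz.symm
  have h2 : G.ConnSet (insert b (insert a C)) :=
    h1.insert_of_adj (Set.mem_insert_of_mem _ hz') hbz.symm
  obtain ⟨p, hp⟩ := h2.exists_walk_length_eq_dist ⟨a, by simp⟩ ⟨b, by simp⟩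
  let f : G.induce (insert b (insert a C)) ↪g G := Embedding.induce _
  have h3 : (p.map f.toHom).IsChordless := by
    have h4 := p.isChordless_of_length_eq_dist hp
    rw [Walk.isChordless_iff_forall_mem_edges] at h4 ⊢
    intro x y hx hy hxy
    rw [Walk.support_map, List.mem_map] at hx hy
    obtain ⟨x, hx, rfl⟩ := hx
    obtain ⟨y, hy, rfl⟩ := hy
    rw [Walk.edges_map, List.mem_map]
    exact ⟨s(x, y), h4 hx hy (f.map_adj_iff.1 hxy), rfl⟩
  have h4 : ∀ x ∈ (p.map f.toHom).support, x = a ∨ x = b ∨ x ∈ C := by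
    intro x hx
    rw [Walk.support_map, List.mem_map] at hx
    obtain ⟨⟨x, hx'⟩, -, rfl⟩ := hx
    have : x = b ∨ x = a ∨ x ∈ C := by simpa using hx'
    change x = a ∨ x = b ∨ x ∈ C
    tauto
  exact ⟨p.map f.toHom, (p.isPath_of_length_eq_dist hp).map f.injective, h3, h4⟩

variable {W : Type v} {V : Type u} {H : SimpleGraph W} {G : SimpleGraph V}

/-- Walks along the edges can be chosen compatibly with reversal. -/
theorem exists_symm_walks (f : W → V) (R : ∀ {a b : V}, Sym2 W → G.Walk a b → Prop)
    (hR : ∀ {a b : V} (e : Sym2 W) (q : G.Walk a b), R e q → R e q.reverse)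
    (h : ∀ d : H.Dart, ∃ q : G.Walk (f d.fst) (f d.snd), R d.edge q) :
    ∃ Q : ∀ d : H.Dart, G.Walk (f d.fst) (f d.snd),
      (∀ d, R d.edge (Q d)) ∧ ∀ d, Q d.symm = (Q d).reverse := by
  have h' : ∀ a b (hab : H.Adj a b), ∃ q : G.Walk (f a) (f b), R s(a, b) q :=
    fun a b hab => h ⟨(a, b), hab⟩
  choose q hq using h'
  -- The order orients every edge; the walk is chosen for that orientation and reversed for the
  -- other.
  let r : W → W → Prop := WellOrderingRel
  have hirr : ∀ {a b}, r a b → ¬ r b a := fun h h' => asymm h h'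
  have htri : ∀ {a b}, a ≠ b → ¬ r a b → r b a := fun {a b} hne h => by
    rcases trichotomous_of r a b with h' | h' | h'
    · exact absurd h' h
    · exact absurd h' hne
    · exact h'
  let Q : ∀ a b, H.Adj a b → G.Walk (f a) (f b) := fun a b hab =>
    if r a b then q a b hab else (q b a hab.symm).reverse
  have hQ : ∀ a b hab, R s(a, b) (Q a b hab) := by
    intro a b hab
    by_cases hd : r a b
    · have : Q a b hab = q a b hab := if_pos hd
      rw [this]
      exact hq a b hab
    · have : Q a b hab = (q b a hab.symm).reverse := if_neg hd
      rw [this]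
      have := hR _ _ (hq b a hab.symm)
      rwa [Sym2.eq_swap] at this
  have hQs : ∀ a b hab, Q b a hab.symm = (Q a b hab).reverse := by
    intro a b hab
    by_cases hd : r a b
    · have h1 : Q a b hab = q a b hab := if_pos hd
      have h2 : Q b a hab.symm = (q a b hab).reverse := if_neg (hirr hd)
      rw [h1, h2]
    · have h1 : Q a b hab = (q b a hab.symm).reverse := if_neg hd
      have h2 : Q b a hab.symm = q b a hab.symm := if_pos (htri hab.ne hd)
      rw [h1, h2, Walk.reverse_reverse]
  exact ⟨fun d => Q d.fst d.snd d.adj, fun d => hQ d.fst d.snd d.adj,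
    fun d => hQs d.fst d.snd d.adj⟩

/-- Distinct branch vertices that are adjacent exactly along `P`, together with pairwise
anticomplete connected sets, one for each further edge, whose attachments are exactly the ends of
that edge, contain a filleting. -/
theorem exists_isFilleting {a b : W} (P : H.Walk a b) (f : W → V) (hf : f.Injective)
    (C : Sym2 W → Set V)
    (hadj : ∀ w w', G.Adj (f w) (f w') ↔ s(w, w') ∈ P.edges)
    (hconn : ∀ e ∈ H.edgeSet, e ∉ P.edges → G.ConnSet (C e))
    (hnotMem : ∀ e ∈ H.edgeSet, e ∉ P.edges → ∀ w, f w ∉ C e)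
    (hattach : ∀ e ∈ H.edgeSet, e ∉ P.edges → ∀ w, (∃ z ∈ C e, G.Adj (f w) z) ↔ w ∈ e)
    (hanti : ∀ e ∈ H.edgeSet, e ∉ P.edges → ∀ e' ∈ H.edgeSet, e' ∉ P.edges → e ≠ e' →
      ∀ x ∈ C e, ∀ y ∈ C e', x ≠ y ∧ ¬ G.Adj x y) :
    ∃ s : Set V, H.IsFilleting P (G.induce s) := by
  let R : ∀ {a b : V}, Sym2 W → G.Walk a b → Prop := fun {a b} e q =>
    q.IsPath ∧ q.IsChordless ∧ (∀ x ∈ q.support, x = a ∨ x = b ∨ (e ∉ P.edges ∧ x ∈ C e)) ∧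
      (e ∈ P.edges → q.length = 1) ∧ (e ∉ P.edges → 2 ≤ q.length)
  obtain ⟨Q, hQ, hQs⟩ := exists_symm_walks (H := H) (G := G) f R
    (by
      rintro a b e q ⟨h1, h2, h3, h4, h5⟩
      refine ⟨h1.reverse, h2.reverse, fun x hx => ?_, by simpa using h4, by simpa using h5⟩
      rw [Walk.support_reverse, List.mem_reverse] at hx
      rcases h3 x hx with h | h | h
      · exact Or.inr (Or.inl h)
      · exact Or.inl h
      · exact Or.inr (Or.inr h))
    (by
      intro d
      by_cases hd : d.edge ∈ P.edges
      · have h : G.Adj (f d.fst) (f d.snd) := (hadj _ _).2 hd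
        refine ⟨h.toWalk, h.isPath_toWalk, h.isChordless_toWalk, fun x hx => ?_, fun _ => rfl,
          fun h => absurd hd h⟩
        rw [h.support_toWalk] at hx
        simp at hx
        tauto
      · have he : d.edge ∈ H.edgeSet := d.edge_mem
        obtain ⟨q, h1, h2, h3⟩ := (hconn _ he hd).exists_chordless
          ((hattach _ he hd d.fst).2 (Sym2.mem_mk_left _ _))
          ((hattach _ he hd d.snd).2 (Sym2.mem_mk_right _ _))
        refine ⟨q, h1, h2, fun x hx => ?_, fun h => absurd h hd, fun _ => ?_⟩
        · have := h3 x hx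
          tauto
        · by_contra hlt
          push Not at hlt
          -- Length `0` would identify two branch vertices; length `1` would be an edge between
          -- them, which exists only along `P`.
          interval_cases hl : q.length
          · exact d.adj.ne (hf (Walk.eq_of_length_eq_zero hl))
          · exact hd ((hadj _ _).1 (Walk.adj_of_length_eq_one hl)))
  have hend : ∀ (d : H.Dart) (w : W), f w ∈ (Q d).support → w = d.fst ∨ w = d.snd := by
    intro d w hw
    rcases (hQ d).2.2.1 _ hw with h | h | ⟨h, h'⟩
    · exact Or.inl (hf h)
    · exact Or.inr (hf h)
    · exact absurd h' (hnotMem _ d.edge_mem h w)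
  have hsame : ∀ d d' : H.Dart, d.edge = d'.edge → ∀ x, x ∈ (Q d).support → x ∈ (Q d').support := by
    intro d d' hdd x hx
    rcases dart_edge_eq_iff d d' |>.1 hdd with rfl | rfl
    · exact hx
    · have h1 : (Q d'.symm).support = (Q d').reverse.support :=
        congrArg (fun q => q.support) (hQs d')
      rw [h1, Walk.support_reverse, List.mem_reverse] at hx
      exact hx
  let S : Set V := {x | x ∈ Set.range f ∨ ∃ d : H.Dart, x ∈ (Q d).support}
  have hS : ∀ d : H.Dart, ∀ x ∈ (Q d).support, x ∈ S := fun d x hx => Or.inr ⟨d, hx⟩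
  -- classification of the vertices of `S`
  have hcl : ∀ x ∈ S, (∃ w, x = f w) ∨
      ∃ d : H.Dart, d.edge ∉ P.edges ∧ x ∈ C d.edge ∧ x ∈ (Q d).support := by
    rintro x (⟨w, rfl⟩ | ⟨d, hd⟩)
    · exact Or.inl ⟨w, rfl⟩
    · rcases (hQ d).2.2.1 _ hd with h | h | ⟨h, h'⟩
      · exact Or.inl ⟨_, h⟩
      · exact Or.inl ⟨_, h⟩
      · exact Or.inr ⟨d, h, h', hd⟩
  have hhalf : ∀ w, ∀ d : H.Dart, d.edge ∉ P.edges → ∀ y ∈ C d.edge, G.Adj (f w) y →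
      f w ∈ (Q d).support := by
    intro w d hd y hy hwy
    have := (hattach _ d.edge_mem hd w).1 ⟨y, hy, hwy⟩
    rcases Sym2.mem_iff.1 this with rfl | rfl
    · exact Walk.start_mem_support _
    · exact Walk.end_mem_support _
  have hedge : ∀ x ∈ S, ∀ y ∈ S, G.Adj x y → ∃ d : H.Dart, x ∈ (Q d).support ∧ y ∈ (Q d).support := by
    intro x hx y hy hxy
    rcases hcl x hx with ⟨w, rfl⟩ | ⟨d, hd, hxC, hxd⟩ <;>
      rcases hcl y hy with ⟨w', rfl⟩ | ⟨d', hd', hyC, hyd⟩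
    · have h := (hadj w w').1 hxy
      have h' : H.Adj w w' := P.edges_subset_edgeSet h
      exact ⟨⟨(w, w'), h'⟩, Walk.start_mem_support _, Walk.end_mem_support _⟩
    · exact ⟨d', hhalf w d' hd' y hyC hxy, hyd⟩
    · exact ⟨d, hxd, hhalf w' d hd x hxC hxy.symm⟩
    · by_cases hdd : d.edge = d'.edge
      · exact ⟨d', hsame d d' hdd x hxd, hyd⟩
      · exact absurd hxy (hanti _ d.edge_mem hd _ d'.edge_mem hd' hdd x hxC y hyC).2
  have hmem : ∀ (d : H.Dart) (x : S), x ∈ ((Q d).induce S (hS d)).support ↔ (x : V) ∈ (Q d).support := by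
    intro d x
    rw [Walk.support_induce]
    simp [List.mem_attachWith]
  refine ⟨S, ⟨fun w => ⟨f w, Or.inl ⟨w, rfl⟩⟩, fun w w' h => hf (congrArg Subtype.val h),
    fun d => (Q d).induce S (hS d), fun d => ?_, fun d => ?_, fun d w hw => ?_, ?_, ?_, ?_⟩, ?_⟩
  · apply Walk.IsPath.of_map (f := (Embedding.induce S : G.induce S ↪g G).toHom)
    rw [Walk.map_induce]
    exact (hQ d).1
  · exact Walk.induce_eq_reverse S (hQs d) _ _
  · exact hend d w ((hmem d _).1 hw)
  · intro d d' hdd x hx hx'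
    rw [hmem] at hx hx'
    rcases (hQ d).2.2.1 _ hx with h | h | ⟨h, hC⟩
    · exact ⟨d.fst, Subtype.ext h.symm⟩
    · exact ⟨d.snd, Subtype.ext h.symm⟩
    rcases (hQ d').2.2.1 _ hx' with h' | h' | ⟨h', hC'⟩
    · exact ⟨d'.fst, Subtype.ext h'.symm⟩
    · exact ⟨d'.snd, Subtype.ext h'.symm⟩
    exact absurd rfl (hanti _ d.edge_mem h _ d'.edge_mem h' hdd _ hC _ hC').1
  · rintro ⟨x, hx⟩
    rcases hx with ⟨w, rfl⟩ | ⟨d, hd⟩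
    · exact Or.inl ⟨w, rfl⟩
    · exact Or.inr ⟨d, (hmem d _).2 hd⟩
  · intro e
    induction e with | _ x y
    intro he
    have hxy : G.Adj x y := he
    obtain ⟨d, hx, hy⟩ := hedge x x.2 y y.2 hxy
    exact ⟨d, Walk.mem_edges_induce S _ _ ((hQ d).2.1.mem_edges hx hy hxy)⟩
  · intro d
    change (_ → ((Q d).induce S (hS d)).length = 1) ∧ (_ → 2 ≤ ((Q d).induce S (hS d)).length)
    rw [Walk.length_induce]
    exact (hQ d).2.2.2

end SimpleGraph

/-! ### From rakes to fillets. -/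

namespace SimpleGraph

open scoped Classical

/-- The vertices of a finite graph can be placed on a line so that exactly the pairs joined by an
edge of a given path become consecutive. -/
theorem Walk.IsPath.exists_positions {W : Type v} [Finite W] {H : SimpleGraph W} {a b : W}
    {P : H.Walk a b} (hP : P.IsPath) : ∃ (k : ℕ) (pos : W → ℕ), pos.Injective ∧
      (∀ w, pos w < k) ∧
      ∀ w w', s(w, w') ∈ P.edges ↔ pos w = pos w' + 1 ∨ pos w' = pos w + 1 := by
  obtain ⟨n, ⟨idx⟩⟩ := Finite.exists_equiv_fin W
  have hex : ∀ w, w ∈ P.support → ∃ t, P.getVert t = w ∧ t ≤ P.length := fun w hw =>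
    Walk.mem_support_iff_exists_getVert.1 hw
  choose! t ht using hex
  have htu : ∀ i, i ≤ P.length → t (P.getVert i) = i := fun i hi => by
    have h := ht _ (P.getVert_mem_support i)
    exact hP.getVert_injOn h.2 hi h.1
  -- The path occupies `0, …, P.length`. One position is skipped after it, and the remaining
  -- vertices are two apart, so they are consecutive to nothing.
  let pos : W → ℕ := fun w => if w ∈ P.support then t w else P.length + 2 + 2 * (idx w : ℕ)
  have h1 : ∀ w ∈ P.support, pos w = t w := fun w hw => if_pos hw
  have h2 : ∀ w, w ∉ P.support → pos w = P.length + 2 + 2 * (idx w : ℕ) := fun w hw => if_neg hw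
  have hidx : ∀ w w', (idx w : ℕ) = idx w' → w = w' := fun w w' h => idx.injective (Fin.ext h)
  have hstep : ∀ w w', pos w' = pos w + 1 → s(w, w') ∈ P.edges := by
    intro w w' h
    by_cases hw : w ∈ P.support <;> by_cases hw' : w' ∈ P.support
    · rw [h1 w hw, h1 w' hw'] at h
      have e1 := ht w hw
      have e2 := ht w' hw'
      rw [Walk.mk_mem_edges_iff_exists]
      exact ⟨t w, by omega, by rw [← h, e1.1, e2.1]⟩
    · rw [h1 w hw, h2 w' hw'] at h
      have e1 := ht w hw
      omega
    · rw [h2 w hw, h1 w' hw'] at h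
      have e1 := ht w' hw'
      omega
    · rw [h2 w hw, h2 w' hw'] at h
      omega
  refine ⟨P.length + 2 + 2 * n, pos, fun w w' h => ?_, fun w => ?_, fun w w' => ⟨fun h => ?_, ?_⟩⟩
  · by_cases hw : w ∈ P.support <;> by_cases hw' : w' ∈ P.support
    · rw [h1 w hw, h1 w' hw'] at h
      rw [← (ht w hw).1, ← (ht w' hw').1, h]
    · rw [h1 w hw, h2 w' hw'] at h
      have e1 := ht w hw
      omega
    · rw [h2 w hw, h1 w' hw'] at h
      have e1 := ht w' hw'
      omega
    · rw [h2 w hw, h2 w' hw'] at h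
      exact hidx w w' (by omega)
  · by_cases hw : w ∈ P.support
    · rw [h1 w hw]
      have e1 := ht w hw
      omega
    · rw [h2 w hw]
      have := (idx w).2
      omega
  · obtain ⟨i, hi, h⟩ := (Walk.mk_mem_edges_iff_exists P).1 h
    have e1 : pos (P.getVert i) = i := by
      rw [h1 _ (P.getVert_mem_support i), htu i hi.le]
    have e2 : pos (P.getVert (i + 1)) = i + 1 := by
      rw [h1 _ (P.getVert_mem_support _), htu _ hi]
    rcases Sym2.eq_iff.1 h with ⟨rfl, rfl⟩ | ⟨rfl, rfl⟩ <;> omega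
  · rintro (h | h)
    · rw [Sym2.eq_swap]; exact hstep _ _ h
    · exact hstep _ _ h

/-- A rake: an induced path `y 0, …, y (k - 1)` and pairwise anticomplete connected sets, one for
each `l < m`, where the only vertices of the path with neighbours in the `l`-th set are
`y (i l)` and `y (j l)`. -/
def HasRake {V : Type u} (G : SimpleGraph V) (k m : ℕ) (i j : ℕ → ℕ) : Prop :=
  ∃ (y : ℕ → V) (C : ℕ → Set V),
    (∀ a < k, ∀ b < k, y a = y b → a = b) ∧
    (∀ a < k, ∀ b < k, G.Adj (y a) (y b) ↔ a = b + 1 ∨ b = a + 1) ∧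
    (∀ l < m, G.ConnSet (C l)) ∧
    (∀ l < m, ∀ a < k, y a ∉ C l ∧ ((∃ z ∈ C l, G.Adj (y a) z) ↔ a = i l ∨ a = j l)) ∧
    (∀ l < m, ∀ l' < m, l ≠ l' → ∀ x ∈ C l, ∀ z ∈ C l', x ≠ z ∧ ¬ G.Adj x z)

/-- Fillets of a given graph can be found in suitable rakes. -/
theorem exists_isFilleting_of_hasRake {W : Type v} [Finite W] (H : SimpleGraph W) {a b : W}
    (P : H.Walk a b) (hP : P.IsPath) : ∃ (k m : ℕ) (i j : ℕ → ℕ),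
      (∀ l < m, i l < k ∧ j l < k ∧ i l ≠ j l) ∧
      ∀ (V : Type u) (G : SimpleGraph V), G.HasRake k m i j →
        ∃ s : Set V, H.IsFilleting P (G.induce s) := by
  obtain ⟨k, pos, hpi, hpk, hpe⟩ := hP.exists_positions
  let T : Set (Sym2 W) := {e | e ∈ H.edgeSet ∧ e ∉ P.edges}
  obtain ⟨m, ⟨φ⟩⟩ := Finite.exists_equiv_fin T
  let fst : ℕ → ℕ := fun l => if h : l < m then pos (φ.symm ⟨l, h⟩).1.out.1 else 0
  let snd : ℕ → ℕ := fun l => if h : l < m then pos (φ.symm ⟨l, h⟩).1.out.2 else 0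
  refine ⟨k, m, fst, snd, fun l hl => ?_, ?_⟩
  · simp only [fst, snd, dif_pos hl]
    refine ⟨hpk _, hpk _, fun h => ?_⟩
    have h1 := (φ.symm ⟨l, hl⟩).2.1
    have h2 : (φ.symm ⟨l, hl⟩).1 = s((φ.symm ⟨l, hl⟩).1.out.1, (φ.symm ⟨l, hl⟩).1.out.2) :=
      (Quot.out_eq _).symm
    rw [h2] at h1
    exact H.ne_of_adj h1 (hpi h)
  · rintro V G ⟨y, C, hy, hadj, hconn, hhead, hanti⟩
    let D : Sym2 W → Set V := fun e => if h : e ∈ T then C (φ ⟨e, h⟩) else ∅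
    have hD : ∀ e (h : e ∈ T), D e = C (φ ⟨e, h⟩) := fun e h => dif_pos h
    have hfst : ∀ e (h : e ∈ T), fst (φ ⟨e, h⟩) = pos e.out.1 := fun e h => by
      simp only [fst, dif_pos (φ ⟨e, h⟩).2, Fin.eta, Equiv.symm_apply_apply]
    have hsnd : ∀ e (h : e ∈ T), snd (φ ⟨e, h⟩) = pos e.out.2 := fun e h => by
      simp only [snd, dif_pos (φ ⟨e, h⟩).2, Fin.eta, Equiv.symm_apply_apply]
    refine exists_isFilleting P (fun w => y (pos w))
      (fun w w' h => hpi (hy _ (hpk w) _ (hpk w') h)) D ?_ ?_ ?_ ?_ ?_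
    · intro w w'
      rw [hpe]
      exact hadj _ (hpk w) _ (hpk w')
    · intro e he heP
      rw [hD e ⟨he, heP⟩]
      exact hconn _ (φ _).2
    · intro e he heP w
      rw [hD e ⟨he, heP⟩]
      exact (hhead _ (φ _).2 _ (hpk w)).1
    · intro e he heP w
      rw [hD e ⟨he, heP⟩, (hhead _ (φ _).2 _ (hpk w)).2, hfst, hsnd, hpi.eq_iff, hpi.eq_iff]
      conv_rhs => rw [show e = s(e.out.1, e.out.2) from (Quot.out_eq _).symm]
      exact Sym2.mem_iff.symm
    · intro e he heP e' he' heP' hne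
      rw [hD e ⟨he, heP⟩, hD e' ⟨he', heP'⟩]
      refine hanti _ (φ _).2 _ (φ _).2 fun h => hne ?_
      exact congrArg Subtype.val (φ.injective (Fin.ext h))

end SimpleGraph

/-! ### Unfolding a head into a comb. -/

namespace SimpleGraph

open scoped Classical

variable {V : Type u} {G : SimpleGraph V} {K : ℕ → Finset V} {lam : ℕ → V → V}
  {E : ℕ → Finset V} {N A R n : ℕ} {κ σ : ℝ} {v : V} {F F' : Finset V} {J J' : Finset ℕ}

theorem body_mono {K : ℕ → Finset V} (hF : F ⊆ F') (hJ : J ⊆ J') : body K F J ⊆ body K F' J' := by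
  rintro a (ha | ⟨p, hp, ha⟩)
  · exact Or.inl (hF ha)
  · exact Or.inr ⟨p, hJ hp, ha⟩

theorem body_union (K : ℕ → Finset V) (F F' : Finset V) (J J' : Finset ℕ) :
    body K (F ∪ F') (J ∪ J') = body K F J ∪ body K F' J' := by
  ext a
  simp only [body, Set.mem_ofPred_eq, Set.mem_union, Finset.mem_union]
  constructor
  · rintro ((h | h) | ⟨p, h | h, ha⟩)
    exacts [Or.inl (Or.inl h), Or.inr (Or.inl h), Or.inl (Or.inr ⟨p, h, ha⟩),
      Or.inr (Or.inr ⟨p, h, ha⟩)]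
  · rintro ((h | ⟨p, h, ha⟩) | (h | ⟨p, h, ha⟩))
    exacts [Or.inl (Or.inl h), Or.inr ⟨p, Or.inl h, ha⟩, Or.inl (Or.inr h),
      Or.inr ⟨p, Or.inr h, ha⟩]

theorem Head.root_mem (h : Head G K lam E N A R n v F J) : v ∈ F := by
  induction h with
  | block _ _ => exact Finset.mem_singleton_self _
  | attach _ _ => exact Finset.mem_singleton_self _
  | leg _ _ _ _ ih _ => exact Finset.mem_union_left _ ih
  | spine _ _ _ _ ih _ => exact Finset.mem_union_left _ ih

theorem Head.lt_of_mem (h : Head G K lam E N A R n v F J) : ∀ p ∈ J, p < N := by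
  induction h with
  | block _ _ => exact fun p hp => absurd hp (Finset.notMem_empty p)
  | attach hp _ =>
    intro q hq
    rw [Finset.mem_singleton] at hq
    exact hq ▸ hp
  | leg _ _ _ _ ih ih' => exact fun p hp => (Finset.mem_union.1 hp).elim (ih p) (ih' p)
  | spine _ _ _ _ ih ih' => exact fun p hp => (Finset.mem_union.1 hp).elim (ih p) (ih' p)

/-- A vertex is of type `J` if it lies in a block, or is an attachment of a core in `J`. -/
def HasType (lam : ℕ → V → V) (E : ℕ → Finset V) (N : ℕ) (J : Finset ℕ) (u : V) : Prop :=
  (∃ p < N, u ∈ E p) ∨ ∃ p ∈ J, ∃ x ∈ E p, u = lam p x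

theorem HasType.mono {u : V} (h : HasType lam E N J u) (hJ : J ⊆ J') : HasType lam E N J' u :=
  h.imp_right fun ⟨p, hp, h⟩ => ⟨p, hJ hp, h⟩

theorem Head.hasType (h : Head G K lam E N A R n v F J) : ∀ u ∈ F, HasType lam E N J u := by
  induction h with
  | block hp hv =>
    intro u hu
    rw [Finset.mem_singleton] at hu
    exact Or.inl ⟨_, hp, hu ▸ hv⟩
  | attach hp hx =>
    intro u hu
    rw [Finset.mem_singleton] at hu
    exact Or.inr ⟨_, Finset.mem_singleton_self _, _, hx, hu⟩
  | leg _ _ _ _ ih ih' =>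
    intro u hu
    rcases Finset.mem_union.1 hu with hu | hu
    · exact (ih u hu).mono Finset.subset_union_left
    · exact (ih' u hu).mono Finset.subset_union_right
  | spine _ _ _ _ ih ih' =>
    intro u hu
    rcases Finset.mem_union.1 hu with hu | hu
    · exact (ih u hu).mono Finset.subset_union_left
    · exact (ih' u hu).mono Finset.subset_union_right

theorem Head.connSet (hP : G.IsPool N K lam E κ σ) (h : Head G K lam E N A R n v F J) :
    G.ConnSet (body K F J) := by
  have hjoin : ∀ {v w : V} {F F' : Finset V} {J J' : Finset ℕ}, v ∈ F → w ∈ F' → G.Adj v w →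
      G.ConnSet (body K F J) → G.ConnSet (body K F' J') →
      G.ConnSet (body K (F ∪ F') (J ∪ J')) := by
    intro v w F F' J J' hv hw hadj h1 h2
    rw [body_union]
    exact h1.union_of_adj h2 (Or.inl hv) (Or.inl hw) hadj
  induction h with
  | @block p v hp hv =>
    have : body K {v} ∅ = {v} := by ext a; simp [body]
    rw [this]
    exact G.connSet_singleton v
  | @attach p x hp hx =>
    have : body K {lam p x} {p} = insert (lam p x) (K p : Set V) := by ext a; simp [body]
    rw [this]
    obtain ⟨z, hz, hadj⟩ := hP.lam_core p hp x hx
    exact (hP.conn p hp).insert_of_adj hz hadj.symm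
  | leg h h' _ hj ih ih' => exact hjoin h.root_mem h'.root_mem hj.1 ih ih'
  | spine h h' _ hj ih ih' => exact hjoin h.root_mem h'.root_mem hj.1 ih ih'

/-- The legs of a comb: each of `R + 1` vertices has `A` legs, except that the first one has
`n`. -/
def IsLeg (A R n i a : ℕ) : Prop := i ≤ R ∧ a < if i = 0 then n else A

/-- A comb: an induced path `y 0, …, y R` with pairwise anticomplete connected legs. -/
structure Comb (G : SimpleGraph V) (K : ℕ → Finset V) (lam : ℕ → V → V) (E : ℕ → Finset V)
    (N A R n : ℕ) (y : ℕ → V) (LF : ℕ → ℕ → Finset V) (LJ : ℕ → ℕ → Finset ℕ)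
    (F : Finset V) (J : Finset ℕ) : Prop where
  head_mem : ∀ i ≤ R, y i ∈ F
  head_adj : ∀ i j, i < j → j ≤ R → y i ≠ y j ∧ (G.Adj (y i) (y j) ↔ j = i + 1)
  head_type : ∀ i ≤ R, (∃ p < N, y i ∈ E p) ∨
    ∃ p ∈ J, (∃ x ∈ E p, y i = lam p x) ∧ ∀ j b, IsLeg A R n j b → p ∉ LJ j b
  leg_subset : ∀ i a, IsLeg A R n i a → LF i a ⊆ F ∧ LJ i a ⊆ J
  leg_core : ∀ i a, IsLeg A R n i a → (LJ i a).Nonempty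
  leg_conn : ∀ i a, IsLeg A R n i a → G.ConnSet (body K (LF i a) (LJ i a))
  leg_type : ∀ i a, IsLeg A R n i a → ∀ u ∈ LF i a, HasType lam E N (LJ i a) u
  leg_adj : ∀ i a, IsLeg A R n i a → ∃ z ∈ body K (LF i a) (LJ i a), G.Adj (y i) z
  head_leg : ∀ i ≤ R, ∀ j b, IsLeg A R n j b → ∀ z ∈ body K (LF j b) (LJ j b),
    y i ≠ z ∧ (G.Adj (y i) z → i = j)
  leg_disj : ∀ i a j b, IsLeg A R n i a → IsLeg A R n j b → (i, a) ≠ (j, b) →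
    Disjoint (LJ i a) (LJ j b)
  leg_leg : ∀ i a j b, IsLeg A R n i a → IsLeg A R n j b → (i, a) ≠ (j, b) →
    ∀ z ∈ body K (LF i a) (LJ i a), ∀ w ∈ body K (LF j b) (LJ j b), z ≠ w ∧ ¬ G.Adj z w

theorem Comb.leg_body_subset {y : ℕ → V} {LF : ℕ → ℕ → Finset V} {LJ : ℕ → ℕ → Finset ℕ}
    (h : Comb G K lam E N A R n y LF LJ F J) {i a : ℕ} (hi : IsLeg A R n i a) :
    body K (LF i a) (LJ i a) ⊆ body K F J :=
  body_mono (h.leg_subset i a hi).1 (h.leg_subset i a hi).2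

theorem comb_single {v : V} (hF : v ∈ F) (hv : (∃ p < N, v ∈ E p) ∨ ∃ p ∈ J, ∃ x ∈ E p, v = lam p x) :
    Comb G K lam E N A 0 0 (fun _ => v) (fun _ _ => ∅) (fun _ _ => ∅) F J := by
  have hno : ∀ i a, ¬ IsLeg A 0 0 i a := by
    rintro i a ⟨h1, h2⟩
    rw [if_pos (Nat.le_zero.1 h1)] at h2
    omega
  exact ⟨fun _ _ => hF, fun i j hij hj => by omega,
    fun _ _ => hv.imp_right fun ⟨p, hp, h⟩ => ⟨p, hp, h, fun j b hj => absurd hj (hno j b)⟩,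
    fun i a h => absurd h (hno i a), fun i a h => absurd h (hno i a),
    fun i a h => absurd h (hno i a), fun i a h => absurd h (hno i a),
    fun i a h => absurd h (hno i a), fun _ _ j b h => absurd h (hno j b),
    fun i a _ _ h => absurd h (hno i a), fun i a _ _ h => absurd h (hno i a)⟩

/-- The only edge between the comb and the new leg is the one from `y 0` to `w`. Any other would
force `y 0` to coincide with another vertex of the path or with a vertex of an old leg. -/
theorem Comb.add_leg {y : ℕ → V} {LF : ℕ → ℕ → Finset V} {LJ : ℕ → ℕ → Finset ℕ} {w : V}
    (h : Comb G K lam E N A R n y LF LJ F J) (hj : G.JoinAt K (y 0) F J w F' J')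
    (hw : w ∈ F') (hc : G.ConnSet (body K F' J')) (ht : ∀ u ∈ F', HasType lam E N J' u)
    (hJ : J'.Nonempty) :
    Comb G K lam E N A R (n + 1) y (fun i a => if i = 0 ∧ a = n then F' else LF i a)
      (fun i a => if i = 0 ∧ a = n then J' else LJ i a) (F ∪ F') (J ∪ J') := by
  have hleg : ∀ i a, IsLeg A R (n + 1) i a → (i = 0 ∧ a = n) ∨ (¬ (i = 0 ∧ a = n) ∧ IsLeg A R n i a) := by
    rintro i a ⟨h1, h2⟩
    by_cases hi : i = 0 ∧ a = n
    · exact Or.inl hi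
    · refine Or.inr ⟨hi, h1, ?_⟩
      split_ifs at h2 ⊢ with h3
      · have : a ≠ n := fun h => hi ⟨h3, h⟩
        omega
      · exact h2
  have hb : ∀ i a, IsLeg A R n i a → body K (LF i a) (LJ i a) ⊆ body K F J :=
    fun i a => h.leg_body_subset
  obtain ⟨hadj, hdis, hj⟩ := hj
  refine ⟨fun i hi => Finset.mem_union_left _ (h.head_mem i hi), h.head_adj, ?_, ?_, ?_, ?_, ?_,
    ?_, ?_, ?_, ?_⟩
  · intro i hi
    refine (h.head_type i hi).imp_right fun ⟨p, hp, hx, hp'⟩ =>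
      ⟨p, Finset.mem_union_left _ hp, hx, fun j b hjb => ?_⟩
    rcases hleg j b hjb with hl | ⟨hl, hl'⟩
    · rw [if_pos hl]; exact Finset.disjoint_left.1 hdis hp
    · rw [if_neg hl]; exact hp' j b hl'
  · intro i a hia
    rcases hleg i a hia with hl | ⟨hl, hl'⟩
    · simp only [if_pos hl]; exact ⟨Finset.subset_union_right, Finset.subset_union_right⟩
    · simp only [if_neg hl]
      have := h.leg_subset i a hl'
      exact ⟨this.1.trans Finset.subset_union_left, this.2.trans Finset.subset_union_left⟩
  · intro i a hia
    rcases hleg i a hia with hl | ⟨hl, hl'⟩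
    · simp only [if_pos hl]; exact hJ
    · simp only [if_neg hl]; exact h.leg_core i a hl'
  · intro i a hia
    rcases hleg i a hia with hl | ⟨hl, hl'⟩
    · simp only [if_pos hl]; exact hc
    · simp only [if_neg hl]; exact h.leg_conn i a hl'
  · intro i a hia
    rcases hleg i a hia with hl | ⟨hl, hl'⟩
    · simp only [if_pos hl]; exact ht
    · simp only [if_neg hl]; exact h.leg_type i a hl'
  · intro i a hia
    rcases hleg i a hia with hl | ⟨hl, hl'⟩
    · simp only [if_pos hl]; exact ⟨w, Or.inl hw, hl.1 ▸ hadj⟩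
    · simp only [if_neg hl]; exact h.leg_adj i a hl'
  · intro i hi j b hjb
    rcases hleg j b hjb with hl | ⟨hl, hl'⟩
    · simp only [if_pos hl]
      intro z hz
      have := hj _ (Or.inl (h.head_mem i hi)) z hz
      refine ⟨this.1, fun hyz => ?_⟩
      by_contra hne
      rw [hl.1] at hne
      exact (h.head_adj 0 i (Nat.pos_of_ne_zero hne) hi).1 (this.2 hyz).1.symm
    · simp only [if_neg hl]; exact h.head_leg i hi j b hl'
  · intro i a j b hia hjb hne
    rcases hleg i a hia with hl | ⟨hl, hl'⟩ <;> rcases hleg j b hjb with hm | ⟨hm, hm'⟩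
    · exact absurd (Prod.ext (hl.1.trans hm.1.symm) (hl.2.trans hm.2.symm)) hne
    · simp only [if_pos hl, if_neg hm]
      exact (Finset.disjoint_of_subset_left (h.leg_subset j b hm').2 hdis).symm
    · simp only [if_neg hl, if_pos hm]
      exact Finset.disjoint_of_subset_left (h.leg_subset i a hl').2 hdis
    · simp only [if_neg hl, if_neg hm]; exact h.leg_disj i a j b hl' hm' hne
  · have key : ∀ i a, IsLeg A R n i a → ∀ z ∈ body K (LF i a) (LJ i a), ∀ w ∈ body K F' J',
        z ≠ w ∧ ¬ G.Adj z w := by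
      intro i a hia z hz w hw
      have := hj z (hb i a hia hz) w hw
      refine ⟨this.1, fun hzw => ?_⟩
      exact (h.head_leg 0 (Nat.zero_le _) i a hia z hz).1 (this.2 hzw).1.symm
    intro i a j b hia hjb hne
    rcases hleg i a hia with hl | ⟨hl, hl'⟩ <;> rcases hleg j b hjb with hm | ⟨hm, hm'⟩
    · exact absurd (Prod.ext (hl.1.trans hm.1.symm) (hl.2.trans hm.2.symm)) hne
    · simp only [if_pos hl, if_neg hm]
      intro z hz w hw
      have := key j b hm' w hw z hz
      exact ⟨this.1.symm, fun h => this.2 h.symm⟩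
    · simp only [if_neg hl, if_pos hm]
      exact key i a hl'
    · simp only [if_neg hl, if_neg hm]; exact h.leg_leg i a j b hl' hm' hne

/-- The new first vertex `v` has no legs, so all indices shift by one. The old first vertex has
exactly `A` legs and becomes an ordinary vertex of the path. Whatever hung at `v` stays in `F` but
is no longer part of the comb. -/
theorem Comb.add_head {y : ℕ → V} {LF : ℕ → ℕ → Finset V} {LJ : ℕ → ℕ → Finset ℕ}
    (h : Comb G K lam E N A R A y LF LJ F' J') (hj : G.JoinAt K v F J (y 0) F' J')
    (hv : v ∈ F) (ht : HasType lam E N J v) :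
    Comb G K lam E N A (R + 1) 0 (fun i => if i = 0 then v else y (i - 1))
      (fun i a => LF (i - 1) a) (fun i a => LJ (i - 1) a) (F ∪ F') (J ∪ J') := by
  have hleg : ∀ i a, IsLeg A (R + 1) 0 i a → i ≠ 0 ∧ IsLeg A R A (i - 1) a := by
    rintro i a ⟨h1, h2⟩
    split_ifs at h2 with h3
    · omega
    · exact ⟨h3, by omega, by rw [ite_self]; exact h2⟩
  obtain ⟨hadj, hdis, hj⟩ := hj
  refine ⟨?_, ?_, ?_, ?_, ?_, ?_, ?_, ?_, ?_, ?_, ?_⟩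
  · intro i hi
    by_cases h0 : i = 0
    · rw [if_pos h0]; exact Finset.mem_union_left _ hv
    · rw [if_neg h0]; exact Finset.mem_union_right _ (h.head_mem _ (by omega))
  · intro i j hij hjR
    have hj0 : j ≠ 0 := by omega
    simp only [if_neg hj0]
    by_cases h0 : i = 0
    · simp only [if_pos h0]
      have h1 := hj v (Or.inl hv) _ (Or.inl (h.head_mem (j - 1) (by omega)))
      refine ⟨h1.1, fun h2 => ?_, fun h2 => ?_⟩
      · by_contra hne
        exact (h.head_adj 0 (j - 1) (by omega) (by omega)).1 (h1.2 h2).2.symm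
      · have : j - 1 = 0 := by omega
        rw [this]; exact hadj
    · simp only [if_neg h0]
      have := h.head_adj (i - 1) (j - 1) (by omega) (by omega)
      refine ⟨this.1, this.2.trans ?_⟩
      omega
  · intro i hi
    by_cases h0 : i = 0
    · simp only [if_pos h0]
      refine ht.imp_right fun ⟨p, hp, hx⟩ => ⟨p, Finset.mem_union_left _ hp, hx, fun j b hjb hpj => ?_⟩
      exact Finset.disjoint_left.1 hdis hp ((h.leg_subset _ _ (hleg j b hjb).2).2 hpj)
    · simp only [if_neg h0]
      exact (h.head_type (i - 1) (by omega)).imp_right fun ⟨p, hp, hx, hp'⟩ =>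
        ⟨p, Finset.mem_union_right _ hp, hx, fun j b hjb => hp' _ _ (hleg j b hjb).2⟩
  · intro i a hia
    have := h.leg_subset _ _ (hleg i a hia).2
    exact ⟨this.1.trans Finset.subset_union_right, this.2.trans Finset.subset_union_right⟩
  · exact fun i a hia => h.leg_core _ _ (hleg i a hia).2
  · exact fun i a hia => h.leg_conn _ _ (hleg i a hia).2
  · exact fun i a hia => h.leg_type _ _ (hleg i a hia).2
  · intro i a hia
    rw [if_neg (hleg i a hia).1]
    exact h.leg_adj _ _ (hleg i a hia).2
  · intro i hi j b hjb z hz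
    by_cases h0 : i = 0
    · rw [if_pos h0]
      have h1 := hj v (Or.inl hv) z (h.leg_body_subset (hleg j b hjb).2 hz)
      refine ⟨h1.1, fun h2 => ?_⟩
      exact absurd (h1.2 h2).2.symm (h.head_leg 0 (Nat.zero_le _) _ _ (hleg j b hjb).2 z hz).1
    · rw [if_neg h0]
      have h1 := h.head_leg (i - 1) (by omega) _ _ (hleg j b hjb).2 z hz
      refine ⟨h1.1, fun h2 => ?_⟩
      have := h1.2 h2
      have := (hleg j b hjb).1
      omega
  · intro i a j b hia hjb hne
    refine h.leg_disj _ _ _ _ (hleg i a hia).2 (hleg j b hjb).2 fun heq => hne ?_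
    have h1 := (hleg i a hia).1
    have h2 := (hleg j b hjb).1
    rw [Prod.mk.injEq] at heq ⊢
    omega
  · intro i a j b hia hjb hne
    refine h.leg_leg _ _ _ _ (hleg i a hia).2 (hleg j b hjb).2 fun heq => hne ?_
    have h1 := (hleg i a hia).1
    have h2 := (hleg j b hjb).1
    rw [Prod.mk.injEq] at heq ⊢
    omega

theorem Head.exists_comb (hP : G.IsPool N K lam E κ σ) (h : Head G K lam E N A R n v F J) :
    ∃ y LF LJ, Comb G K lam E N A R n y LF LJ F J ∧ y 0 = v := by
  induction h with
  | @block p v hp hv =>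
    exact ⟨_, _, _, comb_single (Finset.mem_singleton_self v) (Or.inl ⟨p, hp, hv⟩), rfl⟩
  | @attach p x hp hx =>
    exact ⟨_, _, _, comb_single (Finset.mem_singleton_self _)
      (Or.inr ⟨p, Finset.mem_singleton_self p, x, hx, rfl⟩), rfl⟩
  | leg h h' hJ hj ih ih' =>
    obtain ⟨y, LF, LJ, hc, rfl⟩ := ih
    exact ⟨y, _, _, hc.add_leg hj h'.root_mem (h'.connSet hP) h'.hasType hJ, rfl⟩
  | spine h h' hJ hj ih ih' =>
    obtain ⟨y, LF, LJ, hc, rfl⟩ := ih'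
    exact ⟨_, _, _, hc.add_head hj h.root_mem (h.hasType _ h.root_mem), if_pos rfl⟩

end SimpleGraph

/-! ### Links between gadgets through their reserves. -/

namespace SimpleGraph

open scoped Classical

variable {V : Type u} {G : SimpleGraph V} {K : ℕ → Finset V} {lam : ℕ → V → V}
  {E E₀ D : ℕ → Finset V} {N A R n : ℕ} {κ σ e : ℝ} {p p' : ℕ}

/-- A vertex `u` avoids the gadget `p` with reserve `D p` if it is a vertex of some block outside
this reserve, or an attachment of another gadget. -/
def Avoids (lam : ℕ → V → V) (E D : ℕ → Finset V) (N p : ℕ) (u : V) : Prop :=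
  (∃ q < N, u ∈ E q ∧ u ∉ D p) ∨ ∃ q < N, q ≠ p ∧ ∃ x ∈ E q, u = lam q x

theorem Avoids.ne (hP : G.IsPool N K lam E₀ κ σ) (hp : p < N) (hD : D p ⊆ E₀ p) {u x : V}
    (hu : Avoids lam E₀ D N p u) (hx : x ∈ D p) : x ≠ u ∧ lam p x ≠ u := by
  rcases hu with ⟨q, hq, hu, hup⟩ | ⟨q, hq, hqp, x', hx', rfl⟩
  · exact ⟨fun h => hup (h ▸ hx), hP.lam_ne_block hp hq (hD hx) hu⟩
  · exact ⟨(hP.lam_ne_block hq hp hx' (hD hx)).symm, hP.lam_ne_lam hp hq hqp.symm (hD hx) hx'⟩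

variable [Fintype V]

/-- Adjacency to the reserve vertices is bounded by the degree condition. Adjacency to their
attachments, counted with multiplicity, is bounded by the pool condition, which for attachments
needs a different gadget. -/
theorem Avoids.card_le (hG : G.CoherentAt e) (hP : G.IsPool N K lam E₀ κ σ) (hp : p < N)
    (hD : D p ⊆ E₀ p) {u : V} (hu : Avoids lam E₀ D N p u) :
    (((D p).filter fun x => G.Adj x u ∨ G.Adj (lam p x) u).card : ℝ) ≤ e + κ := by
  have h1 : (((D p).filter fun x => G.Adj (lam p x) u).card : ℝ) ≤ κ := by
    refine (Nat.cast_le.2 (Finset.card_le_card (Finset.filter_subset_filter _ hD))).trans ?_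
    rcases hu with ⟨q, hq, hu, -⟩ | ⟨q, hq, hqp, x', hx', rfl⟩
    · exact hP.lam_block p hp q hq u hu
    · exact hP.lam_lam p hp q hq hqp.symm x' hx'
  have h2 := hG.card_filter_adj_lt' (D p) u
  rw [Finset.filter_or]
  have h3 : (((D p).filter (fun x => G.Adj x u) ∪
      (D p).filter fun x => G.Adj (lam p x) u).card : ℝ) ≤
      ((D p).filter fun x => G.Adj x u).card + ((D p).filter fun x => G.Adj (lam p x) u).card := by
    exact_mod_cast Finset.card_union_le _ _
  linarith

theorem exists_large_clear (hG : G.CoherentAt e) (hP : G.IsPool N K lam E₀ κ σ) (hp : p < N)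
    (hD : D p ⊆ E₀ p) {S : Finset V} (hS : ∀ u ∈ S, Avoids lam E₀ D N p u)
    (hc : S.card * (e + κ) + e ≤ (D p).card) :
    ∃ D' ⊆ D p, e ≤ D'.card ∧ ∀ x ∈ D', ∀ u ∈ S, ∀ z ∈ ({x, lam p x} : Finset V),
      z ≠ u ∧ ¬ G.Adj z u := by
  let B : Finset V := S.biUnion fun u => (D p).filter fun x => G.Adj x u ∨ G.Adj (lam p x) u
  have hB : (B.card : ℝ) ≤ S.card * (e + κ) := by
    have h1 : (B.card : ℝ) ≤
        ∑ u ∈ S, (((D p).filter fun x => G.Adj x u ∨ G.Adj (lam p x) u).card : ℝ) := by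
      exact_mod_cast Finset.card_biUnion_le
    refine h1.trans ((Finset.sum_le_sum fun u hu => (hS u hu).card_le hG hP hp hD).trans ?_)
    rw [Finset.sum_const, nsmul_eq_mul]
  refine ⟨D p \ B, Finset.sdiff_subset, ?_, ?_⟩
  · have : ((D p).card : ℝ) ≤ (D p \ B).card + B.card := by
      exact_mod_cast Finset.card_le_card_sdiff_add_card
    linarith
  · intro x hx u hu z hz
    rw [Finset.mem_sdiff] at hx
    have hno : ¬ (G.Adj x u ∨ G.Adj (lam p x) u) := fun h =>
      hx.2 (Finset.mem_biUnion.2 ⟨u, hu, Finset.mem_filter.2 ⟨hx.1, h⟩⟩)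
    have hne := (hS u hu).ne hP hp hD hx.1
    rcases Finset.mem_insert.1 hz with rfl | hz
    · exact ⟨hne.1, fun h => hno (Or.inl h)⟩
    · rw [Finset.mem_singleton] at hz
      subst hz
      exact ⟨hne.2, fun h => hno (Or.inr h)⟩

/-- The vertices of a link between two gadgets. -/
noncomputable def link (lam : ℕ → V → V) (p p' : ℕ) (x x' : V) : Finset V :=
  {x, lam p x} ∪ {x', lam p' x'}

omit [Fintype V] in
theorem avoids_of_mem_link (hP : G.IsPool N K lam E₀ κ σ) (hD : ∀ p < N, D p ⊆ E₀ p) {q : ℕ}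
    (hp : p < N) (hp' : p' < N) (hq : q < N) (hpq : p ≠ q) (hpq' : p' ≠ q) {x x' u : V}
    (hx : x ∈ D p) (hx' : x' ∈ D p') (hu : u ∈ link lam p p' x x') : Avoids lam E₀ D N q u := by
  have key : ∀ r < N, r ≠ q → ∀ z ∈ D r, ∀ u ∈ ({z, lam r z} : Finset V),
      Avoids lam E₀ D N q u := by
    intro r hr hrq z hz u hu
    rcases Finset.mem_insert.1 hu with rfl | hu
    · exact Or.inl ⟨r, hr, hD r hr hz, fun h =>
        Finset.disjoint_left.1 (hP.block_disjoint r hr q hq hrq) (hD r hr hz) (hD q hq h)⟩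
    · exact Or.inr ⟨r, hr, hrq, z, hD r hr hz, Finset.mem_singleton.1 hu⟩
  rcases Finset.mem_union.1 hu with hu | hu
  · exact key p hp hpq x hx u hu
  · exact key p' hp' hpq' x' hx' u hu

omit [Fintype V] in
theorem not_adj_core_of_mem_link (hP : G.IsPool N K lam E₀ κ σ) (hD : ∀ p < N, D p ⊆ E₀ p) {q : ℕ}
    (hp : p < N) (hp' : p' < N) (hq : q < N) (hpq : p ≠ q) (hpq' : p' ≠ q) {x x' u w : V}
    (hx : x ∈ D p) (hx' : x' ∈ D p') (hu : u ∈ link lam p p' x x') (hw : w ∈ K q) :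
    u ≠ w ∧ ¬ G.Adj u w := by
  have key : ∀ r < N, r ≠ q → ∀ z ∈ D r, ∀ u ∈ ({z, lam r z} : Finset V),
      u ≠ w ∧ ¬ G.Adj u w := by
    intro r hr hrq z hz u hu
    rcases Finset.mem_insert.1 hu with rfl | hu
    · exact hP.block_anti r hr q hq _ (hD r hr hz) w hw
    · rw [Finset.mem_singleton.1 hu]
      exact hP.lam_anti r hr q hq hrq z (hD r hr hz) w hw
  rcases Finset.mem_union.1 hu with hu | hu
  · exact key p hp hpq x hx u hu
  · exact key p' hp' hpq' x' hx' u hu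

/-- Two gadgets can be linked while avoiding a small set of vertices. -/
theorem exists_link (hG : G.CoherentAt e) (hP : G.IsPool N K lam E₀ κ σ)
    (hD : ∀ p < N, D p ⊆ E₀ p) (hp : p < N) (hp' : p' < N) (hpp : p ≠ p') {S : Finset V}
    (hS : ∀ u ∈ S, Avoids lam E₀ D N p u ∧ Avoids lam E₀ D N p' u)
    (hc : ∀ q < N, S.card * (e + κ) + e ≤ (D q).card) :
    ∃ x ∈ D p, ∃ x' ∈ D p', G.Adj x x' ∧
      ∀ u ∈ S, ∀ z ∈ link lam p p' x x', z ≠ u ∧ ¬ G.Adj z u := by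
  obtain ⟨B, hB, hBc, hBS⟩ := exists_large_clear hG hP hp (hD p hp) (fun u hu => (hS u hu).1)
    (hc p hp)
  obtain ⟨B', hB', hBc', hBS'⟩ := exists_large_clear hG hP hp' (hD p' hp')
    (fun u hu => (hS u hu).2) (hc p' hp')
  obtain ⟨x, hx, x', hx', hadj⟩ := hG.exists_adj B B'
    (Finset.disjoint_of_subset_left (hB.trans (hD p hp)) (Finset.disjoint_of_subset_right
      (hB'.trans (hD p' hp')) (hP.block_disjoint p hp p' hp' hpp))) hBc hBc'
  refine ⟨x, hB hx, x', hB' hx', hadj, fun u hu z hz => ?_⟩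
  rcases Finset.mem_union.1 hz with hz | hz
  · exact hBS x hx u hu z hz
  · exact hBS' x' hx' u hu z hz

/-- Disjoint pairs of gadgets can be linked by pairwise anticomplete links. -/
theorem exists_links [Nonempty V] (hG : G.CoherentAt e) (hP : G.IsPool N K lam E₀ κ σ)
    (hD : ∀ p < N, D p ⊆ E₀ p) (he : 0 ≤ e + κ) {b : ℕ} (M : ℕ)
    (hc : ∀ q < N, (b + 4 * M : ℕ) * (e + κ) + e ≤ (D q).card) (p p' : ℕ → ℕ) (S : ℕ → Finset V) :
    ∀ m ≤ M, (∀ l < m, p l < N ∧ p' l < N ∧ p l ≠ p' l) →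
      (∀ l < m, ∀ l' < m, l ≠ l' → p l ≠ p l' ∧ p l ≠ p' l' ∧ p' l ≠ p l' ∧ p' l ≠ p' l') →
      (∀ l < m, (S l).card ≤ b ∧
        ∀ u ∈ S l, Avoids lam E₀ D N (p l) u ∧ Avoids lam E₀ D N (p' l) u) →
      ∃ x x' : ℕ → V, ∀ l < m, x l ∈ D (p l) ∧ x' l ∈ D (p' l) ∧ G.Adj (x l) (x' l) ∧
        (∀ u ∈ S l, ∀ z ∈ link lam (p l) (p' l) (x l) (x' l), z ≠ u ∧ ¬ G.Adj z u) ∧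
        ∀ l' < l, ∀ u ∈ link lam (p l') (p' l') (x l') (x' l'),
          ∀ z ∈ link lam (p l) (p' l) (x l) (x' l), z ≠ u ∧ ¬ G.Adj z u := by
  intro m
  induction m with
  | zero =>
    intro _ _ _ _
    exact ⟨fun _ => Classical.arbitrary V, fun _ => Classical.arbitrary V,
      fun l hl => absurd hl (Nat.not_lt_zero l)⟩
  | succ m ih =>
    intro hm hlt hne hS
    obtain ⟨x, x', hx⟩ := ih (by omega) (fun l hl => hlt l (by omega))
      (fun l hl l' hl' => hne l (by omega) l' (by omega)) (fun l hl => hS l (by omega))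
    obtain ⟨h1, h2, h3⟩ := hlt m (by omega)
    -- Earlier links have at most four vertices each and belong to other gadgets, so they can be
    -- avoided along with `S m`.
    let S' : Finset V := S m ∪
      (Finset.range m).biUnion fun l => link lam (p l) (p' l) (x l) (x' l)
    have hcard : S'.card ≤ b + 4 * M := by
      refine (Finset.card_union_le _ _).trans (Nat.add_le_add (hS m (by omega)).1 ?_)
      refine (Finset.card_biUnion_le_card_mul _ _ 4 fun l _ => ?_).trans ?_
      · refine (Finset.card_union_le _ _).trans ?_
        have h5 := Finset.card_le_two (a := x l) (b := lam (p l) (x l))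
        have h6 := Finset.card_le_two (a := x' l) (b := lam (p' l) (x' l))
        omega
      · rw [Finset.card_range]; omega
    obtain ⟨z, hz, z', hz', hadj, hzS⟩ := exists_link hG hP hD h1 h2 h3 (S := S')
      (by
        intro u hu
        rcases Finset.mem_union.1 hu with hu | hu
        · exact (hS m (by omega)).2 u hu
        · obtain ⟨l, hl, hu⟩ := Finset.mem_biUnion.1 hu
          have hl := Finset.mem_range.1 hl
          obtain ⟨a1, a2, a3, a4⟩ := hne l (by omega) m (by omega) hl.ne
          obtain ⟨b1, b2, -⟩ := hlt l (by omega)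
          obtain ⟨c1, c2, -⟩ := hx l hl
          exact ⟨avoids_of_mem_link hP hD b1 b2 h1 a1 a3 c1 c2 hu,
            avoids_of_mem_link hP hD b1 b2 h2 a2 a4 c1 c2 hu⟩)
      (fun q hq => by
        refine le_trans ?_ (hc q hq)
        have : (S'.card : ℝ) ≤ (b + 4 * M : ℕ) := by exact_mod_cast hcard
        have := mul_le_mul_of_nonneg_right this he
        linarith)
    have hold : ∀ l < m, Function.update x m z l = x l ∧ Function.update x' m z' l = x' l :=
      fun l hl => ⟨Function.update_of_ne hl.ne _ _, Function.update_of_ne hl.ne _ _⟩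
    refine ⟨Function.update x m z, Function.update x' m z', fun l hl => ?_⟩
    rcases Nat.lt_succ_iff_lt_or_eq.1 hl with hl | rfl
    · rw [(hold l hl).1, (hold l hl).2]
      obtain ⟨a1, a2, a3, a4, a5⟩ := hx l hl
      refine ⟨a1, a2, a3, a4, fun l' hl' => ?_⟩
      rw [(hold l' (by omega)).1, (hold l' (by omega)).2]
      exact a5 l' hl'
    · rw [Function.update_self, Function.update_self]
      refine ⟨hz, hz', hadj, fun u hu => hzS u (Finset.mem_union_left _ hu), fun l' hl' u hu => ?_⟩
      rw [(hold l' hl').1, (hold l' hl').2] at hu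
      exact hzS u (Finset.mem_union_right _ (Finset.mem_biUnion.2 ⟨l', Finset.mem_range.2 hl', hu⟩))

end SimpleGraph

/-! ### From combs to rakes. -/

namespace SimpleGraph

open scoped Classical

variable {V : Type u} {G : SimpleGraph V} {K : ℕ → Finset V} {lam : ℕ → V → V}
  {E E₀ D : ℕ → Finset V} {N A R n : ℕ} {κ σ e : ℝ} {F : Finset V} {J : Finset ℕ}
  {y : ℕ → V} {LF : ℕ → ℕ → Finset V} {LJ : ℕ → ℕ → Finset ℕ}

/-- Block vertices of the structure lie in `E`, disjoint from the reserves, and its attachments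
belong to gadgets in `J`. So only gadgets in `J` could fail to be avoided. -/
theorem HasType.avoids (hP : G.IsPool N K lam E₀ κ σ) (hE : ∀ p < N, E p ⊆ E₀ p)
    (hD : ∀ p < N, D p ⊆ E₀ p) (hED : ∀ p < N, Disjoint (E p) (D p)) {J : Finset ℕ}
    (hJ : ∀ q ∈ J, q < N) {u : V} (hu : HasType lam E N J u) {p : ℕ} (hp : p < N) (hpJ : p ∉ J) :
    Avoids lam E₀ D N p u := by
  rcases hu with ⟨q, hq, hu⟩ | ⟨q, hq, x, hx, rfl⟩
  · refine Or.inl ⟨q, hq, hE q hq hu, fun hup => ?_⟩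
    by_cases hqp : q = p
    · subst hqp; exact Finset.disjoint_left.1 (hED q hq) hu hup
    · exact Finset.disjoint_left.1 (hP.block_disjoint q hq p hp hqp) (hE q hq hu) (hD p hp hup)
  · exact Or.inr ⟨q, hJ q hq, fun h => hpJ (h ▸ hq), x, hE q (hJ q hq) hx, rfl⟩

/-- A leg extended by one end of a link. -/
theorem ConnSet.extend_link (hP : G.IsPool N K lam E₀ κ σ) {J : Finset ℕ} {F : Finset V}
    (hc : G.ConnSet (body K F J)) {p : ℕ} (hpJ : p ∈ J) (hp : p < N) {x : V} (hx : x ∈ E₀ p) :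
    G.ConnSet (insert x (insert (lam p x) (body K F J))) := by
  obtain ⟨w, hw, hadj⟩ := hP.lam_core p hp x hx
  exact (hc.insert_of_adj (Or.inr ⟨p, hpJ, hw⟩) hadj.symm).insert_of_adj
    (Set.mem_insert _ _) (hP.lam_adj p hp x hx).symm

variable [Fintype V]

/-- The legs of a comb can be linked in pairs to form a rake. -/
theorem Comb.hasRake (hG : G.CoherentAt e) (hP : G.IsPool N K lam E₀ κ σ)
    (hE : ∀ p < N, E p ⊆ E₀ p) (hD : ∀ p < N, D p ⊆ E₀ p) (hED : ∀ p < N, Disjoint (E p) (D p))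
    (h : Comb G K lam E N A R n y LF LJ F J) (hJ : ∀ p ∈ J, p < N) (he : 0 ≤ e + κ)
    {b k m : ℕ} (hF : F.card ≤ b) (hk : k ≤ R) (hm : m ≤ A)
    (hc : ∀ q < N, (b + 4 * m : ℕ) * (e + κ) + e ≤ (D q).card) {i j : ℕ → ℕ}
    (hij : ∀ l < m, i l < k ∧ j l < k ∧ i l ≠ j l) : G.HasRake k m i j := by
  -- The path of the rake starts at `y 1`, since `y 0` need not have `A` legs. The `l`-th set of the
  -- rake uses leg number `l` at each of its two ends.
  have hleg : ∀ a < k, ∀ l < m, IsLeg A R n (a + 1) l := fun a ha l hl =>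
    ⟨by omega, by rw [if_neg (Nat.succ_ne_zero a)]; omega⟩
  have hli : ∀ l < m, IsLeg A R n (i l + 1) l := fun l hl => hleg _ (hij l hl).1 l hl
  have hlj : ∀ l < m, IsLeg A R n (j l + 1) l := fun l hl => hleg _ (hij l hl).2.1 l hl
  have hp : ∀ l, ∃ q, l < m → q ∈ LJ (i l + 1) l := fun l => by
    by_cases hl : l < m
    · obtain ⟨q, hq⟩ := h.leg_core _ _ (hli l hl)
      exact ⟨q, fun _ => hq⟩
    · exact ⟨0, fun h => absurd h hl⟩
  have hp' : ∀ l, ∃ q, l < m → q ∈ LJ (j l + 1) l := fun l => by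
    by_cases hl : l < m
    · obtain ⟨q, hq⟩ := h.leg_core _ _ (hlj l hl)
      exact ⟨q, fun _ => hq⟩
    · exact ⟨0, fun h => absurd h hl⟩
  choose p hp using hp
  choose p' hp' using hp'
  have hJN : ∀ i a, IsLeg A R n i a → ∀ q ∈ LJ i a, q < N := fun i a hia q hq =>
    hJ q ((h.leg_subset i a hia).2 hq)
  have hpN : ∀ l < m, p l < N := fun l hl => hJN _ _ (hli l hl) _ (hp l hl)
  have hpN' : ∀ l < m, p' l < N := fun l hl => hJN _ _ (hlj l hl) _ (hp' l hl)
  have hnot : ∀ i a j b, IsLeg A R n i a → IsLeg A R n j b → (i, a) ≠ (j, b) → ∀ q ∈ LJ i a,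
      q ∉ LJ j b := fun i a j b hia hjb hne q hq =>
    Finset.disjoint_left.1 (h.leg_disj i a j b hia hjb hne) hq
  have hne2 : ∀ {a b : ℕ} (l l' : ℕ), l ≠ l' → (a, l) ≠ (b, l') := fun l l' hll h =>
    hll (Prod.mk.inj h).2
  have : Nonempty V := ⟨y 0⟩
  obtain ⟨x, x', hx⟩ := exists_links hG hP hD he m hc p p'
    -- Vertices of the two legs being linked may fail to avoid the gadgets `p l` and `p' l`; edges
    -- from the link to them are harmless, as they lie in the same set of the rake.
    (fun l => F.filter fun u => Avoids lam E₀ D N (p l) u ∧ Avoids lam E₀ D N (p' l) u) m le_rfl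
    (by
      intro l hl
      refine ⟨hpN l hl, hpN' l hl, fun heq => ?_⟩
      refine hnot _ _ _ _ (hli l hl) (hlj l hl) (fun h => ?_) _ (hp l hl) (heq ▸ hp' l hl)
      exact (hij l hl).2.2 (by simpa using h))
    (by
      intro l hl l' hl' hll
      exact ⟨fun heq => hnot _ _ _ _ (hli l hl) (hli l' hl') (hne2 l l' hll) _ (hp l hl)
          (heq ▸ hp l' hl'),
        fun heq => hnot _ _ _ _ (hli l hl) (hlj l' hl') (hne2 l l' hll) _ (hp l hl)
          (heq ▸ hp' l' hl'),
        fun heq => hnot _ _ _ _ (hlj l hl) (hli l' hl') (hne2 l l' hll) _ (hp' l hl)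
          (heq ▸ hp l' hl'),
        fun heq => hnot _ _ _ _ (hlj l hl) (hlj l' hl') (hne2 l l' hll) _ (hp' l hl)
          (heq ▸ hp' l' hl')⟩)
    (fun l _ => ⟨(Finset.card_le_card (Finset.filter_subset _ _)).trans hF,
      fun u hu => (Finset.mem_filter.1 hu).2⟩)
  let M : ℕ → Finset V := fun l => link lam (p l) (p' l) (x l) (x' l)
  let X : ℕ → ℕ → Set V := fun a l => body K (LF (a + 1) l) (LJ (a + 1) l)
  let C : ℕ → Set V := fun l =>
    insert (x l) (insert (lam (p l) (x l)) (X (i l) l)) ∪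
      insert (x' l) (insert (lam (p' l) (x' l)) (X (j l) l))
  have hC : ∀ l, ∀ z ∈ C l, z ∈ M l ∨ z ∈ X (i l) l ∨ z ∈ X (j l) l := by
    rintro l z ((rfl | rfl | hz) | (rfl | rfl | hz))
    · exact Or.inl (by simp [M, link])
    · exact Or.inl (by simp [M, link])
    · exact Or.inr (Or.inl hz)
    · exact Or.inl (by simp [M, link])
    · exact Or.inl (by simp [M, link])
    · exact Or.inr (Or.inr hz)
  -- links are anticomplete to the path
  have hMy : ∀ l < m, ∀ a < k, ∀ z ∈ M l, z ≠ y (a + 1) ∧ ¬ G.Adj z (y (a + 1)) := by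
    intro l hl a ha z hz
    have hav : ∀ i', IsLeg A R n i' l → ∀ q ∈ LJ i' l, Avoids lam E₀ D N q (y (a + 1)) := by
      intro i' hi' q hq
      have hqN := hJN _ _ hi' q hq
      rcases h.head_type (a + 1) (by omega) with hy | ⟨r, hr, hy, hr'⟩
      · exact HasType.avoids (J := ∅) hP hE hD hED (by simp) (Or.inl hy) hqN (by simp)
      · refine HasType.avoids (J := {r}) hP hE hD hED (by simpa using hJ r hr)
          (Or.inr ⟨r, by simp, hy⟩) hqN fun hqr => ?_
        rw [Finset.mem_singleton] at hqr
        exact hr' _ _ hi' (hqr ▸ hq)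
    exact (hx l hl).2.2.2.1 _ (Finset.mem_filter.2 ⟨h.head_mem _ (by omega),
      hav _ (hli l hl) _ (hp l hl), hav _ (hlj l hl) _ (hp' l hl)⟩) z hz
  -- links are anticomplete to the other legs
  have hMX : ∀ l < m, ∀ l' < m, l ≠ l' → ∀ a < k, ∀ z ∈ M l, ∀ w ∈ X a l',
      z ≠ w ∧ ¬ G.Adj z w := by
    intro l hl l' hl' hll a ha z hz w hw
    have hleg' := hleg a ha l' hl'
    have n1 : p l ∉ LJ (a + 1) l' := hnot _ _ _ _ (hli l hl) hleg' (hne2 l l' hll) _ (hp l hl)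
    have n2 : p' l ∉ LJ (a + 1) l' := hnot _ _ _ _ (hlj l hl) hleg' (hne2 l l' hll) _ (hp' l hl)
    rcases hw with hw | ⟨q, hq, hw⟩
    · have ht := h.leg_type _ _ hleg' w hw
      exact (hx l hl).2.2.2.1 w (Finset.mem_filter.2 ⟨(h.leg_subset _ _ hleg').1 hw,
        ht.avoids hP hE hD hED (hJN _ _ hleg') (hpN l hl) n1,
        ht.avoids hP hE hD hED (hJN _ _ hleg') (hpN' l hl) n2⟩) z hz
    · exact not_adj_core_of_mem_link hP hD (hpN l hl) (hpN' l hl) (hJN _ _ hleg' q hq)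
        (fun h => n1 (h ▸ hq)) (fun h => n2 (h ▸ hq)) (hx l hl).1 (hx l hl).2.1 hz hw
  have hMM : ∀ l < m, ∀ l' < m, l ≠ l' → ∀ z ∈ M l, ∀ w ∈ M l', z ≠ w ∧ ¬ G.Adj z w := by
    intro l hl l' hl' hll z hz w hw
    rcases lt_or_gt_of_ne hll with hlt | hlt
    · have := (hx l' hl').2.2.2.2 l hlt z hz w hw
      exact ⟨this.1.symm, fun h => this.2 h.symm⟩
    · exact (hx l hl).2.2.2.2 l' hlt w hw z hz
  have hXX : ∀ l < m, ∀ l' < m, l ≠ l' → ∀ a < k, ∀ a' < k, ∀ z ∈ X a l, ∀ w ∈ X a' l',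
      z ≠ w ∧ ¬ G.Adj z w := fun l hl l' hl' hll a ha a' ha' =>
    h.leg_leg _ _ _ _ (hleg a ha l hl) (hleg a' ha' l' hl') (hne2 l l' hll)
  have hyX : ∀ l < m, ∀ a < k, ∀ a' < k, ∀ z ∈ X a l,
      y (a' + 1) ≠ z ∧ (G.Adj (y (a' + 1)) z → a' = a) := by
    intro l hl a ha a' ha' z hz
    have := h.head_leg (a' + 1) (by omega) _ _ (hleg a ha l hl) z hz
    exact ⟨this.1, fun hadj => by have := this.2 hadj; omega⟩
  refine ⟨fun a => y (a + 1), C, ?_, ?_, ?_, ?_, ?_⟩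
  · intro a ha a' ha' heq
    rcases lt_trichotomy a a' with hlt | rfl | hlt
    · exact absurd heq (h.head_adj (a + 1) (a' + 1) (by omega) (by omega)).1
    · rfl
    · exact absurd heq.symm (h.head_adj (a' + 1) (a + 1) (by omega) (by omega)).1
  · intro a ha a' ha'
    rcases lt_trichotomy a a' with hlt | rfl | hlt
    · rw [(h.head_adj (a + 1) (a' + 1) (by omega) (by omega)).2]
      omega
    · exact ⟨fun hadj => absurd hadj (G.loopless.irrefl _), fun h => by omega⟩
    · rw [G.adj_comm, (h.head_adj (a' + 1) (a + 1) (by omega) (by omega)).2]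
      omega
  · intro l hl
    obtain ⟨h1, h2, h3, -⟩ := hx l hl
    exact ((h.leg_conn _ _ (hli l hl)).extend_link hP (hp l hl) (hpN l hl)
      (hD _ (hpN l hl) h1)).union_of_adj ((h.leg_conn _ _ (hlj l hl)).extend_link hP (hp' l hl)
      (hpN' l hl) (hD _ (hpN' l hl) h2)) (Set.mem_insert _ _) (Set.mem_insert _ _) h3
  · intro l hl a ha
    refine ⟨fun hmem => ?_, ?_, ?_⟩
    · rcases hC l _ hmem with hz | hz | hz
      · exact (hMy l hl a ha _ hz).1 rfl
      · exact (hyX l hl _ (hij l hl).1 a ha _ hz).1 rfl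
      · exact (hyX l hl _ (hij l hl).2.1 a ha _ hz).1 rfl
    · rintro ⟨z, hz, hadj⟩
      rcases hC l _ hz with hz | hz | hz
      · exact absurd hadj.symm (hMy l hl a ha _ hz).2
      · exact Or.inl ((hyX l hl _ (hij l hl).1 a ha _ hz).2 hadj)
      · exact Or.inr ((hyX l hl _ (hij l hl).2.1 a ha _ hz).2 hadj)
    · rintro (rfl | rfl)
      · obtain ⟨z, hz, hadj⟩ := h.leg_adj _ _ (hli l hl)
        exact ⟨z, Or.inl (Or.inr (Or.inr hz)), hadj⟩
      · obtain ⟨z, hz, hadj⟩ := h.leg_adj _ _ (hlj l hl)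
        exact ⟨z, Or.inr (Or.inr (Or.inr hz)), hadj⟩
  · intro l hl l' hl' hll z hz w hw
    have hsymm : ∀ {z w}, w ≠ z ∧ ¬ G.Adj w z → z ≠ w ∧ ¬ G.Adj z w := fun h =>
      ⟨h.1.symm, fun h' => h.2 h'.symm⟩
    obtain ⟨i1, j1, -⟩ := hij l hl
    obtain ⟨i2, j2, -⟩ := hij l' hl'
    rcases hC l z hz with hz | hz | hz <;> rcases hC l' w hw with hw | hw | hw
    · exact hMM l hl l' hl' hll z hz w hw
    · exact hMX l hl l' hl' hll _ i2 z hz w hw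
    · exact hMX l hl l' hl' hll _ j2 z hz w hw
    · exact hsymm (hMX l' hl' l hl hll.symm _ i1 w hw z hz)
    · exact hXX l hl l' hl' hll _ i1 _ i2 z hz w hw
    · exact hXX l hl l' hl' hll _ i1 _ j2 z hz w hw
    · exact hsymm (hMX l' hl' l hl hll.symm _ j1 w hw z hz)
    · exact hXX l hl l' hl' hll _ j1 _ i2 z hz w hw
    · exact hXX l hl l' hl' hll _ j1 _ j2 z hz w hw

end SimpleGraph

/-! ### Choice of the parameters. -/

namespace SimpleGraph

open scoped Classical

/-- A large set splits into two large halves. -/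
theorem exists_half {V : Type u} (S : Finset V) {σ : ℝ} (h : 2 * σ + 1 ≤ S.card) :
    ∃ A ⊆ S, σ ≤ A.card ∧ σ ≤ (S \ A).card := by
  obtain ⟨A, hA, hc⟩ := Finset.exists_subset_card_eq (Nat.div_le_self S.card 2)
  have h1 : (S \ A).card = S.card - A.card := Finset.card_sdiff_of_subset hA
  have h2 : S.card ≤ 2 * A.card + 1 := by omega
  have h3 : A.card ≤ (S \ A).card := by omega
  have h4 : (S.card : ℝ) ≤ 2 * A.card + 1 := by exact_mod_cast h2
  have h5 : (A.card : ℝ) ≤ (S \ A).card := by exact_mod_cast h3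
  exact ⟨A, hA, by linarith, by linarith⟩

section Coherent

variable {V : Type u} [Fintype V] {G : SimpleGraph V} {e : ℝ}

/-- If `e ≤ 1`, any two distinct vertices are adjacent, while all degrees are less than one. The
bound lets `e` absorb additive constants. -/
theorem CoherentAt.one_lt (hG : G.CoherentAt e) (hV : 2 ≤ Fintype.card V) : 1 < e := by
  by_contra hlt
  push Not at hlt
  obtain ⟨a, b, hab⟩ := Fintype.exists_pair_of_one_lt_card (α := V) hV
  obtain ⟨x, hx, y, hy, hadj⟩ := hG.exists_adj {a} {b} (by simpa using hab) (by simpa using hlt)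
    (by simpa using hlt)
  have h1 := hG.degree_lt x
  have h2 : 1 ≤ (Finset.univ.filter fun u => G.Adj x u).card :=
    Finset.card_pos.2 ⟨y, by simpa using hadj⟩
  have h3 : (1 : ℝ) ≤ (Finset.univ.filter fun u => G.Adj x u).card := by exact_mod_cast h2
  have h4 : 1 ≤ e := by linarith
  have h5 : e = 1 := le_antisymm hlt h4
  linarith

/-- A sufficiently large pool yields rakes. -/
theorem IsPool.hasRake (hG : G.CoherentAt e) {k m A T N b : ℕ} {K : ℕ → Finset V}
    {lam : ℕ → V → V} {E : ℕ → Finset V} {κ σ : ℝ} (hA : A = m + 1) (hT : T = (k + 1) * (A + 1))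
    (hN : 2 ^ T * (2 ^ T * (2 ^ (T + 1)) ^ (2 * T + 1) + (2 ^ (T + 1)) ^ (2 * T)) <
      N * 2 ^ (T + 1))
    (hb : b = 2 ^ (N * (T + 1)) * 2 ^ (2 ^ T)) (hκ : 0 < κ) (heκ : e ≤ κ) (he : 0 ≤ e)
    (hσ : 8 ^ (N * (T + 1)) * (4 ^ (2 ^ T) * κ) ≤ σ)
    (hσ' : (b + 4 * m : ℕ) * (e + κ) + e ≤ σ) (hP : G.IsPool N K lam E κ (2 * σ + 1))
    {i j : ℕ → ℕ} (hij : ∀ l < m, i l < k ∧ j l < k ∧ i l ≠ j l) : G.HasRake k m i j := by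
  -- One half of each block is spent on the comb, the other is the reserve for the links.
  have hsplit : ∀ p, ∃ S ⊆ E p, p < N → σ ≤ S.card ∧ σ ≤ (E p \ S).card := by
    intro p
    by_cases hp : p < N
    · obtain ⟨S, h1, h2⟩ := exists_half (E p) (hP.block_card p hp)
      exact ⟨S, h1, fun _ => h2⟩
    · exact ⟨∅, Finset.empty_subset _, fun h => absurd h hp⟩
  choose S hS hSc using hsplit
  have hP' := hP.restrict (E' := S) (fun p _ => hS p) fun p hp => hσ.trans (hSc p hp).1
  have hT1 : 1 ≤ T := by rw [hT]; exact Nat.mul_pos (Nat.succ_pos _) (Nat.succ_pos _)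
  obtain ⟨R, n, v, F, J, hh, hn, hR, hF⟩ := hP'.hasHead hG (A := A) (T := T) (by omega) hT1 rfl hκ
    heκ le_rfl hN
  obtain ⟨y, LF, LJ, hc, -⟩ := hh.exists_comb hP'
  refine hc.hasRake hG hP (D := fun p => E p \ S p) (fun p _ => hS p)
    (fun p _ => Finset.sdiff_subset) (fun p _ => Finset.disjoint_sdiff) hh.lt_of_mem (by linarith)
    (hF.trans hb.ge) ?_ (by omega) (fun q hq => hσ'.trans (hSc q hq).2) hij
  -- As `n ≤ A`, a level of at least `(k + 1) * (A + 1)` forces a spine longer than `k`.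
  by_contra hlt
  push Not at hlt
  have : (R + 1) * (A + 1) ≤ (k + 1) * (A + 1) := Nat.mul_le_mul_right _ (by omega)
  have : (R + 1) * (A + 1) ≤ k * (A + 1) := Nat.mul_le_mul_right _ (by omega)
  rw [hT, Nat.add_mul] at hR
  rw [Nat.add_mul] at this
  omega

end Coherent

/-- Rakes of a given shape exist in all graphs that are coherent for a suitable parameter. -/
theorem exists_forall_hasRake (k m : ℕ) : ∃ ε : ℝ, 0 < ε ∧
    ∀ (V : Type u) (G : SimpleGraph V), G.IsCoherent ε → ∀ i j : ℕ → ℕ,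
      (∀ l < m, i l < k ∧ j l < k ∧ i l ≠ j l) → G.HasRake k m i j := by
  obtain ⟨A, hA⟩ : ∃ A, A = m + 1 := ⟨_, rfl⟩
  obtain ⟨T, hT⟩ : ∃ T, T = (k + 1) * (A + 1) := ⟨_, rfl⟩
  obtain ⟨N, hN0, hN⟩ : ∃ N, 1 ≤ N ∧
      2 ^ T * (2 ^ T * (2 ^ (T + 1)) ^ (2 * T + 1) + (2 ^ (T + 1)) ^ (2 * T)) <
        N * 2 ^ (T + 1) :=
    ⟨2 ^ T * (2 ^ T * (2 ^ (T + 1)) ^ (2 * T + 1) + (2 ^ (T + 1)) ^ (2 * T)) + 1, by omega,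
      lt_of_lt_of_le (Nat.lt_succ_self _) (Nat.le_mul_of_pos_right _ (by positivity))⟩
  obtain ⟨b, hb⟩ : ∃ b : ℕ, b = 2 ^ (N * (T + 1)) * 2 ^ (2 ^ T) := ⟨_, rfl⟩
  obtain ⟨Q, hQ⟩ : ∃ Q : ℝ, Q = 8 ^ (N * (T + 1)) * 4 ^ (2 ^ T) := ⟨_, rfl⟩
  have hQ0 : 0 ≤ Q := by rw [hQ]; positivity
  -- Half a block must have at least `Z * κ` vertices: `Q * κ` serves the game, and the rest serves
  -- the links, using `e ≤ κ`.
  obtain ⟨Z, hZ⟩ : ∃ Z : ℝ, Z = Q + 2 * (b + 4 * m : ℕ) + 1 := ⟨_, rfl⟩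
  have hbm : (0 : ℝ) ≤ (b + 4 * m : ℕ) := Nat.cast_nonneg _
  have hZ1 : 1 ≤ Z := by rw [hZ]; linarith
  have hNr : (1 : ℝ) ≤ N := by exact_mod_cast hN0
  obtain ⟨t, ht⟩ : ∃ t : ℝ, t = 1 / (13 + 8 * N) := ⟨_, rfl⟩
  have ht0 : 0 < t := by rw [ht]; positivity
  have ht1 : t * (13 + 8 * N) = 1 := by rw [ht]; field_simp
  have htle : t ≤ 1 := by nlinarith
  obtain ⟨δ, hδ⟩ : ∃ δ : ℝ, δ = t / (16 * N) := ⟨_, rfl⟩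
  have hδ0 : 0 < δ := by rw [hδ]; positivity
  have hδN : N * δ = t / 16 := by rw [hδ]; field_simp
  have hδt : δ ≤ t / 16 := by nlinarith
  obtain ⟨c, hc⟩ : ∃ c : ℝ, c = t / (16 * Z) := ⟨_, rfl⟩
  have hc0 : 0 < c := by rw [hc]; positivity
  have hcZ : Z * c = t / 16 := by rw [hc]; field_simp
  have hct : c ≤ t / 16 := by nlinarith
  -- With `n` the number of vertices, the parameters will be `τ = t * n`, `d = r = δ * n`, `κ₂ = c *
  -- n`, `κ₁ = c * δ * n` and `e = c * δ * δ * n`. The two double counts then hold with equality: `n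
  -- * e = κ₁ * d` and `n * κ₁ = κ₂ * r`. The value of `t` makes room for `N` gadgets, `δ` keeps the
  -- total loss of a block below a fraction of `t * n`, and `c` gives `Z * κ₂ = t / 16 * n`.
  have hε0 : 0 < c * δ * δ := by positivity
  have hcδ : c * δ ≤ c := by nlinarith
  have hεc : c * δ * δ ≤ c := by nlinarith [mul_pos hc0 hδ0]
  have hεδ : c * δ * δ ≤ δ / 16 := by nlinarith
  refine ⟨c * δ * δ, hε0, fun V G hcoh i j hij => ?_⟩
  have := hcoh.finite
  have := Fintype.ofFinite V
  have hG := hcoh.coherentAt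
  have hV : 2 ≤ Fintype.card V := by
    have := hcoh.two_le_card
    rwa [Nat.card_eq_fintype_card] at this
  have he1 := hG.one_lt hV
  obtain ⟨n, hn⟩ : ∃ n : ℝ, n = Fintype.card V := ⟨_, rfl⟩
  rw [← hn] at hG he1
  have hn0 : 0 < n := by
    have : (2 : ℝ) ≤ Fintype.card V := by exact_mod_cast hV
    linarith
  obtain ⟨e, he⟩ : ∃ e : ℝ, e = c * δ * δ * n := ⟨_, rfl⟩
  rw [← he] at hG he1
  have heκ : e ≤ c * n := by rw [he]; exact mul_le_mul_of_nonneg_right hεc hn0.le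
  have heδ : e ≤ δ / 16 * n := by rw [he]; exact mul_le_mul_of_nonneg_right hεδ hn0.le
  have hδn : δ * n ≤ t / 16 * n := mul_le_mul_of_nonneg_right hδt hn0.le
  have hNδn : N * (δ * n) = t / 16 * n := by rw [← mul_assoc, hδN]
  have hNe : N * e ≤ t / 256 * n := by
    have := mul_le_mul_of_nonneg_left heδ (show (0 : ℝ) ≤ N by linarith)
    nlinarith
  have htn : 0 < t * n := mul_pos ht0 hn0
  obtain ⟨K, lam, E, hP⟩ := hG.exists_isPool (κ₁ := c * δ * n) (κ₂ := c * n) (τ := t * n)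
    (d := δ * n) (r := δ * n) (N := N) he1.le (by positivity)
    (mul_le_mul_of_nonneg_right hcδ hn0.le) (by rw [← hn, he]; apply le_of_eq; ring)
    (by rw [← hn]; apply le_of_eq; ring) (by linarith) (by positivity) (by positivity)
    (by
      rw [← hn]
      have h1 : t * n * (13 + 8 * N) = n := by
        calc t * n * (13 + 8 * N) = t * (13 + 8 * N) * n := by ring
          _ = n := by rw [ht1, one_mul]
      have h2 : 12 * (t * n) + 2 * N * (4 * (t * n) + δ * n) =
          t * n * (13 + 8 * N) - t * n + 2 * (N * (δ * n)) := by ring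
      rw [h2, h1, hNδn]
      linarith)
  have hσ : 2 * (t / 16 * n) + 1 ≤ t * n / 2 - N * (2 * e + δ * n + δ * n) := by
    have h1 : N * (2 * e + δ * n + δ * n) = 2 * (N * e) + 2 * (N * (δ * n)) := by ring
    rw [h1, hNδn]
    have : 1 ≤ δ / 16 * n := he1.le.trans heδ
    linarith
  have hZn : Z * (c * n) = t / 16 * n := by rw [← mul_assoc, hcZ]
  have hcn : 0 < c * n := mul_pos hc0 hn0
  have hZe : Q * (c * n) + (2 * (b + 4 * m : ℕ) + 1) * (c * n) = t / 16 * n := by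
    rw [← hZn, hZ]; ring
  refine (hP.restrict (fun _ _ => subset_rfl) fun p hp => hσ.trans (hP.block_card p hp)).hasRake
    hG hA hT hN hb hcn heκ (by linarith) ?_ ?_ hij
  · rw [← mul_assoc, ← hQ, ← hZe]
    have : 0 ≤ (2 * (b + 4 * m : ℕ) + 1) * (c * n) := by positivity
    linarith
  · rw [← hZe]
    have h1 : 0 ≤ Q * (c * n) := by positivity
    have h2 : (b + 4 * m : ℕ) * (e + c * n) ≤ (b + 4 * m : ℕ) * (c * n + c * n) :=
      mul_le_mul_of_nonneg_left (by linarith) hbm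
    have h3 : (2 * (b + 4 * m : ℕ) + 1) * (c * n) =
      (b + 4 * m : ℕ) * (c * n + c * n) + c * n := by ring
    linarith

end SimpleGraph

theorem mainTheorem3 {W : Type v} [Finite W] (H : SimpleGraph W) {a b : W}
    (P : H.Walk a b) (hP : P.IsPath) :
    (∀ I : GraphIdeal.{u}, I.Coherent →
      ∃ (V : Type u) (J : SimpleGraph V), I.Mem J ∧ H.IsFilleting P J) ∧
    (GraphIdeal.filletingFree.{u, v} H P).Incoherent := by
  apply SimpleGraph.filleting_ideals_of_quantitative
  obtain ⟨k, m, i, j, hij, h⟩ := SimpleGraph.exists_isFilleting_of_hasRake.{u} H P hP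
  obtain ⟨ε, hε, hr⟩ := SimpleGraph.exists_forall_hasRake.{u} k m
  exact ⟨ε, hε, fun V G hG => h V G (hr V G hG i j hij)⟩
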